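/- **Setting.** Let $T>0$, $\mu_0>0$, and let $\Gamma(t)$, $t\in[0,T]$, be closed (compact, without boundary), connected, oriented smooth surfaces in $\mathbb{R}^3$ that move smoothly in time, with unit outward normal $\nu(\cdot,t)$ and scalar outward normal velocity $V_\Gamma^N(\cdot,t)$. Put $S_T=\bigcup_{t\in(0,T)}\Gamma(t)\times\{t\}$. Let $\pi(\cdot,t)$ be the closest point mapping onto $\Gamma(t)$ and $d(\cdot,t)$ the signed distance from $\Gamma(t)$, increasing in the direction of $\nu$, so that $x=\pi(x,t)+d(x,t)\,\nu(\pi(x,t),t)$ near $\Gamma(t)$. On $\Gamma(t)$ let $P_\Gamma=I_3-\nu\otimes\nu$. For a vector field $w$ on $\Gamma(t)$ let $\nabla_\Gamma w=P_\Gamma\nabla\tilde w$, where $\tilde w$ is any extension of $w$ to a neighborhood (for instance $w\circ\pi$) and $(\nabla F)_{ij}=\partial_iF_j$. Let $D^{tan}(w)=\tfrac12\{\nabla_\Gamma w+(\nabla_\Gamma w)^T\}$ and $H=-\mathrm{div}_\Gamma\nu=-\mathrm{tr}\,\nabla_\Gamma\nu$. For $\varepsilon>0$ let $\Omega_\varepsilon(t)=\{x\in\mathbb{R}^3\mid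 \mathrm{dist}(x,\Gamma(t))<\varepsilon\}$, with unit outward normal $\nu_\varepsilon$ and outward normal velocity $V_\varepsilon^N$ of $\partial\Omega_\varepsilon(t)$. Write $D(u)=\tfrac12\{\nabla u+(\nabla u)^T\}$, $\sigma=2\mu_0D(u)-pI_3$ and $|M|^2=\sum_{i,j}M_{ij}^2$. Let $\mathcal{H}^2$ be the two-dimensional Hausdorff measure (normalized to be the surface area). **Theorem 5.6.** For all sufficiently small $\varepsilon>0$ let $u=u^\varepsilon$ (vector-valued) and $p=p^\varepsilon$ (scalar) be functions on $\bigcup_{t\in(0,T)}\overline{\Omega_\varepsilon(t)}\times\{t\}$, smooth up to the lateral boundary, with the expansions $$u^\varepsilon(x,t)=v(\pi,t)+d\,v^1(\pi,t)+d^2\,v^2(\pi,t)+R(d^3),\qquad p^\varepsilon(x,t)=q(\pi,t)+d\,q^1(\pi,t)+R(d^2),$$ where $\pi=\pi(x,t)$, $d=d(x,t)$, and $v,v^1,v^2,q,q^1$ are smooth on $S_T$ and independent of $\varepsilon$. Here $R(d^k)$ denotes a remainder all of whose space-time derivatives of order $l\le k$ are bounded on $\Omega_\varepsilon(t)$ by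 $C|d(x,t)|^{k-l}$, with $C$ independent of $\varepsilon$ and uniform for $t$ in compact subintervals of $(0,T)$. Suppose that for all sufficiently small $\varepsilon>0$ and all $t\in(0,T)$ the functions $u=u^\varepsilon$, $p=p^\varepsilon$ satisfy the energy identity $$\frac{d}{dt}\int_{\Omega_\varepsilon(t)}\frac{|u|^2}{2}\,dx=-2\mu_0\int_{\Omega_\varepsilon(t)}|D(u)|^2\,dx+\int_{\partial\Omega_\varepsilon(t)}(\sigma\nu_\varepsilon\cdot\nu_\varepsilon)V_\varepsilon^N\,d\mathcal{H}^2$$ and the boundary conditions $$u\cdot\nu_\varepsilon=V_\varepsilon^N,\qquad D(u)\nu_\varepsilon-(D(u)\nu_\varepsilon\cdot\nu_\varepsilon)\nu_\varepsilon=0\qquad\text{on }\partial\Omega_\varepsilon(t).$$ Then for every $t\in(0,T)$ the function $s\mapsto\int_{\Gamma(s)}\frac{|v|^2}{2}\,d\mathcal{H}^2$ is differentiable at $t$ and $$\frac{d}{dt}\int_{\Gamma(t)}\frac{|v|^2}{2}\,d\mathcal{H}^2=-2\mu_0\int_{\Gamma(t)}|P_\Gamma D^{tan}(v)P_\Gamma|^2\,d\mathcal{H}^2+\int_{\Gamma(t)}(qH-q^1)V_\Gamma^N\,d\mathcal{H}^2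 .$$ -/

import Mathlib

open Set Filter Topology MeasureTheory
open scoped ContDiff

namespace ThinFluid

noncomputable section

/-- Three-dimensional Euclidean space. -/
abbrev E3 : Type := EuclideanSpace ℝ (Fin 3)

/-- The `i`-th standard basis vector of `ℝ³`. -/
def e (i : Fin 3) : E3 := EuclideanSpace.single i 1

/-- A smoothly moving closed (compact, without boundary) connected oriented surface `Γ(t)`,
`t ∈ [0, T]`, in `ℝ³`, together with its unit outward normal `ν` and its scalar outward normal
velocity `V`. Only the values of `ν` and `V` on the surface matter.

Smoothness in space and time: near each of its points the space-time set
`⋃ t, Γ(t) × {t}` is the zero set of a smooth function `φ` with `∇ₓ φ ≠ 0`, chosen to increase in the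
direction of `ν`, so that `ν = ∇ₓ φ / |∇ₓ φ|` and `V = - ∂ₜ φ / |∇ₓ φ|`. -/
structure MovingSurface (T : ℝ) where
  /-- the surface at time `t` -/
  Γ : ℝ → Set E3
  /-- the unit outward normal vector field -/
  ν : E3 → ℝ → E3
  /-- the scalar outward normal velocity -/
  V : E3 → ℝ → ℝ
  isCompact_spaceTime : IsCompact {z : E3 × ℝ | z.2 ∈ Icc 0 T ∧ z.1 ∈ Γ z.2}
  isConnected : ∀ t ∈ Icc 0 T, IsConnected (Γ t)
  exists_defining : ∀ t₀ ∈ Icc 0 T, ∀ y₀ ∈ Γ t₀,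
    ∃ (W : Set (E3 × ℝ)) (φ : E3 × ℝ → ℝ), IsOpen W ∧ (y₀, t₀) ∈ W ∧ ContDiffOn ℝ ∞ φ W ∧
      ∀ x t, (x, t) ∈ W → t ∈ Icc 0 T →
        gradient (fun y => φ (y, t)) x ≠ 0 ∧
        (x ∈ Γ t ↔ φ (x, t) = 0) ∧
        (x ∈ Γ t →
          ν x t = ‖gradient (fun y => φ (y, t)) x‖⁻¹ • gradient (fun y => φ (y, t)) x ∧
          V x t = -(‖gradient (fun y => φ (y, t)) x‖⁻¹ * deriv (fun s => φ (x, s)) t))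
  /-- `ν` points into the unbounded component of the complement of `Γ(t)`. -/
  outward : ∀ t ∈ Icc 0 T, ∀ y ∈ Γ t, ∀ᶠ s : ℝ in 𝓝[>] 0,
    ¬ Bornology.IsBounded (connectedComponentIn (Γ t)ᶜ (y + s • ν y t))

/-- A point of `K` closest to `x` (the closest point, where it is unique). -/
def closestPoint (K : Set E3) (x : E3) : E3 :=
  open Classical in
  if h : ∃ y ∈ K, dist x y = Metric.infDist x K then h.choose else x

/-- The gradient matrix `(∇ F)ᵢⱼ = ∂ᵢ Fⱼ`. -/
def gradMatrix (F : E3 → E3) (x : E3) : Matrix (Fin 3) (Fin 3) ℝ :=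
  Matrix.of fun i j => (fderiv ℝ F x (e i)) j

/-- The strain rate tensor `D(F) = (∇ F + (∇ F)ᵀ) / 2`. -/
def strain (F : E3 → E3) (x : E3) : Matrix (Fin 3) (Fin 3) ℝ :=
  (1 / 2 : ℝ) • (gradMatrix F x + (gradMatrix F x).transpose)

/-- The square `|M|² = ∑ᵢⱼ Mᵢⱼ²` of the Frobenius norm. -/
def frobSq (M : Matrix (Fin 3) (Fin 3) ℝ) : ℝ := ∑ i, ∑ j, M i j ^ 2

/-- The vector `M a`. -/
def matVec (M : Matrix (Fin 3) (Fin 3) ℝ) (a : E3) : E3 := WithLp.toLp 2 (M.mulVec a.ofLp)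

namespace MovingSurface

variable {T : ℝ} (S : MovingSurface T)

/-- The space-time hypersurface `S_T = ⋃_{t ∈ (0,T)} Γ(t) × {t}`. -/
def spaceTime : Set (E3 × ℝ) := {z | z.2 ∈ Ioo 0 T ∧ z.1 ∈ S.Γ z.2}

/-- The closest point mapping `π(·, t)` onto `Γ(t)`. -/
def proj (x : E3) (t : ℝ) : E3 := closestPoint (S.Γ t) x

/-- The signed distance `d(·, t)` from `Γ(t)`, increasing in the direction of `ν`:
the coefficient `d` in `x = π(x,t) + d(x,t) ν(π(x,t),t)`. -/
def sdist (x : E3) (t : ℝ) : ℝ := inner ℝ (x - S.proj x t) (S.ν (S.proj x t) t)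

/-- The moving thin domain `Ω_ε(t) = {x | dist(x, Γ(t)) < ε}`. -/
def Ω (ε t : ℝ) : Set E3 := {x | Metric.infDist x (S.Γ t) < ε}

/-- The unit outward normal of `∂Ω_ε(t)`, `Ω_ε(t)` being the sublevel set `{dist(·, Γ(t)) < ε}`:
the normalized gradient of `dist(·, Γ(t))`. -/
def bdryNormal (x : E3) (t : ℝ) : E3 :=
  ‖gradient (fun y => Metric.infDist y (S.Γ t)) x‖⁻¹ •
    gradient (fun y => Metric.infDist y (S.Γ t)) x

/-- The scalar outward normal velocity of `∂Ω_ε(t)`, `Ω_ε(t)` being the sublevel set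
`{dist(·, Γ(t)) < ε}`. -/
def bdryVelocity (x : E3) (t : ℝ) : ℝ :=
  -(‖gradient (fun y => Metric.infDist y (S.Γ t)) x‖⁻¹ *
    deriv (fun s => Metric.infDist x (S.Γ s)) t)

/-- The orthogonal projection `P_Γ = I₃ - ν ⊗ ν` onto the tangent plane. -/
def tanProj (y : E3) (t : ℝ) : Matrix (Fin 3) (Fin 3) ℝ :=
  1 - Matrix.of fun i j => S.ν y t i * S.ν y t j

/-- The tangential gradient matrix `∇_Γ G = P_Γ ∇ G̃` of a vector field `G` on the surface, computed
with the extension `G̃ = G ∘ π` that is constant in the normal direction. -/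
def tanGrad (G : E3 → ℝ → E3) (y : E3) (t : ℝ) : Matrix (Fin 3) (Fin 3) ℝ :=
  S.tanProj y t * gradMatrix (fun x => G (S.proj x t) t) y

/-- The tangential strain rate `D^tan(G) = (∇_Γ G + (∇_Γ G)ᵀ) / 2`. -/
def tanStrain (G : E3 → ℝ → E3) (y : E3) (t : ℝ) : Matrix (Fin 3) (Fin 3) ℝ :=
  (1 / 2 : ℝ) • (S.tanGrad G y t + (S.tanGrad G y t).transpose)

/-- (Twice) the mean curvature `H = - div_Γ ν`. -/
def meanCurv (y : E3) (t : ℝ) : ℝ := -(S.tanGrad S.ν y t).trace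

/-- The family `f ε`, `0 < ε ≪ 1`, of functions on `⋃ t, closure Ω_ε(t) × {t}` is smooth up to the
lateral boundary (`f ε` is smooth near each of these points) and has the expansion
`f ε (x,t) = c₀(π(x,t),t) + d c₁(π(x,t),t) + ⋯ + d^(k-1) c_(k-1)(π(x,t),t) + R(d^k)`
with smooth coefficients `c_j` on `S_T` that do not depend on `ε`. Here `R(d^k)` stands for a
remainder whose space-time derivatives of order `l ≤ k` are bounded by `C |d|^(k-l)`, with `C`
independent of `ε` and locally uniform in time. -/
structure HasExpansion {F : Type*} [NormedAddCommGroup F] [NormedSpace ℝ F] {k : ℕ}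
    (f : ℝ → E3 → ℝ → F) (c : Fin k → E3 → ℝ → F) : Prop where
  smooth : ∀ᶠ ε : ℝ in 𝓝[>] 0, ∀ t ∈ Ioo 0 T, ∀ x ∈ closure (S.Ω ε t),
    ContDiffAt ℝ ∞ (Function.uncurry (f ε)) (x, t)
  coeff_smooth : ∀ j, ContDiffOn ℝ ∞ (Function.uncurry (c j)) S.spaceTime
  remainder : ∀ a b : ℝ, 0 < a → b < T → ∃ C : ℝ, ∀ᶠ ε : ℝ in 𝓝[>] 0,
    ∀ t ∈ Icc a b, ∀ x ∈ S.Ω ε t, ∀ l ≤ k,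
      ‖iteratedFDeriv ℝ l
          (fun z : E3 × ℝ =>
            f ε z.1 z.2 - ∑ j : Fin k, S.sdist z.1 z.2 ^ (j : ℕ) • c j (S.proj z.1 z.2) z.2)
          (x, t)‖ ≤ C * |S.sdist x t| ^ (k - l)

/-- The impermeability condition `u · ν_ε = V_ε` on `∂Ω_ε(t)`, `t ∈ (0,T)`. -/
def Impermeable (ε : ℝ) (u : E3 → ℝ → E3) : Prop :=
  ∀ t ∈ Ioo 0 T, ∀ x ∈ frontier (S.Ω ε t), inner ℝ (u x t) (S.bdryNormal x t) = S.bdryVelocity x t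

/-- The perfect slip condition `[D(u) ν_ε]_tan = 0` on `∂Ω_ε(t)`, `t ∈ (0,T)`, where
`[a]_tan = a - (a · ν_ε) ν_ε`. -/
def PerfectSlip (ε : ℝ) (u : E3 → ℝ → E3) : Prop :=
  ∀ t ∈ Ioo 0 T, ∀ x ∈ frontier (S.Ω ε t),
    matVec (strain (fun y => u y t) x) (S.bdryNormal x t) -
      inner ℝ (matVec (strain (fun y => u y t) x) (S.bdryNormal x t)) (S.bdryNormal x t) •
        S.bdryNormal x t = 0

/-- The Cauchy stress tensor `σ = 2 μ₀ D(u) - p I₃`. -/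
def stress (μ₀ : ℝ) (u : E3 → ℝ → E3) (p : E3 → ℝ → ℝ) (x : E3) (t : ℝ) :
    Matrix (Fin 3) (Fin 3) ℝ :=
  (2 * μ₀) • strain (fun y => u y t) x - p x t • (1 : Matrix (Fin 3) (Fin 3) ℝ)

/-- The energy identity of the Navier-Stokes equations in `Ω_ε(t)`, `t ∈ (0,T)`:
`d/dt ∫_{Ω_ε} |u|²/2 = - 2 μ₀ ∫_{Ω_ε} |D(u)|² + ∫_{∂Ω_ε} (σ ν_ε · ν_ε) V_ε dℋ²`. -/
def BulkEnergyIdentity (μ₀ ε : ℝ) (u : E3 → ℝ → E3) (p : E3 → ℝ → ℝ) : Prop :=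
  ∀ t ∈ Ioo 0 T,
    HasDerivAt (fun s => ∫ x in S.Ω ε s, ‖u x s‖ ^ 2 / 2)
      (-(2 * μ₀) * (∫ x in S.Ω ε t, frobSq (strain (fun y => u y t) x)) +
        ∫ x in frontier (S.Ω ε t),
          inner ℝ (matVec (stress μ₀ u p x t) (S.bdryNormal x t)) (S.bdryNormal x t) *
            S.bdryVelocity x t ∂μHE[2])
      t

/-- The energy identity on `Γ(t)`, `t ∈ (0,T)`:
`d/dt ∫_Γ |v|²/2 dℋ² = - 2 μ₀ ∫_Γ |P_Γ D^tan(v) P_Γ|² dℋ² + ∫_Γ (q H - q¹) V dℋ²`. -/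
def SurfaceEnergyIdentity (μ₀ : ℝ) (v : E3 → ℝ → E3) (q q1 : E3 → ℝ → ℝ) : Prop :=
  ∀ t ∈ Ioo 0 T,
    HasDerivAt (fun s => ∫ y in S.Γ s, ‖v y s‖ ^ 2 / 2 ∂μHE[2])
      (-(2 * μ₀) *
          (∫ y in S.Γ t, frobSq (S.tanProj y t * S.tanStrain v y t * S.tanProj y t) ∂μHE[2]) +
        ∫ y in S.Γ t, (q y t * S.meanCurv y t - q1 y t) * S.V y t ∂μHE[2])
      t

end MovingSurface

end

end ThinFluid

/-! Multiply the bulk energy identity by `(2 * ε)⁻¹` and let `ε → 0`. If the rescaled kinetic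
energies converge pointwise and their time derivatives converge uniformly near `t`, the limit is
differentiable with the limiting derivative. So three limits, uniform for times in a compact
interval, suffice: `Tube.tendsto_energy`, `Tube.tendsto_dissipation` and `Tube.tendsto_boundary`.

All integrals are moved to the surface by the normal coordinates `(y, r) ↦ y + r ν(y)`, whose
Jacobian is `det (1 + r ∇ν) = 1 - r H + O(r²)`. In the volume terms only the convergence of the
Jacobian to `1` matters. In the boundary term the sheets `r = ±ε` carry velocities `±V`, so dividing
by `2ε` produces a difference quotient and first-order terms count. The normal stress is `-(q + r
q1) + O(r²)`, and half the difference of `-(1 - r H)(q + r q1)` between the two sheets is `ε (q H -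
q1)`, which gives the stated density.

The boundary conditions enter through the expansion. Impermeability on both sheets gives `v · ν = V`
and `v1 · ν = v2 · ν = 0` (`inner_coeff_eq`), so the viscous part of the normal stress is `O(ε²)`.
Perfect slip then yields `D ν = 0` on `Γ` for the limiting strain `D` (`matVec_strainOf_normal`).
Since `D` differs from the tangential strain of `v` only by a symmetrised product of `ν` and `v1`,
which the projection annihilates, `D = P D^tan(v) P` (`strainOf_expansion_surface`).

Two foundations carry this. The change of variables for Hausdorff measure compares the displacement
locally with a linear map over the tangent plane, up to bi-Lipschitz constants close to one
(`NormalField.exists_nhds_bilipschitz`), and recovers the density from these local ratios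
(`measure_eq_setLIntegral_of_locally`). Regularity of the closest point and the signed distance
comes from the inverse function theorem (`exists_normal_coordinates`, `eventually_regularAt`), and
compactness in space-time makes the tube uniform (`exists_tube`). -/

namespace ThinFluid

noncomputable section

open scoped ENNReal NNReal

/-! ### Lipschitz comparison of Hausdorff measures -/

section Hausdorff

/-- Comparison of Hausdorff measures of two images of the same set. -/
theorem euclideanHausdorffMeasure_image_le_mul {α X Y : Type*} [MetricSpace X] [MeasurableSpace X]
    [BorelSpace X] [MetricSpace Y] [MeasurableSpace Y] [BorelSpace Y] (d : ℕ) {f : α → X}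
    {g : α → Y} {S : Set α} {K : ℝ≥0}
    (h : ∀ a ∈ S, ∀ b ∈ S, dist (f a) (f b) ≤ K * dist (g a) (g b)) :
    μHE[d] (f '' S) ≤ (K : ℝ≥0∞) ^ d * μHE[d] (g '' S) := by
  rcases S.eq_empty_or_nonempty with rfl | ⟨a₀, ha₀⟩
  · simp
  have : Nonempty α := ⟨a₀⟩
  have hinv : ∀ a ∈ S, f (Function.invFunOn g S (g a)) = f a := by
    intro a ha
    have hm : Function.invFunOn g S (g a) ∈ S := Function.invFunOn_mem ⟨a, ha, rfl⟩
    have he : g (Function.invFunOn g S (g a)) = g a := Function.invFunOn_eq ⟨a, ha, rfl⟩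
    have := h _ hm _ ha
    rw [he, dist_self, mul_zero] at this
    exact dist_le_zero.1 this
  have hlip : LipschitzOnWith K (fun y => f (Function.invFunOn g S y)) (g '' S) := by
    apply LipschitzOnWith.of_dist_le_mul
    rintro _ ⟨a, ha, rfl⟩ _ ⟨b, hb, rfl⟩
    simp only [hinv a ha, hinv b hb]
    exact h a ha b hb
  have himg : (fun y => f (Function.invFunOn g S y)) '' (g '' S) = f '' S := by
    rw [image_image]
    exact image_congr hinv
  have := hlip.hausdorffMeasure_image_le (d := d) (Nat.cast_nonneg d)
  rw [himg, ENNReal.rpow_natCast] at this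
  simp only [Measure.euclideanHausdorffMeasure_def, Measure.smul_apply, ENNReal.smul_def,
    smul_eq_mul]
  calc _ ≤ _ := mul_le_mul_right this _
    _ = _ := by ring

end Hausdorff

/-! ### Recovering a density from local ratios of measures -/

section LocalComparison

variable {X : Type*} [TopologicalSpace X] [SecondCountableTopology X] [MeasurableSpace X]
  [OpensMeasurableSpace X]

/-- Second countability reduces the cover to a countable one; making it disjoint lets the local
inequalities be summed without losing a factor. -/
theorem measure_le_mul_of_locally {μ ν : Measure X} {B : Set X} {c : ℝ≥0∞}
    (h : ∀ x ∈ B, ∃ U ∈ 𝓝 x, ∀ S, MeasurableSet S → S ⊆ U ∩ B → μ S ≤ c * ν S) {S : Set X}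
    (hS : MeasurableSet S) (hSB : S ⊆ B) : μ S ≤ c * ν S := by
  choose! U hU hloc using h
  obtain ⟨D, hDB, hDc, hD⟩ := TopologicalSpace.countable_cover_nhdsWithin
    (s := B) (f := fun x => interior (U x))
    (fun x hx => mem_nhdsWithin_of_mem_nhds (interior_mem_nhds.2 (hU x hx)))
  rcases D.eq_empty_or_nonempty with rfl | hne
  · have : S = ∅ := by
      apply subset_empty_iff.1
      simpa using hSB.trans hD
    simp [this]
  obtain ⟨e, rfl⟩ := hDc.exists_eq_range hne
  set V : ℕ → Set X := fun n => interior (U (e n)) with hV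
  have hVm : ∀ n, MeasurableSet (disjointed V n) :=
    fun n => MeasurableSet.disjointed (fun n => isOpen_interior.measurableSet) n
  have hcov : S = ⋃ n, S ∩ disjointed V n := by
    rw [← inter_iUnion, iUnion_disjointed, eq_comm, inter_eq_left]
    refine hSB.trans (hD.trans ?_)
    simp [hV]
  have hdisj : Pairwise (Function.onFun Disjoint fun n => S ∩ disjointed V n) := fun i j hij =>
    (disjoint_disjointed V hij).mono inter_subset_right inter_subset_right
  rw [hcov, measure_iUnion hdisj (fun n => hS.inter (hVm n)),
    measure_iUnion hdisj (fun n => hS.inter (hVm n)), ← ENNReal.tsum_mul_left]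
  refine ENNReal.tsum_le_tsum fun n => hloc _ (hDB ⟨n, rfl⟩) _ (hS.inter (hVm n)) ?_
  exact subset_inter (inter_subset_right.trans ((disjointed_subset V n).trans interior_subset))
    (inter_subset_left.trans hSB)

/-- A measure is determined by its infinitesimal ratio to another measure. -/
theorem measure_eq_setLIntegral_of_locally {μ ν : Measure X} {B : Set X}
    {J : X → ℝ≥0} (hJ : ContinuousOn J B) (hJpos : ∀ x ∈ B, 0 < J x)
    (h : ∀ x ∈ B, ∀ c : ℝ≥0, 1 < c → ∃ U ∈ 𝓝 x, ∀ S, MeasurableSet S → S ⊆ U ∩ B →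
      μ S ≤ c * (J x * ν S) ∧ J x * ν S ≤ c * μ S) {S : Set X}
    (hS : MeasurableSet S) (hSB : S ⊆ B) : μ S = ∫⁻ x in S, J x ∂ν := by
  -- One factor `c` is the loss in the hypothesis, the other is the oscillation of `J` near `x`.
  have key : ∀ c : ℝ≥0, 1 < c → ∀ x ∈ B, ∃ U ∈ 𝓝 x, ∀ S, MeasurableSet S → S ⊆ U ∩ B →
      μ S ≤ (c * c : ℝ≥0) * (ν.withDensity fun x => J x) S ∧
        (ν.withDensity fun x => J x) S ≤ (c * c : ℝ≥0) * μ S := by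
    intro c hc x hx
    obtain ⟨U, hU, hloc⟩ := h x hx c hc
    have hc0 : 0 < c := one_pos.trans hc
    have h1 : ∀ᶠ y in 𝓝[B] x, J y < c * J x :=
      (hJ x hx).eventually_lt_const (by nlinarith [hJpos x hx])
    have h2 : ∀ᶠ y in 𝓝[B] x, c⁻¹ * J x < J y :=
      (hJ x hx).eventually_const_lt (by
        have : c⁻¹ < 1 := inv_lt_one_of_one_lt₀ hc
        nlinarith [hJpos x hx])
    have h12 := h1.and h2
    rw [eventually_nhdsWithin_iff] at h12
    refine ⟨U ∩ {y | y ∈ B → J y < c * J x ∧ c⁻¹ * J x < J y}, inter_mem hU h12, ?_⟩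
    intro S hS hSU
    obtain ⟨ha, hb⟩ := hloc S hS (fun y hy => ⟨(hSU hy).1.1, (hSU hy).2⟩)
    have hup : (ν.withDensity fun x => (J x : ℝ≥0∞)) S ≤ c * (J x * ν S) := by
      rw [withDensity_apply _ hS, ← mul_assoc, ← setLIntegral_const]
      refine setLIntegral_mono' hS fun y hy => ?_
      exact_mod_cast ((hSU hy).1.2 (hSU hy).2).1.le
    have hlow : J x * ν S ≤ c * (ν.withDensity fun x => (J x : ℝ≥0∞)) S := by
      rw [withDensity_apply _ hS, ← setLIntegral_const, ← lintegral_const_mul' _ _ (by simp)]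
      refine setLIntegral_mono' hS fun y hy => ?_
      have := ((hSU hy).1.2 (hSU hy).2).2.le
      rw [inv_mul_le_iff₀ hc0] at this
      exact_mod_cast this
    constructor
    · refine ha.trans ?_
      rw [ENNReal.coe_mul, mul_assoc]
      gcongr
    · refine hup.trans ?_
      rw [ENNReal.coe_mul, mul_assoc]
      gcongr
  -- The factor survives globalisation unchanged, so it can be sent to `1` afterwards.
  have lim : ∀ a b : ℝ≥0∞, (∀ c : ℝ≥0, 1 < c → a ≤ (c * c : ℝ≥0) * b) → a ≤ b := by
    intro a b hab
    have ht : Tendsto (fun c : ℝ≥0 => ((c * c : ℝ≥0) : ℝ≥0∞) * b) (𝓝[>] 1) (𝓝 (((1 * 1 : ℝ≥0) : ℝ≥0∞) * b)) := by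
      refine ENNReal.Tendsto.mul_const ?_ (Or.inl (by simp))
      exact ENNReal.tendsto_coe.2 (((continuous_id.mul continuous_id).tendsto (1 : ℝ≥0)).mono_left
        nhdsWithin_le_nhds)
    simp only [mul_one, ENNReal.coe_one, one_mul] at ht
    refine ge_of_tendsto ht ?_
    filter_upwards [self_mem_nhdsWithin] with c hc using hab c hc
  rw [← withDensity_apply _ hS]
  apply le_antisymm
  · refine lim _ _ fun c hc => measure_le_mul_of_locally (fun x hx => ?_) hS hSB
    obtain ⟨U, hU, hloc⟩ := key c hc x hx
    exact ⟨U, hU, fun S hS hSU => (hloc S hS hSU).1⟩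
  · refine lim _ _ fun c hc => measure_le_mul_of_locally (fun x hx => ?_) hS hSB
    obtain ⟨U, hU, hloc⟩ := key c hc x hx
    exact ⟨U, hU, fun S hS hSU => (hloc S hS hSU).2⟩

end LocalComparison

end

end ThinFluid

namespace ThinFluid

noncomputable section

open scoped ENNReal NNReal

/-! ### Areas in a plane computed as volumes of cylinders -/

section Plane

/-- The orthogonal projection onto the plane orthogonal to the unit vector `n`. -/
def planeProj (n : E3) : E3 →L[ℝ] E3 :=
  ContinuousLinearMap.id ℝ E3 - (innerSL ℝ n).smulRight n

theorem planeProj_apply (n x : E3) : planeProj n x = x - inner ℝ n x • n := by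
  simp [planeProj]

theorem inner_planeProj {n : E3} (hn : ‖n‖ = 1) (x : E3) : inner ℝ n (planeProj n x) = 0 := by
  rw [planeProj_apply, inner_sub_right, inner_smul_right, real_inner_self_eq_norm_sq, hn]
  ring

theorem planeProj_self {n : E3} (hn : ‖n‖ = 1) : planeProj n n = 0 := by
  rw [planeProj_apply, real_inner_self_eq_norm_sq, hn]
  simp

theorem planeProj_of_inner_eq_zero {n x : E3} (h : inner ℝ n x = 0) : planeProj n x = x := by
  rw [planeProj_apply, h, zero_smul, sub_zero]

theorem norm_planeProj_add_smul_sq {n : E3} (hn : ‖n‖ = 1) (x : E3) (r : ℝ) :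
    ‖planeProj n x + r • n‖ ^ 2 = ‖planeProj n x‖ ^ 2 + r ^ 2 := by
  rw [norm_add_sq_real, inner_smul_right, real_inner_comm, inner_planeProj hn, norm_smul, hn]
  simp

theorem norm_planeProj_sq {n : E3} (hn : ‖n‖ = 1) (x : E3) :
    ‖x‖ ^ 2 = ‖planeProj n x‖ ^ 2 + (inner ℝ n x) ^ 2 := by
  rw [← norm_planeProj_add_smul_sq hn, planeProj_apply, sub_add_cancel]

theorem norm_planeProj_le {n : E3} (hn : ‖n‖ = 1) (x : E3) : ‖planeProj n x‖ ≤ ‖x‖ := by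
  have := norm_planeProj_sq hn x
  exact le_of_sq_le_sq (by nlinarith [sq_nonneg (inner ℝ n x)]) (norm_nonneg _)

/-- Fubini over parallel planes, which fixes the normalisation linking planar Hausdorff measure to
Lebesgue measure. -/
theorem volume_eq_lintegral_slice {n : E3} (hn : ‖n‖ = 1) {t : Set E3} (ht : MeasurableSet t) :
    volume t = ∫⁻ r : ℝ, μHE[2] (t ∩ {x | inner ℝ n x = r}) := by
  have h := EuclideanGeometry.euclideanHausdorffMeasure_eq_lintegral (0 : E3) (v := n)
    (by rintro rfl; simp at hn) ht
  have h3 : Module.finrank ℝ E3 = 3 := by simp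
  rw [h3, EuclideanSpace.euclideanHausdorffMeasure_eq_volume] at h
  rw [h]
  have : ‖n‖ₑ = 1 := by rw [← ofReal_norm, hn]; simp
  rw [this, one_mul]
  refine lintegral_congr fun r => ?_
  congr 2
  ext x
  simp only [vadd_eq_add, add_zero, SetLike.mem_coe, AffineSubspace.mem_mk', vsub_eq_sub,
    Submodule.mem_orthogonal_singleton_iff_inner_right, inner_sub_right, inner_smul_right,
    real_inner_self_eq_norm_sq, hn, mem_ofPred_eq]
  constructor <;> intro h <;> linarith

/-- The flattening map `(y, r) ↦ P y + r n`. -/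
def flatten (n : E3) (z : E3 × ℝ) : E3 := planeProj n z.1 + z.2 • n

theorem continuous_flatten (n : E3) : Continuous (flatten n) := by
  unfold flatten
  fun_prop

theorem flatten_inter_slice {n : E3} (hn : ‖n‖ = 1) (S : Set (E3 × ℝ)) (r : ℝ) :
    flatten n '' S ∩ {x | inner ℝ n x = r} =
      (fun x => r • n + x) '' (planeProj n '' ((fun y => (y, r)) ⁻¹' S)) := by
  have key : ∀ z : E3 × ℝ, inner ℝ n (flatten n z) = z.2 := by
    intro z
    rw [flatten, inner_add_right, inner_planeProj hn, inner_smul_right, real_inner_self_eq_norm_sq,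
      hn]
    ring
  ext x
  constructor
  · rintro ⟨⟨z, hz, rfl⟩, hx⟩
    rw [mem_ofPred_eq, key] at hx
    subst hx
    exact ⟨_, ⟨z.1, hz, rfl⟩, by simp [flatten, add_comm]⟩
  · rintro ⟨_, ⟨y, hy, rfl⟩, rfl⟩
    have : r • n + planeProj n y = flatten n (y, r) := by simp [flatten, add_comm]
    simp only [this]
    exact ⟨⟨_, hy, rfl⟩, key _⟩

theorem volume_flatten_image {n : E3} (hn : ‖n‖ = 1) {S : Set (E3 × ℝ)}
    (hS : MeasurableSet (flatten n '' S)) :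
    volume (flatten n '' S) = ∫⁻ r : ℝ, μHE[2] (planeProj n '' ((fun y => (y, r)) ⁻¹' S)) := by
  rw [volume_eq_lintegral_slice hn hS]
  refine lintegral_congr fun r => ?_
  rw [flatten_inter_slice hn]
  exact (isometry_add_left (r • n)).euclideanHausdorffMeasure_image _

/-- The cylinder of height one over a subset of the plane orthogonal to `n`. -/
def cylinder (n : E3) (X : Set E3) : Set E3 := {x | planeProj n x ∈ X ∧ inner ℝ n x ∈ Icc (0 : ℝ) 1}

theorem measurableSet_cylinder (n : E3) {X : Set E3} (hX : MeasurableSet X) :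
    MeasurableSet (cylinder n X) :=
  ((planeProj n).continuous.measurable hX).inter
    ((innerSL ℝ n).continuous.measurable measurableSet_Icc)

theorem cylinder_eq_flatten_image {n : E3} (hn : ‖n‖ = 1) {X : Set E3}
    (hX0 : ∀ x ∈ X, inner ℝ n x = 0) : cylinder n X = flatten n '' (X ×ˢ Icc 0 1) := by
  ext x
  constructor
  · rintro ⟨h1, h2⟩
    refine ⟨(planeProj n x, inner ℝ n x), ⟨h1, h2⟩, ?_⟩
    simp only [flatten]
    rw [planeProj_of_inner_eq_zero (inner_planeProj hn x), planeProj_apply, sub_add_cancel]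
  · rintro ⟨⟨y, r⟩, ⟨hy, hr⟩, rfl⟩
    simp only [cylinder, flatten, mem_ofPred_eq]
    rw [planeProj_of_inner_eq_zero (hX0 y hy), map_add, map_smul, planeProj_self hn,
      planeProj_of_inner_eq_zero (hX0 y hy), inner_add_right, hX0 y hy, inner_smul_right,
      real_inner_self_eq_norm_sq, hn]
    simpa using ⟨hy, hr⟩

theorem volume_cylinder {n : E3} (hn : ‖n‖ = 1) {X : Set E3} (hX : MeasurableSet X)
    (hX0 : ∀ x ∈ X, inner ℝ n x = 0) : volume (cylinder n X) = μHE[2] X := by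
  have hm := measurableSet_cylinder n hX
  rw [cylinder_eq_flatten_image hn hX0] at hm ⊢
  rw [volume_flatten_image hn hm]
  have : ∀ r : ℝ, μHE[2] (planeProj n '' ((fun y => (y, r)) ⁻¹' (X ×ˢ Icc 0 1))) =
      (Icc (0 : ℝ) 1).indicator (fun _ => μHE[2] X) r := by
    intro r
    by_cases hr : r ∈ Icc (0 : ℝ) 1
    · rw [indicator_of_mem hr]
      congr 1
      have : (fun y : E3 => (y, r)) ⁻¹' (X ×ˢ Icc 0 1) = X := by
        ext y
        simp only [mem_preimage, mem_prod, hr, and_true]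
      rw [this]
      conv_rhs => rw [← image_id X]
      exact image_congr fun x hx => planeProj_of_inner_eq_zero (hX0 x hx)
    · rw [indicator_of_notMem hr]
      have : (fun y : E3 => (y, r)) ⁻¹' (X ×ˢ Icc 0 1) = ∅ := by
        ext y
        simp only [mem_preimage, mem_prod, hr, and_false, mem_empty_iff_false]
      simp [this]
  simp_rw [this]
  rw [lintegral_indicator measurableSet_Icc]
  simp

theorem injective_of_det_ne_zero {L : E3 →L[ℝ] E3} (h : L.det ≠ 0) : Function.Injective L :=
  (L.toContinuousLinearEquivOfDetNeZero h).injective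

/-- Because `L` fixes `n` and preserves the height along `n`, it maps the unit cylinder over `X`
onto the unit cylinder over `L '' X`. The three-dimensional determinant formula therefore computes
the area ratio. -/
theorem measure_image_plane {n : E3} (hn : ‖n‖ = 1) {L : E3 →L[ℝ] E3} (hdet : L.det ≠ 0)
    (hLn : L n = n) (hnL : ∀ x, inner ℝ n (L x) = inner ℝ n x) {X : Set E3} (hX : MeasurableSet X)
    (hX0 : ∀ x ∈ X, inner ℝ n x = 0) :
    μHE[2] (L '' X) = ENNReal.ofReal |L.det| * μHE[2] X := by
  have hLX : MeasurableSet (L '' X) :=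
    hX.image_of_continuousOn_injOn L.continuous.continuousOn (injective_of_det_ne_zero hdet).injOn
  have hLX0 : ∀ x ∈ L '' X, inner ℝ n x = 0 := by
    rintro _ ⟨x, hx, rfl⟩
    rw [hnL, hX0 x hx]
  rw [← volume_cylinder hn hX hX0, ← volume_cylinder hn hLX hLX0,
    ← Measure.addHaar_image_continuousLinearMap]
  congr 1
  ext x
  constructor
  · rintro ⟨⟨z, hz, hzx⟩, hx⟩
    have h0 := hX0 z hz
    have hPz := planeProj_of_inner_eq_zero h0
    refine ⟨z + inner ℝ n x • n, ⟨?_, ?_⟩, ?_⟩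
    · rwa [map_add, map_smul, planeProj_self hn, smul_zero, add_zero, hPz]
    · rwa [inner_add_right, h0, inner_smul_right, real_inner_self_eq_norm_sq, hn, zero_add,
        one_pow, mul_one]
    · rw [map_add, map_smul, hLn, hzx, planeProj_apply, sub_add_cancel]
  · rintro ⟨w, ⟨hw, hw'⟩, rfl⟩
    refine ⟨⟨_, hw, ?_⟩, by rwa [hnL]⟩
    rw [planeProj_apply, planeProj_apply, map_sub, map_smul, hLn, hnL]

end Plane

end

end ThinFluid

/-! ### Infinitesimal geometry of the normal displacement -/

namespace ThinFluid

noncomputable section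

open scoped ENNReal NNReal

/-- `N` restricts to a unit normal field of the compact `C²` surface `Γ`, with derivative `A`. -/
structure NormalField (Γ : Set E3) (N : E3 → E3) (A : E3 → E3 →L[ℝ] E3) : Prop where
  isCompact : IsCompact Γ
  norm_eq_one : ∀ y ∈ Γ, ‖N y‖ = 1
  hasStrictFDerivAt : ∀ y ∈ Γ, HasStrictFDerivAt N (A y) y
  deriv_normal : ∀ y ∈ Γ, A y (N y) = 0
  inner_deriv : ∀ y ∈ Γ, ∀ h, inner ℝ (N y) (A y h) = 0
  continuousOn_deriv : ContinuousOn A Γ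
  flat : ∀ y ∈ Γ, ∀ δ > 0, ∀ᶠ p : E3 × E3 in 𝓝 (y, y), p.1 ∈ Γ → p.2 ∈ Γ →
    |inner ℝ (N y) (p.1 - p.2)| ≤ δ * ‖p.1 - p.2‖

/-- The normal displacement `(y, r) ↦ y + r N(y)`. -/
def displace (N : E3 → E3) (z : E3 × ℝ) : E3 := z.1 + z.2 • N z.1

/-- The tangential derivative `1 + r A` of the normal displacement. -/
def displaceDeriv (A : E3 → E3 →L[ℝ] E3) (z : E3 × ℝ) : E3 →L[ℝ] E3 :=
  ContinuousLinearMap.id ℝ E3 + z.2 • A z.1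

/-- The Jacobian of the normal displacement. -/
def displaceJac (A : E3 → E3 →L[ℝ] E3) (z : E3 × ℝ) : ℝ≥0 := ‖(displaceDeriv A z).det‖₊

namespace NormalField

variable {Γ : Set E3} {N : E3 → E3} {A : E3 → E3 →L[ℝ] E3} (hN : NormalField Γ N A)
include hN

theorem continuousOn_normal : ContinuousOn N Γ := fun y hy =>
  (hN.hasStrictFDerivAt y hy).continuousAt.continuousWithinAt

theorem continuousOn_displace : ContinuousOn (displace N) (Γ ×ˢ univ) := by
  unfold displace
  refine continuousOn_fst.add (continuousOn_snd.smul ?_)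
  exact hN.continuousOn_normal.comp continuousOn_fst (fun z hz => hz.1)

theorem continuousOn_displaceJac : ContinuousOn (displaceJac A) (Γ ×ˢ univ) := by
  unfold displaceJac displaceDeriv
  have h : ContinuousOn (fun z : E3 × ℝ => ContinuousLinearMap.id ℝ E3 + z.2 • A z.1)
      (Γ ×ˢ univ) := by
    refine continuousOn_const.add (continuousOn_snd.smul ?_)
    exact hN.continuousOn_deriv.comp continuousOn_fst (fun z hz => hz.1)
  exact ((ContinuousLinearMap.continuous_det (𝕜 := ℝ) (E := E3)).comp_continuousOn h).nnnorm

theorem displaceDeriv_normal {y : E3} (hy : y ∈ Γ) (r : ℝ) :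
    displaceDeriv A (y, r) (N y) = N y := by
  simp [displaceDeriv, hN.deriv_normal y hy]

theorem inner_displaceDeriv {y : E3} (hy : y ∈ Γ) (r : ℝ) (x : E3) :
    inner ℝ (N y) (displaceDeriv A (y, r) x) = inner ℝ (N y) x := by
  simp [displaceDeriv, inner_add_right, inner_smul_right, hN.inner_deriv y hy]

theorem hasStrictFDerivAt_displace {y : E3} (hy : y ∈ Γ) (r : ℝ) :
    HasStrictFDerivAt (displace N)
      ((displaceDeriv A (y, r)).comp (ContinuousLinearMap.fst ℝ E3 ℝ) +
        (ContinuousLinearMap.snd ℝ E3 ℝ).smulRight (N y)) (y, r) := by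
  have h1 : HasStrictFDerivAt (fun z : E3 × ℝ => N z.1)
      ((A y).comp (ContinuousLinearMap.fst ℝ E3 ℝ)) (y, r) :=
    HasStrictFDerivAt.comp (f := Prod.fst) (y, r) (hN.hasStrictFDerivAt y hy) hasStrictFDerivAt_fst
  have h2 := (hasStrictFDerivAt_fst (𝕜 := ℝ) (p := (y, r))).add
    ((hasStrictFDerivAt_snd (𝕜 := ℝ) (p := (y, r))).smul h1)
  convert! h2 using 1
  ext z <;> simp [displaceDeriv]

/-- As `displaceDeriv` fixes the normal, composing it with `flatten` differs from the strict
derivative of `displace` only by the normal component of the chord. Flatness of the surface makes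
that component negligible. -/
theorem flatten_approx {y : E3} (hy : y ∈ Γ) (r : ℝ) {δ : ℝ} (hδ : 0 < δ) :
    ∀ᶠ p : (E3 × ℝ) × (E3 × ℝ) in 𝓝 ((y, r), (y, r)), p.1.1 ∈ Γ → p.2.1 ∈ Γ →
      ‖displace N p.1 - displace N p.2 -
        displaceDeriv A (y, r) (flatten (N y) p.1 - flatten (N y) p.2)‖ ≤ δ * ‖p.1 - p.2‖ := by
  have h1 := (hN.hasStrictFDerivAt_displace hy r).isLittleO.bound (half_pos hδ)
  have hc : Tendsto (fun p : (E3 × ℝ) × (E3 × ℝ) => (p.1.1, p.2.1)) (𝓝 ((y, r), (y, r)))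
      (𝓝 (y, y)) := by
    have : Continuous (fun p : (E3 × ℝ) × (E3 × ℝ) => (p.1.1, p.2.1)) := by fun_prop
    exact this.tendsto _
  filter_upwards [h1, hc.eventually (hN.flat y hy _ (half_pos hδ))] with p hp1 hp2 hpa hpb
  have hp2 := hp2 hpa hpb
  have e : displace N p.1 - displace N p.2 -
        displaceDeriv A (y, r) (flatten (N y) p.1 - flatten (N y) p.2) =
      (displace N p.1 - displace N p.2 - ((displaceDeriv A (y, r)).comp
        (ContinuousLinearMap.fst ℝ E3 ℝ) + (ContinuousLinearMap.snd ℝ E3 ℝ).smulRight (N y))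
          (p.1 - p.2)) + inner ℝ (N y) (p.1.1 - p.2.1) • N y := by
    have : flatten (N y) p.1 - flatten (N y) p.2 = (p.1.1 - p.2.1) -
        inner ℝ (N y) (p.1.1 - p.2.1) • N y + (p.1.2 - p.2.2) • N y := by
      simp only [flatten, planeProj_apply, inner_sub_right]
      module
    rw [this, map_add, map_sub, map_smul, map_smul, hN.displaceDeriv_normal hy]
    simp
    module
  rw [e]
  refine (norm_add_le _ _).trans ?_
  rw [norm_smul, hN.norm_eq_one y hy, mul_one, Real.norm_eq_abs]
  have : ‖p.1.1 - p.2.1‖ ≤ ‖p.1 - p.2‖ := norm_fst_le (p.1 - p.2)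
  nlinarith

/-- Short chords of the surface are almost tangential, so the tangent projection nearly preserves
their length. -/
theorem norm_sub_le_planeProj {y : E3} (hy : y ∈ Γ) {K : ℝ} (hK : 1 < K) :
    ∀ᶠ p : E3 × E3 in 𝓝 (y, y), p.1 ∈ Γ → p.2 ∈ Γ →
      ‖p.1 - p.2‖ ≤ K * ‖planeProj (N y) (p.1 - p.2)‖ := by
  have hδ : 0 < 1 - K⁻¹ := sub_pos.2 (inv_lt_one_of_one_lt₀ hK)
  filter_upwards [hN.flat y hy _ hδ] with p hp h1 h2
  have hp := hp h1 h2
  set x := p.1 - p.2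
  have h3 : ‖x‖ ≤ ‖planeProj (N y) x‖ + |inner ℝ (N y) x| := by
    have : x = planeProj (N y) x + inner ℝ (N y) x • N y := by
      rw [planeProj_apply, sub_add_cancel]
    calc ‖x‖ = ‖planeProj (N y) x + inner ℝ (N y) x • N y‖ := by rw [← this]
      _ ≤ _ := norm_add_le _ _
      _ = _ := by rw [norm_smul, hN.norm_eq_one y hy, mul_one, Real.norm_eq_abs]
  have h4 : K⁻¹ * ‖x‖ ≤ ‖planeProj (N y) x‖ := by linarith
  rwa [inv_mul_le_iff₀ (by linarith)] at h4

/-- Near a point of the surface, the normal displacement and the linearized flattened displacement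
differ by a bi-Lipschitz change with constant close to one. -/
theorem exists_nhds_bilipschitz {y : E3} (hy : y ∈ Γ) {r : ℝ}
    (hdet : (displaceDeriv A (y, r)).det ≠ 0) {K : ℝ} (hK : 1 < K) :
    ∃ U ∈ 𝓝 (y, r), ∀ a ∈ U ∩ Γ ×ˢ univ, ∀ b ∈ U ∩ Γ ×ˢ univ,
      ‖displace N a - displace N b‖ ≤
        K * ‖displaceDeriv A (y, r) (flatten (N y) a - flatten (N y) b)‖ ∧
      ‖displaceDeriv A (y, r) (flatten (N y) a - flatten (N y) b)‖ ≤
        K * ‖displace N a - displace N b‖ ∧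
      ‖a.1 - b.1‖ ≤ K * ‖planeProj (N y) (a.1 - b.1)‖ := by
  set L := displaceDeriv A (y, r) with hL
  obtain ⟨m, hm, hLm⟩ : ∃ m > 0, ∀ x, ‖x‖ ≤ m * ‖L x‖ := by
    set e := L.toContinuousLinearEquivOfDetNeZero hdet
    refine ⟨‖(e.symm : E3 →L[ℝ] E3)‖ + 1, by positivity, fun x => ?_⟩
    have h1 : e.symm (L x) = x := e.symm_apply_apply x
    have h2 := (e.symm : E3 →L[ℝ] E3).le_opNorm (L x)
    simp only [ContinuousLinearEquiv.coe_coe, h1] at h2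
    nlinarith [norm_nonneg (L x)]
  have hKinv : 0 < 1 - K⁻¹ := sub_pos.2 (inv_lt_one_of_one_lt₀ hK)
  -- The additive error `δ ‖a - b‖` becomes at most `δ * (2 * m) * ‖L w‖`, with `m` from
  -- invertibility of `L` and `2` from `‖a - b‖ ≤ 2 ‖w‖`. The two bounds turn it into the
  -- multiplicative constants `K` in each direction.
  obtain ⟨δ, hδ, hδK⟩ : ∃ δ > 0, δ * (2 * m) ≤ 1 - K⁻¹ ∧ δ * (2 * m) ≤ K - 1 := by
    refine ⟨min (1 - K⁻¹) (K - 1) / (2 * m), by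
      have : 0 < min (1 - K⁻¹) (K - 1) := lt_min hKinv (by linarith)
      positivity, ?_⟩
    rw [div_mul_cancel₀ _ (by positivity)]
    exact ⟨min_le_left _ _, min_le_right _ _⟩
  have h1 := hN.flatten_approx hy r hδ
  have hc : Tendsto (fun p : (E3 × ℝ) × (E3 × ℝ) => (p.1.1, p.2.1)) (𝓝 ((y, r), (y, r)))
      (𝓝 (y, y)) := by
    have : Continuous (fun p : (E3 × ℝ) × (E3 × ℝ) => (p.1.1, p.2.1)) := by fun_prop
    exact this.tendsto _
  have h2 := hc.eventually (hN.norm_sub_le_planeProj hy hK)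
  -- A second instance with constant `2` keeps the bound `‖a - b‖ ≤ 2 ‖w‖` independent of `K`, which
  -- may be large.
  have h3 := hc.eventually (hN.norm_sub_le_planeProj hy one_lt_two)
  have h123 := (h1.and (h2.and h3))
  rw [nhds_prod_eq (x := (y, r)) (y := (y, r))] at h123
  obtain ⟨U, hU, hUprop⟩ := mem_prod_self_iff.1 h123
  refine ⟨U, hU, fun a ha b hb => ?_⟩
  obtain ⟨p1, p2, p3⟩ := hUprop (mk_mem_prod ha.1 hb.1)
  have p1 := p1 ha.2.1 hb.2.1
  have p2 := p2 ha.2.1 hb.2.1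
  have p3 := p3 ha.2.1 hb.2.1
  simp only at p1 p2 p3
  set w := flatten (N y) a - flatten (N y) b with hw
  have hw' : w = planeProj (N y) (a.1 - b.1) + (a.2 - b.2) • N y := by
    simp only [hw, flatten, map_sub]
    module
  have hn := hN.norm_eq_one y hy
  have hsq := norm_planeProj_add_smul_sq hn (a.1 - b.1) (a.2 - b.2)
  rw [← hw'] at hsq
  have q1 : ‖planeProj (N y) (a.1 - b.1)‖ ≤ ‖w‖ :=
    le_of_sq_le_sq (by nlinarith [sq_nonneg (a.2 - b.2)]) (norm_nonneg _)
  have q2 : |a.2 - b.2| ≤ ‖w‖ := by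
    refine le_of_sq_le_sq ?_ (norm_nonneg _)
    rw [sq_abs]
    nlinarith [sq_nonneg ‖planeProj (N y) (a.1 - b.1)‖]
  have q3 : ‖a - b‖ ≤ 2 * ‖w‖ := by
    rw [Prod.norm_def]
    refine max_le ?_ ?_
    · exact p3.trans (by nlinarith)
    · rw [Prod.snd_sub, Real.norm_eq_abs]
      nlinarith [norm_nonneg w]
  have q4 : δ * ‖a - b‖ ≤ δ * (2 * m) * ‖L w‖ := by
    have := hLm w
    nlinarith
  have q5 := p1.trans q4
  have q6 : ‖displace N a - displace N b‖ ≤ ‖L w‖ + δ * (2 * m) * ‖L w‖ := by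
    have := norm_le_insert' (displace N a - displace N b) (L w)
    linarith
  have q7 : ‖L w‖ ≤ ‖displace N a - displace N b‖ + δ * (2 * m) * ‖L w‖ := by
    have := norm_le_insert (displace N a - displace N b) (L w)
    linarith
  refine ⟨by nlinarith [norm_nonneg (L w)], ?_, p2⟩
  have : K⁻¹ * ‖L w‖ ≤ ‖displace N a - displace N b‖ := by nlinarith [norm_nonneg (L w)]
  rwa [inv_mul_le_iff₀ (by linarith)] at this

end NormalField

end

end ThinFluid

/-! ### Change of variables for the normal displacement -/

namespace ThinFluid

noncomputable section

open scoped ENNReal NNReal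

theorem exists_one_lt_pow_le {c : ℝ≥0} (hc : 1 < c) (k : ℕ) : ∃ K : ℝ≥0, 1 < K ∧ K ^ k ≤ c := by
  have ht : Tendsto (fun K : ℝ≥0 => K ^ k) (𝓝[>] 1) (𝓝 (1 ^ k)) :=
    ((continuous_pow k).tendsto (1 : ℝ≥0)).mono_left nhdsWithin_le_nhds
  rw [one_pow] at ht
  obtain ⟨K, h1, h2⟩ := ((ht.eventually_lt_const hc).and self_mem_nhdsWithin).exists
  exact ⟨K, h2, h1.le⟩

/-- Change of variables along a continuous injection with a given Jacobian. -/
theorem setIntegral_image_of_measure_image {X : Type*} [TopologicalSpace X] [PolishSpace X]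
    [MeasurableSpace X] [BorelSpace X] {ν : Measure X} {μ : Measure E3} {B : Set X}
    (hB : MeasurableSet B) {e : X → E3} (he : ContinuousOn e B) (hinj : InjOn e B) {J : X → ℝ≥0}
    (hJ : ContinuousOn J B)
    (h : ∀ S, MeasurableSet S → S ⊆ B → μ (e '' S) = ∫⁻ x in S, J x ∂ν) (f : E3 → ℝ)
    (hf : ContinuousOn f (e '' B)) :
    ∫ x in e '' B, f x ∂μ = ∫ z in B, J z * f (e z) ∂ν := by
  have hem : AEMeasurable e (ν.restrict B) := he.aemeasurable hB
  have hJm : AEMeasurable (fun x => (J x : ℝ≥0∞)) (ν.restrict B) :=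
    (hJ.aemeasurable hB).coe_nnreal_ennreal
  have hmap : Measure.map e ((ν.restrict B).withDensity fun x => J x) = μ.restrict (e '' B) := by
    ext s hs
    have hem' : AEMeasurable e ((ν.restrict B).withDensity fun x => J x) :=
      hem.mono_ac (withDensity_absolutelyContinuous _ _)
    have hpre : MeasurableSet (e ⁻¹' s ∩ B) := by
      have := (continuousOn_iff_continuous_domRestrict.1 he).measurable hs
      have h2 := (MeasurableEmbedding.subtype_coe hB).measurableSet_image' this
      convert h2 using 1
      ext x
      simp [and_comm]
    rw [Measure.map_apply_of_aemeasurable hem' hs, Measure.restrict_apply hs,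
      ← restrict_withDensity hB, Measure.restrict_apply' hB, withDensity_apply _ hpre,
      ← h _ hpre inter_subset_right, image_preimage_inter]
  have himg : MeasurableSet (e '' B) := hB.image_of_continuousOn_injOn he hinj
  rw [← hmap, integral_map (hem.mono_ac (withDensity_absolutelyContinuous _ _))]
  · rw [integral_withDensity_eq_integral_smul₀ (hJ.aemeasurable hB)]
    rfl
  · rw [hmap]
    exact hf.aestronglyMeasurable himg

/-- Injectivity makes `S ↦ μ (e '' S)` a measure on `X`, obtained by pulling `μ` back along the
embedding; the local ratio principle then applies to it. -/
theorem measure_image_eq_setLIntegral {X : Type*} [TopologicalSpace X] [PolishSpace X]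
    [MeasurableSpace X] [BorelSpace X] {ν : Measure X} {μ : Measure E3} {B : Set X}
    (hB : MeasurableSet B) {e : X → E3} (he : ContinuousOn e B) (hinj : InjOn e B) {J : X → ℝ≥0}
    (hJ : ContinuousOn J B) (hJpos : ∀ x ∈ B, 0 < J x)
    (h : ∀ x ∈ B, ∀ c : ℝ≥0, 1 < c → ∃ U ∈ 𝓝 x, ∀ S, MeasurableSet S → S ⊆ U ∩ B →
      μ (e '' S) ≤ c * (J x * ν S) ∧ J x * ν S ≤ c * μ (e '' S)) {S : Set X}
    (hS : MeasurableSet S) (hSB : S ⊆ B) : μ (e '' S) = ∫⁻ x in S, J x ∂ν := by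
  have hemb := he.measurableEmbedding hB hinj
  have hval := MeasurableEmbedding.subtype_coe hB
  set μ' : Measure X := (μ.comap (B.domRestrict e)).map Subtype.val with hμ'
  have key : ∀ S ⊆ B, μ' S = μ (e '' S) := by
    intro S hSB
    rw [hμ', hval.map_apply, hemb.comap_apply]
    congr 1
    ext x
    constructor
    · rintro ⟨z, hz, rfl⟩
      exact ⟨z, hz, rfl⟩
    · rintro ⟨z, hz, rfl⟩
      exact ⟨⟨z, hSB hz⟩, hz, rfl⟩
  rw [← key S hSB]
  refine measure_eq_setLIntegral_of_locally hJ hJpos (fun x hx c hc => ?_) hS hSB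
  obtain ⟨U, hU, hloc⟩ := h x hx c hc
  refine ⟨U, hU, fun S hS hSU => ?_⟩
  rw [key S (hSU.trans inter_subset_right)]
  exact hloc S hS hSU

namespace NormalField

variable {Γ : Set E3} {N : E3 → E3} {A : E3 → E3 →L[ℝ] E3} (hN : NormalField Γ N A)
include hN

/-- The projection is `1`-Lipschitz and its inverse on the image of `S` is `K`-Lipschitz; areas
scale with the square. -/
theorem planeProj_comparison {y : E3} (hy : y ∈ Γ) {K : ℝ≥0} {S : Set E3} (hS : MeasurableSet S)
    (hSK : ∀ a ∈ S, ∀ b ∈ S, ‖a - b‖ ≤ K * ‖planeProj (N y) (a - b)‖) :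
    MeasurableSet (planeProj (N y) '' S) ∧ μHE[2] (planeProj (N y) '' S) ≤ μHE[2] S ∧
      μHE[2] S ≤ (K : ℝ≥0∞) ^ 2 * μHE[2] (planeProj (N y) '' S) := by
  refine ⟨?_, ?_, ?_⟩
  · refine hS.image_of_continuousOn_injOn (planeProj (N y)).continuous.continuousOn ?_
    intro a ha b hb hab
    have := hSK a ha b hb
    rw [map_sub, hab, sub_self, norm_zero, mul_zero] at this
    exact sub_eq_zero.1 (norm_le_zero_iff.1 this)
  · have := euclideanHausdorffMeasure_image_le_mul 2 (f := planeProj (N y)) (g := id) (S := S)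
      (K := 1) (fun a _ b _ => by
        rw [dist_eq_norm, ← map_sub, NNReal.coe_one, one_mul, id, id, dist_eq_norm]
        exact norm_planeProj_le (hN.norm_eq_one y hy) _)
    simpa using this
  · have := euclideanHausdorffMeasure_image_le_mul 2 (f := id) (g := planeProj (N y)) (S := S)
      (K := K) (fun a ha b hb => by
        rw [id, id, dist_eq_norm, dist_eq_norm, ← map_sub]
        exact hSK a ha b hb)
    simpa using this

/-- Locally the surface has area at most four times that of a compact planar set, whose area is the
volume of a compact cylinder. -/
theorem measure_lt_top : μHE[2] Γ < ⊤ := by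
  refine hN.isCompact.measure_lt_top_of_nhdsWithin fun y hy => ?_
  have h := hN.norm_sub_le_planeProj hy one_lt_two
  rw [nhds_prod_eq] at h
  obtain ⟨U, hU, hUprop⟩ := mem_prod_self_iff.1 h
  obtain ⟨ε, hε, hball⟩ := Metric.nhds_basis_closedBall.mem_iff.1 hU
  refine ⟨Γ ∩ Metric.closedBall y ε,
    inter_mem_nhdsWithin _ (Metric.closedBall_mem_nhds y hε), ?_⟩
  set S := Γ ∩ Metric.closedBall y ε
  have hSc : IsCompact S := hN.isCompact.inter_right Metric.isClosed_closedBall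
  have hS2 : ∀ a ∈ S, ∀ b ∈ S, ‖a - b‖ ≤ (2 : ℝ≥0) * ‖planeProj (N y) (a - b)‖ := by
    intro a ha b hb
    have hab : (a, b) ∈ U ×ˢ U := mk_mem_prod (hball ha.2) (hball hb.2)
    have h := hUprop hab ha.1 hb.1
    rw [NNReal.coe_ofNat]
    exact h
  obtain ⟨h1, h2, h3⟩ := hN.planeProj_comparison hy hSc.isClosed.measurableSet hS2
  refine h3.trans_lt (ENNReal.mul_lt_top (by simp) ?_)
  have hn := hN.norm_eq_one y hy
  have h0 : ∀ x ∈ planeProj (N y) '' S, inner ℝ (N y) x = 0 := by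
    rintro _ ⟨x, _, rfl⟩
    exact inner_planeProj hn x
  rw [← volume_cylinder hn h1 h0, cylinder_eq_flatten_image hn h0]
  exact (((hSc.image (planeProj (N y)).continuous).prod isCompact_Icc).image
    (continuous_flatten _)).measure_lt_top

theorem exists_nhds_measure_displace_slice {y : E3} (hy : y ∈ Γ) {r : ℝ}
    (hdet : (displaceDeriv A (y, r)).det ≠ 0) {c : ℝ≥0} (hc : 1 < c) :
    ∃ U ∈ 𝓝 y, ∀ S, MeasurableSet S → S ⊆ U ∩ Γ →
      μHE[2] ((fun a => displace N (a, r)) '' S) ≤ c * (displaceJac A (y, r) * μHE[2] S) ∧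
      displaceJac A (y, r) * μHE[2] S ≤ c * μHE[2] ((fun a => displace N (a, r)) '' S) := by
  -- `K ^ 2` is lost between the displacement and its linearisation, and `K ^ 2` between the surface
  -- and its tangent plane.
  obtain ⟨K, hK1, hKc⟩ := exists_one_lt_pow_le hc 4
  obtain ⟨U, hU, hprop⟩ := hN.exists_nhds_bilipschitz hy hdet (K := K) (by exact_mod_cast hK1)
  have hU' : (fun a => (a, r)) ⁻¹' U ∈ 𝓝 y :=
    (by fun_prop : Continuous fun a : E3 => (a, r)).continuousAt.preimage_mem_nhds hU
  refine ⟨_, hU', fun S hS hSU => ?_⟩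
  set L := displaceDeriv A (y, r) with hL
  have hprop' : ∀ a ∈ S, ∀ b ∈ S, _ := fun a ha b hb =>
    hprop (a, r) ⟨(hSU ha).1, (hSU ha).2, mem_univ _⟩ (b, r) ⟨(hSU hb).1, (hSU hb).2, mem_univ _⟩
  have hfl : ∀ a b : E3, L (flatten (N y) (a, r) - flatten (N y) (b, r)) =
      L (planeProj (N y) a) - L (planeProj (N y) b) := fun a b => by
    simp [flatten]
  obtain ⟨h1, h2, h3⟩ := hN.planeProj_comparison hy hS (K := K)
    (fun a ha b hb => (hprop' a ha b hb).2.2)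
  have hplane : μHE[2] ((fun a => L (planeProj (N y) a)) '' S) =
      displaceJac A (y, r) * μHE[2] (planeProj (N y) '' S) := by
    rw [← image_image, measure_image_plane (hN.norm_eq_one y hy) hdet
      (hN.displaceDeriv_normal hy r) (hN.inner_displaceDeriv hy r) h1]
    · rw [displaceJac, ← Real.norm_eq_abs, ofReal_norm]
      rfl
    · rintro _ ⟨x, _, rfl⟩
      exact inner_planeProj (hN.norm_eq_one y hy) x
  have h4 := euclideanHausdorffMeasure_image_le_mul 2 (f := fun a => displace N (a, r))
    (g := fun a => L (planeProj (N y) a)) (S := S) (K := K) (fun a ha b hb => by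
      simp only [dist_eq_norm]
      rw [← hfl]
      exact (hprop' a ha b hb).1)
  have h5 := euclideanHausdorffMeasure_image_le_mul 2 (g := fun a => displace N (a, r))
    (f := fun a => L (planeProj (N y) a)) (S := S) (K := K) (fun a ha b hb => by
      simp only [dist_eq_norm]
      rw [← hfl]
      exact (hprop' a ha b hb).2.1)
  rw [hplane] at h4 h5
  have hK1' : (1 : ℝ≥0∞) ≤ K := by exact_mod_cast hK1.le
  have hKc' : (K : ℝ≥0∞) ^ 4 ≤ c := by exact_mod_cast hKc
  constructor
  · refine h4.trans ?_
    gcongr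
    exact (pow_le_pow_right₀ hK1' (by norm_num)).trans hKc'
  · calc (displaceJac A (y, r) : ℝ≥0∞) * μHE[2] S
        ≤ displaceJac A (y, r) * (K ^ 2 * μHE[2] (planeProj (N y) '' S)) := by gcongr
      _ = K ^ 2 * (displaceJac A (y, r) * μHE[2] (planeProj (N y) '' S)) := by ring
      _ ≤ K ^ 2 * (K ^ 2 * μHE[2] ((fun a => displace N (a, r)) '' S)) := by gcongr
      _ = K ^ 4 * μHE[2] ((fun a => displace N (a, r)) '' S) := by ring
      _ ≤ _ := by gcongr

/-- Flattening keeps the height coordinate, so the product measure and the volume of the flattened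
set can be compared slice by slice; the remaining linear map scales volume by its determinant. -/
theorem exists_nhds_volume_displace {y : E3} (hy : y ∈ Γ) {r : ℝ}
    (hdet : (displaceDeriv A (y, r)).det ≠ 0) {c : ℝ≥0} (hc : 1 < c) :
    ∃ U ∈ 𝓝 (y, r), ∀ S, MeasurableSet S → S ⊆ U ∩ Γ ×ˢ univ →
      volume (displace N '' S) ≤
        c * (displaceJac A (y, r) * ((μHE[2].restrict Γ).prod (volume : Measure ℝ)) S) ∧
      displaceJac A (y, r) * ((μHE[2].restrict Γ).prod (volume : Measure ℝ)) S ≤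
        c * volume (displace N '' S) := by
  -- `K ^ 3` comes from the three-dimensional bi-Lipschitz comparison and `K ^ 2` from the projected
  -- slices.
  obtain ⟨K, hK1, hKc⟩ := exists_one_lt_pow_le hc 5
  obtain ⟨U, hU, hprop⟩ := hN.exists_nhds_bilipschitz hy hdet (K := K) (by exact_mod_cast hK1)
  refine ⟨U, hU, fun S hS hSU => ?_⟩
  set L := displaceDeriv A (y, r) with hL
  have hn := hN.norm_eq_one y hy
  have hprop' : ∀ a ∈ S, ∀ b ∈ S, _ := fun a ha b hb => hprop a (hSU ha) b (hSU hb)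
  have : IsFiniteMeasure ((μHE[2] : Measure E3).restrict Γ) :=
    ⟨by simpa using hN.measure_lt_top⟩
  have hslice : ∀ s : ℝ, MeasurableSet ((fun a : E3 => (a, s)) ⁻¹' S) := fun s =>
    (by fun_prop : Measurable fun a : E3 => (a, s)) hS
  have hcomp := fun s : ℝ => hN.planeProj_comparison hy (hslice s) (K := K)
    (fun a ha b hb => (hprop' (a, s) ha (b, s) hb).2.2)
  have hprod : ((μHE[2].restrict Γ).prod (volume : Measure ℝ)) S =
      ∫⁻ s : ℝ, μHE[2] ((fun a : E3 => (a, s)) ⁻¹' S) := by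
    rw [Measure.prod_apply_symm hS]
    refine lintegral_congr fun s => ?_
    rw [Measure.restrict_apply (hslice s), inter_eq_left.2]
    intro a ha
    exact (hSU ha).2.1
  have hfinj : InjOn (flatten (N y)) S := by
    intro a ha b hb hab
    have hs : a.2 = b.2 := by
      have key : ∀ z : E3 × ℝ, inner ℝ (N y) (flatten (N y) z) = z.2 := by
        intro z
        rw [flatten, inner_add_right, inner_planeProj hn, inner_smul_right,
          real_inner_self_eq_norm_sq, hn]
        ring
      rw [← key a, hab, key b]
    have hp : planeProj (N y) (a.1 - b.1) = 0 := by
      have := hab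
      rw [flatten, flatten, hs, add_left_inj] at this
      rw [map_sub, this, sub_self]
    have := (hprop' a ha b hb).2.2
    rw [hp, norm_zero, mul_zero] at this
    exact Prod.ext (sub_eq_zero.1 (norm_le_zero_iff.1 this)) hs
  have hvol := volume_flatten_image hn
    (hS.image_of_continuousOn_injOn (continuous_flatten (N y)).continuousOn hfinj)
  have hLvol : volume ((fun a => L (flatten (N y) a)) '' S) =
      displaceJac A (y, r) * volume (flatten (N y) '' S) := by
    rw [← image_image, Measure.addHaar_image_continuousLinearMap, displaceJac,
      ← Real.norm_eq_abs, ofReal_norm]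
    rfl
  have h4 := euclideanHausdorffMeasure_image_le_mul 3 (f := displace N)
    (g := fun a => L (flatten (N y) a)) (S := S) (K := K) (fun a ha b hb => by
      simp only [dist_eq_norm]
      rw [← map_sub]
      exact (hprop' a ha b hb).1)
  have h5 := euclideanHausdorffMeasure_image_le_mul 3 (g := displace N)
    (f := fun a => L (flatten (N y) a)) (S := S) (K := K) (fun a ha b hb => by
      simp only [dist_eq_norm]
      rw [← map_sub]
      exact (hprop' a ha b hb).2.1)
  rw [EuclideanSpace.euclideanHausdorffMeasure_eq_volume, hLvol] at h4 h5
  have hv1 : volume (flatten (N y) '' S) ≤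
      ((μHE[2].restrict Γ).prod (volume : Measure ℝ)) S := by
    rw [hvol, hprod]
    exact lintegral_mono fun s => (hcomp s).2.1
  have hv2 : ((μHE[2].restrict Γ).prod (volume : Measure ℝ)) S ≤
      K ^ 2 * volume (flatten (N y) '' S) := by
    rw [hvol, hprod, ← lintegral_const_mul' _ _ (by simp)]
    exact lintegral_mono fun s => (hcomp s).2.2
  have hK1' : (1 : ℝ≥0∞) ≤ K := by exact_mod_cast hK1.le
  have hKc' : (K : ℝ≥0∞) ^ 5 ≤ c := by exact_mod_cast hKc
  constructor
  · refine h4.trans ?_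
    gcongr
    exact (pow_le_pow_right₀ hK1' (by norm_num)).trans hKc'
  · calc (displaceJac A (y, r) : ℝ≥0∞) * ((μHE[2].restrict Γ).prod (volume : Measure ℝ)) S
        ≤ displaceJac A (y, r) * (K ^ 2 * volume (flatten (N y) '' S)) := by gcongr
      _ = K ^ 2 * (displaceJac A (y, r) * volume (flatten (N y) '' S)) := by ring
      _ ≤ K ^ 2 * (K ^ 3 * volume (displace N '' S)) := by gcongr
      _ = K ^ 5 * volume (displace N '' S) := by ring
      _ ≤ _ := by gcongr

theorem isFiniteMeasure_restrict : IsFiniteMeasure ((μHE[2] : Measure E3).restrict Γ) :=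
  ⟨by simpa using hN.measure_lt_top⟩

theorem continuousOn_displace_slice (r : ℝ) : ContinuousOn (fun y => displace N (y, r)) Γ :=
  hN.continuousOn_displace.comp (by fun_prop) fun _ hy => ⟨hy, mem_univ _⟩

theorem continuousOn_displaceJac_slice (r : ℝ) :
    ContinuousOn (fun y => displaceJac A (y, r)) Γ :=
  hN.continuousOn_displaceJac.comp (by fun_prop) fun _ hy => ⟨hy, mem_univ _⟩

theorem measure_displace_slice {r : ℝ} (hdet : ∀ y ∈ Γ, (displaceDeriv A (y, r)).det ≠ 0)
    (hinj : InjOn (fun y => displace N (y, r)) Γ) {S : Set E3} (hS : MeasurableSet S)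
    (hSΓ : S ⊆ Γ) :
    μHE[2] ((fun y => displace N (y, r)) '' S) = ∫⁻ y in S, displaceJac A (y, r) ∂μHE[2] :=
  measure_image_eq_setLIntegral hN.isCompact.isClosed.measurableSet
    (hN.continuousOn_displace_slice r) hinj (hN.continuousOn_displaceJac_slice r)
    (fun y hy => nnnorm_pos.2 (hdet y hy))
    (fun y hy _ hc => hN.exists_nhds_measure_displace_slice hy (hdet y hy) hc) hS hSΓ

theorem measure_displace_slice_lt_top {r : ℝ} (hdet : ∀ y ∈ Γ, (displaceDeriv A (y, r)).det ≠ 0)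
    (hinj : InjOn (fun y => displace N (y, r)) Γ) :
    μHE[2] ((fun y => displace N (y, r)) '' Γ) < ⊤ := by
  have hΓ := hN.isCompact.isClosed.measurableSet
  rw [hN.measure_displace_slice hdet hinj hΓ Subset.rfl]
  obtain ⟨M, hM⟩ := hN.isCompact.bddAbove_image (hN.continuousOn_displaceJac_slice r)
  calc ∫⁻ y in Γ, displaceJac A (y, r) ∂μHE[2] ≤ ∫⁻ _ in Γ, (M : ℝ≥0∞) ∂μHE[2] :=
        setLIntegral_mono' hΓ fun y hy => by exact_mod_cast hM ⟨y, hy, rfl⟩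
    _ = M * μHE[2] Γ := setLIntegral_const _ _
    _ < ⊤ := ENNReal.mul_lt_top (by simp) hN.measure_lt_top

theorem setIntegral_displace_slice {r : ℝ} (hdet : ∀ y ∈ Γ, (displaceDeriv A (y, r)).det ≠ 0)
    (hinj : InjOn (fun y => displace N (y, r)) Γ) {f : E3 → ℝ}
    (hf : ContinuousOn f ((fun y => displace N (y, r)) '' Γ)) :
    ∫ x in (fun y => displace N (y, r)) '' Γ, f x ∂μHE[2] =
      ∫ y in Γ, displaceJac A (y, r) * f (displace N (y, r)) ∂μHE[2] :=
  setIntegral_image_of_measure_image hN.isCompact.isClosed.measurableSet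
    (hN.continuousOn_displace_slice r) hinj (hN.continuousOn_displaceJac_slice r)
    (fun _ hS hSB => hN.measure_displace_slice hdet hinj hS hSB) f hf

theorem setIntegral_displace {I : Set ℝ} (hI : MeasurableSet I)
    (hdet : ∀ z ∈ Γ ×ˢ I, (displaceDeriv A z).det ≠ 0)
    (hinj : InjOn (displace N) (Γ ×ˢ I)) {f : E3 → ℝ}
    (hf : ContinuousOn f (displace N '' (Γ ×ˢ I))) :
    ∫ x in displace N '' (Γ ×ˢ I), f x =
      ∫ z in Γ ×ˢ I, displaceJac A z * f (displace N z)
        ∂((μHE[2].restrict Γ).prod (volume : Measure ℝ)) := by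
  have hm : Γ ×ˢ I ⊆ Γ ×ˢ univ := prod_mono_right (subset_univ I)
  have he := hN.continuousOn_displace.mono hm
  have hJ := hN.continuousOn_displaceJac.mono hm
  have hB := hN.isCompact.isClosed.measurableSet.prod hI
  refine setIntegral_image_of_measure_image hB he hinj hJ (fun S hS hSB => ?_) f hf
  refine measure_image_eq_setLIntegral hB he hinj hJ (fun y hy => nnnorm_pos.2 (hdet y hy))
    (fun z hz c hc => ?_) hS hSB
  obtain ⟨U, hU, hloc⟩ := hN.exists_nhds_volume_displace hz.1 (hdet z hz) hc
  exact ⟨U, hU, fun S hS hSU => hloc S hS (hSU.trans (inter_subset_inter_right _ hm))⟩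

end NormalField

end

end ThinFluid

/-! ### Closest points and the signed distance -/

namespace ThinFluid

noncomputable section

theorem closestPoint_spec {K : Set E3} (hK : IsCompact K) (hne : K.Nonempty) (x : E3) :
    closestPoint K x ∈ K ∧ dist x (closestPoint K x) = Metric.infDist x K := by
  have h : ∃ y ∈ K, dist x y = Metric.infDist x K := by
    obtain ⟨y, hy, hd⟩ := hK.exists_infDist_eq_dist hne x
    exact ⟨y, hy, hd.symm⟩
  rw [closestPoint, dif_pos h]
  exact h.choose_spec

/-- The spatial gradient of a function on space-time. -/
def spaceGrad (φ : E3 × ℝ → ℝ) (z : E3 × ℝ) : E3 := gradient (fun y => φ (y, z.2)) z.1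

theorem inner_spaceGrad {φ : E3 × ℝ → ℝ} {z : E3 × ℝ} (h : DifferentiableAt ℝ φ z) (w : E3) :
    inner ℝ (spaceGrad φ z) w = fderiv ℝ φ z (w, 0) := by
  have h1 : HasFDerivAt (fun y : E3 => (y, z.2)) (ContinuousLinearMap.inl ℝ E3 ℝ) z.1 :=
    hasFDerivAt_prodMk_left z.1 z.2
  have h2 : HasFDerivAt (fun y : E3 => φ (y, z.2))
      ((fderiv ℝ φ z).comp (ContinuousLinearMap.inl ℝ E3 ℝ)) z.1 :=
    HasFDerivAt.comp (g := φ) z.1 h.hasFDerivAt h1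
  rw [spaceGrad, gradient, h2.fderiv, InnerProductSpace.toDual_symm_apply]
  simp

theorem deriv_time_eq {F : Type*} [NormedAddCommGroup F] [NormedSpace ℝ F] {φ : E3 × ℝ → F}
    {z : E3 × ℝ} (h : DifferentiableAt ℝ φ z) :
    deriv (fun s => φ (z.1, s)) z.2 = fderiv ℝ φ z (0, 1) := by
  have h1 : HasFDerivAt (fun s : ℝ => (z.1, s)) (ContinuousLinearMap.inr ℝ E3 ℝ) z.2 :=
    hasFDerivAt_prodMk_right z.1 z.2
  have h2 : HasFDerivAt (fun s : ℝ => φ (z.1, s))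
      ((fderiv ℝ φ z).comp (ContinuousLinearMap.inr ℝ E3 ℝ)) z.2 :=
    HasFDerivAt.comp (g := φ) z.2 h.hasFDerivAt h1
  simpa using h2.hasDerivAt.deriv

theorem contDiffOn_spaceGrad {φ : E3 × ℝ → ℝ} {W : Set (E3 × ℝ)} (hW : IsOpen W)
    (hφ : ContDiffOn ℝ ∞ φ W) : ContDiffOn ℝ ∞ (spaceGrad φ) W := by
  have h1 : ContDiffOn ℝ ∞ (fderiv ℝ φ) W := hφ.fderiv_of_isOpen hW (by simp)
  have h2 : ContDiffOn ℝ ∞ (fun z => (InnerProductSpace.toDual ℝ E3).symm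
      ((fderiv ℝ φ z).comp (ContinuousLinearMap.inl ℝ E3 ℝ))) W :=
    (InnerProductSpace.toDual ℝ E3).symm.contDiff.comp_contDiffOn
      (h1.clm_comp contDiffOn_const)
  refine h2.congr fun z hz => ?_
  refine ext_inner_right ℝ fun w => ?_
  rw [inner_spaceGrad ((hφ.contDiffAt (hW.mem_nhds hz)).differentiableAt (by simp)),
    InnerProductSpace.toDual_symm_apply]
  simp

namespace MovingSurface

variable {T : ℝ} (S : MovingSurface T)

theorem isCompact_Γ {t : ℝ} (ht : t ∈ Icc 0 T) : IsCompact (S.Γ t) := by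
  have h1 : IsCompact ({z : E3 × ℝ | z.2 ∈ Icc 0 T ∧ z.1 ∈ S.Γ z.2} ∩ Prod.snd ⁻¹' {t}) :=
    S.isCompact_spaceTime.inter_right (isClosed_singleton.preimage continuous_snd)
  convert h1.image continuous_fst
  ext x
  constructor
  · intro hx
    exact ⟨(x, t), ⟨⟨ht, hx⟩, rfl⟩, rfl⟩
  · rintro ⟨⟨y, s⟩, ⟨⟨_, hy⟩, hs⟩, rfl⟩
    rw [mem_preimage, mem_singleton_iff] at hs
    simp only at hs hy
    rwa [← hs]

theorem proj_spec {t : ℝ} (ht : t ∈ Icc 0 T) (x : E3) :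
    S.proj x t ∈ S.Γ t ∧ dist x (S.proj x t) = Metric.infDist x (S.Γ t) :=
  closestPoint_spec (S.isCompact_Γ ht) (S.isConnected t ht).nonempty x

theorem norm_normal {t : ℝ} (ht : t ∈ Icc 0 T) {y : E3} (hy : y ∈ S.Γ t) : ‖S.ν y t‖ = 1 := by
  obtain ⟨W, φ, hW, hmem, hφ, h⟩ := S.exists_defining t ht y hy
  obtain ⟨h1, -, h3⟩ := h y t hmem ht
  rw [(h3 hy).1, norm_smul, norm_inv, norm_norm, inv_mul_cancel₀ (norm_ne_zero_iff.2 h1)]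

/-- The closest point minimises `‖w - x‖ ^ 2` on the level set of the defining function, so by
Lagrange multipliers `x - y` is parallel to the gradient, hence to `ν`. Pairing with `ν` identifies
the coefficient. -/
theorem sub_proj_eq {t : ℝ} (ht : t ∈ Icc 0 T) (x : E3) :
    x = S.proj x t + S.sdist x t • S.ν (S.proj x t) t := by
  obtain ⟨hy, hd⟩ := S.proj_spec ht x
  obtain ⟨W, φ, hW, hmem, hφ, h⟩ := S.exists_defining t ht _ hy
  rw [sdist]
  set y := S.proj x t with hydef
  obtain ⟨h1, -, h3⟩ := h y t hmem ht
  have hν := (h3 hy).1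
  have hφy : ContDiffAt ℝ ∞ φ (y, t) := hφ.contDiffAt (hW.mem_nhds hmem)
  have hpair : ContDiffAt ℝ ∞ (fun w : E3 => (w, t)) y := by fun_prop
  have hs : HasStrictFDerivAt (fun w => φ (w, t))
      (InnerProductSpace.toDual ℝ E3 (gradient (fun w => φ (w, t)) y)) y := by
    have := (ContDiffAt.comp y hφy hpair).hasStrictFDerivAt (by simp)
    rw [gradient, LinearIsometryEquiv.apply_symm_apply]
    exact this
  have ho : HasStrictFDerivAt (fun w => ‖w - x‖ ^ 2) (2 • (innerSL ℝ (y - x))) y := by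
    have := (hasStrictFDerivAt_norm_sq (y - x)).comp y ((hasStrictFDerivAt_id y).sub_const x)
    simpa using! this
  have hU : {w : E3 | (w, t) ∈ W} ∈ 𝓝 y :=
    (by fun_prop : Continuous fun w : E3 => (w, t)).continuousAt.preimage_mem_nhds
      (hW.mem_nhds hmem)
  have hφy0 : φ (y, t) = 0 := (h y t hmem ht).2.1.1 hy
  have hextr : IsLocalExtrOn (fun w => ‖w - x‖ ^ 2) {w | φ (w, t) = φ (y, t)} y := by
    left
    filter_upwards [mem_nhdsWithin_of_mem_nhds hU, self_mem_nhdsWithin] with w hw1 hw2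
    have hwΓ : w ∈ S.Γ t := (h w t hw1 ht).2.1.2 (hw2.trans hφy0)
    have hle : dist x y ≤ dist x w := hd.le.trans (Metric.infDist_le_dist_of_mem hwΓ)
    rw [dist_eq_norm, dist_eq_norm, norm_sub_rev x, norm_sub_rev x] at hle
    exact pow_le_pow_left₀ (norm_nonneg _) hle 2
  obtain ⟨a, b, hab, hlin⟩ := hextr.exists_multipliers_of_hasStrictFDerivAt_1d hs ho
  set g := gradient (fun w => φ (w, t)) y with hg
  have hvec : a • g + (2 * b) • (y - x) = 0 := by
    refine ext_inner_right ℝ fun w => ?_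
    have := congrArg (fun f => f w) hlin
    simp only [_root_.add_apply, _root_.smul_apply,
      InnerProductSpace.toDual_apply_apply, innerSL_apply_apply, smul_eq_mul, nsmul_eq_mul,
      _root_.zero_apply] at this
    rw [inner_add_left, inner_smul_left, inner_smul_left, inner_zero_left]
    simp only [conj_trivial]
    push_cast at this
    linarith
  -- Otherwise the nonzero gradient would force both multipliers to vanish.
  have hb : b ≠ 0 := by
    rintro rfl
    simp only [mul_zero, zero_smul, add_zero, smul_eq_zero, h1, or_false] at hvec
    exact hab (by simp [hvec])
  have hx : x - y = (a / (2 * b) * ‖g‖) • S.ν y t := by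
    rw [hν, smul_smul, mul_assoc, mul_inv_cancel₀ (norm_ne_zero_iff.2 h1), mul_one]
    have : (2 * b) • (x - y) = a • g := by
      rw [← sub_eq_zero, ← neg_eq_zero, ← hvec]
      module
    rw [div_eq_inv_mul, ← smul_smul, ← this, smul_smul, inv_mul_cancel₀ (by simpa using hb),
      one_smul]
  conv_lhs => rw [← add_sub_cancel y x]
  congr 1
  rw [hx, inner_smul_left, real_inner_self_eq_norm_sq, S.norm_normal ht hy]
  simp

theorem abs_sdist {t : ℝ} (ht : t ∈ Icc 0 T) (x : E3) :
    |S.sdist x t| = Metric.infDist x (S.Γ t) := by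
  obtain ⟨hy, hd⟩ := S.proj_spec ht x
  rw [← hd, dist_eq_norm]
  conv_rhs => rw [S.sub_proj_eq ht x]
  have hs : S.proj x t + S.sdist x t • S.ν (S.proj x t) t = x := (S.sub_proj_eq ht x).symm
  rw [hs]
  have : x - S.proj x t = S.sdist x t • S.ν (S.proj x t) t := sub_eq_of_eq_add' hs.symm
  rw [this, norm_smul, S.norm_normal ht hy, mul_one, Real.norm_eq_abs]

end MovingSurface

end

end ThinFluid

/-! ### Normal coordinates and local regularity of the closest point mapping -/

namespace ThinFluid

noncomputable section

/-- The normalized spatial gradient. -/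
def unitGrad (φ : E3 × ℝ → ℝ) (z : E3 × ℝ) : E3 := ‖spaceGrad φ z‖⁻¹ • spaceGrad φ z

theorem contDiffAt_unitGrad {φ : E3 × ℝ → ℝ} {W : Set (E3 × ℝ)} (hW : IsOpen W)
    (hφ : ContDiffOn ℝ ∞ φ W) {z : E3 × ℝ} (hz : z ∈ W) (hg : spaceGrad φ z ≠ 0) :
    ContDiffAt ℝ ∞ (unitGrad φ) z := by
  have h := (contDiffOn_spaceGrad hW hφ).contDiffAt (hW.mem_nhds hz)
  exact ((h.norm ℝ hg).inv (norm_ne_zero_iff.2 hg)).smul h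

/-- The map `(y, r, t) ↦ (y + r n(y, t), φ(y, t), t)`, where `n` is the normalized gradient of
`φ`. -/
def normalCoordMap (φ : E3 × ℝ → ℝ) (p : E3 × ℝ × ℝ) : E3 × ℝ × ℝ :=
  (p.1 + p.2.1 • unitGrad φ (p.1, p.2.2), φ (p.1, p.2.2), p.2.2)

/-- The extra component `φ` makes `normalCoordMap` a map between spaces of equal dimension, so the
inverse function theorem applies at height zero. Prescribing the value `0` for that component picks
out feet on the surface; `Q` returns foot and height, and uniqueness is the left inverse property.
-/
theorem exists_normal_coordinates {φ : E3 × ℝ → ℝ} {W : Set (E3 × ℝ)} (hW : IsOpen W)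
    (hφ : ContDiffOn ℝ ∞ φ W) {z₀ : E3 × ℝ} (hz : z₀ ∈ W) (hg : spaceGrad φ z₀ ≠ 0)
    (hφ0 : φ z₀ = 0) :
    ∃ Q : E3 × ℝ → E3 × ℝ, ContDiffAt ℝ 1 Q z₀ ∧ Q z₀ = (z₀.1, 0) ∧
      (∀ᶠ z in 𝓝 z₀, (Q z).1 + (Q z).2 • unitGrad φ ((Q z).1, z.2) = z.1 ∧
        φ ((Q z).1, z.2) = 0) ∧
      ∃ ρ > 0, ∀ᶠ z in 𝓝 z₀, ∀ y r, ‖y - z₀.1‖ < ρ → |r| < ρ →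
        y + r • unitGrad φ (y, z.2) = z.1 → φ (y, z.2) = 0 → Q z = (y, r) := by
  obtain ⟨y₀, t₀⟩ := z₀
  set p₀ : E3 × ℝ × ℝ := (y₀, 0, t₀) with hp₀
  have hφ' : ContDiffAt ℝ ∞ φ (y₀, t₀) := hφ.contDiffAt (hW.mem_nhds hz)
  have hn := contDiffAt_unitGrad hW hφ hz hg
  have hpr : ContDiffAt ℝ ∞ (fun p : E3 × ℝ × ℝ => (p.1, p.2.2)) p₀ := by fun_prop
  have hc1 : ContDiffAt ℝ ∞ (fun p : E3 × ℝ × ℝ => unitGrad φ (p.1, p.2.2)) p₀ :=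
    ContDiffAt.comp (g := unitGrad φ) p₀ hn hpr
  have hc2 : ContDiffAt ℝ ∞ (fun p : E3 × ℝ × ℝ => φ (p.1, p.2.2)) p₀ :=
    ContDiffAt.comp (g := φ) p₀ hφ' hpr
  have hG : ContDiffAt ℝ ∞ (normalCoordMap φ) p₀ := by
    unfold normalCoordMap
    have h1 : ContDiffAt ℝ ∞ (fun p : E3 × ℝ × ℝ => p.2.1) p₀ := by fun_prop
    have h2 : ContDiffAt ℝ ∞ (fun p : E3 × ℝ × ℝ => p.2.2) p₀ := by fun_prop
    exact (contDiffAt_fst.add (h1.smul hc1)).prodMk (hc2.prodMk h2)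
  set n₀ := unitGrad φ (y₀, t₀) with hn₀
  set fst' := ContinuousLinearMap.fst ℝ E3 (ℝ × ℝ)
  set mid' := (ContinuousLinearMap.fst ℝ ℝ ℝ).comp (ContinuousLinearMap.snd ℝ E3 (ℝ × ℝ))
  set snd' := (ContinuousLinearMap.snd ℝ ℝ ℝ).comp (ContinuousLinearMap.snd ℝ E3 (ℝ × ℝ))
  set D : (E3 × ℝ × ℝ) →L[ℝ] (E3 × ℝ × ℝ) :=
    (fst' + mid'.smulRight n₀).prod (((fderiv ℝ φ (y₀, t₀)).comp (fst'.prod snd')).prod snd')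
    with hD
  have hDd : HasFDerivAt (normalCoordMap φ) D p₀ := by
    have hm : HasFDerivAt (fun p : E3 × ℝ × ℝ => p.2.1) mid' p₀ := mid'.hasFDerivAt
    have hs : HasFDerivAt (fun p : E3 × ℝ × ℝ => p.2.2) snd' p₀ := snd'.hasFDerivAt
    have hf : HasFDerivAt (fun p : E3 × ℝ × ℝ => p.1) fst' p₀ := fst'.hasFDerivAt
    have hd1 := (hc1.differentiableAt (by simp)).hasFDerivAt
    have hd2 : HasFDerivAt (fun p : E3 × ℝ × ℝ => φ (p.1, p.2.2))
        ((fderiv ℝ φ (y₀, t₀)).comp (fst'.prod snd')) p₀ :=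
      HasFDerivAt.comp (g := φ) p₀ (hφ'.differentiableAt (by simp)).hasFDerivAt (hf.prodMk hs)
    have := (hf.add (hm.smul hd1)).prodMk (hd2.prodMk hs)
    convert! this using 2
    simp [hp₀, hn₀]
  have hinner : ∀ w : E3, fderiv ℝ φ (y₀, t₀) (w, 0) = inner ℝ (spaceGrad φ (y₀, t₀)) w :=
    fun w => (inner_spaceGrad (hφ'.differentiableAt (by simp)) w).symm
  -- A kernel vector has `w = -a n₀` and `⟨∇φ, w⟩ = 0`, hence `a ‖∇φ‖ = 0`.
  have hinj : Function.Injective D := by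
    rw [injective_iff_map_eq_zero]
    rintro ⟨w, a, s⟩ h0
    simp only [hD, ContinuousLinearMap.prod_apply, _root_.add_apply, fst', mid', snd',
      ContinuousLinearMap.smulRight_apply, ContinuousLinearMap.comp_apply,
      ContinuousLinearMap.coe_fst', ContinuousLinearMap.coe_snd', Prod.mk_eq_zero] at h0
    obtain ⟨h1, h2, rfl⟩ := h0
    have hw : w = -(a • n₀) := eq_neg_of_add_eq_zero_left h1
    rw [hinner, hw, inner_neg_right, inner_smul_right, hn₀, unitGrad, inner_smul_right,
      real_inner_self_eq_norm_sq, neg_eq_zero] at h2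
    have hne := norm_ne_zero_iff.2 hg
    have ha : a = 0 := by
      rcases mul_eq_zero.1 h2 with h | h
      · exact h
      · exfalso
        rcases mul_eq_zero.1 h with h | h
        · exact hne (inv_eq_zero.1 h)
        · exact hne (pow_eq_zero_iff (two_ne_zero) |>.1 h)
    subst ha
    simp [hw]
  set De : (E3 × ℝ × ℝ) ≃L[ℝ] (E3 × ℝ × ℝ) :=
    (LinearEquiv.ofInjectiveEndo (D : (E3 × ℝ × ℝ) →ₗ[ℝ] (E3 × ℝ × ℝ))
      hinj).toContinuousLinearEquiv with hDe
  have hDe' : (De : (E3 × ℝ × ℝ) →L[ℝ] (E3 × ℝ × ℝ)) = D := by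
    ext x <;> rfl
  have hDd' : HasFDerivAt (normalCoordMap φ) (De : (E3 × ℝ × ℝ) →L[ℝ] (E3 × ℝ × ℝ)) p₀ := by
    rw [hDe']
    exact hDd
  set e := hG.toOpenPartialHomeomorph (normalCoordMap φ) hDd' (by simp) with he
  have hecoe : ∀ p, e p = normalCoordMap φ p := fun p => rfl
  have hps : p₀ ∈ e.source := hG.mem_toOpenPartialHomeomorph_source hDd' (by simp)
  have himg : normalCoordMap φ p₀ = (y₀, 0, t₀) := by
    simp [normalCoordMap, hp₀, hφ0]
  have hesymm : ContDiffAt ℝ ∞ e.symm (y₀, 0, t₀) := by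
    have := hG.to_localInverse (n := ∞) hDd' (by simp)
    rw [himg] at this
    exact this
  have hin : ContDiff ℝ ∞ (fun z : E3 × ℝ => ((z.1, (0 : ℝ), z.2) : E3 × ℝ × ℝ)) := by fun_prop
  have hcomp : ContDiffAt ℝ ∞ (fun z : E3 × ℝ => e.symm (z.1, (0 : ℝ), z.2)) (y₀, t₀) :=
    ContDiffAt.comp (g := e.symm) (y₀, t₀) hesymm hin.contDiffAt
  have hback : e.symm (y₀, 0, t₀) = p₀ := by
    rw [← himg, ← hecoe]
    exact e.left_inv hps
  have htarget : ∀ᶠ z : E3 × ℝ in 𝓝 (y₀, t₀), ((z.1, (0 : ℝ), z.2) : E3 × ℝ × ℝ) ∈ e.target := by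
    refine hin.continuous.continuousAt.preimage_mem_nhds (e.open_target.mem_nhds ?_)
    have := e.map_source hps
    rwa [hecoe, himg] at this
  refine ⟨fun z => ((e.symm (z.1, 0, z.2)).1, (e.symm (z.1, 0, z.2)).2.1), ?_, ?_, ?_, ?_⟩
  · have h1 : ContDiffAt ℝ ∞ (fun p : E3 × ℝ × ℝ => (p.1, p.2.1)) (e.symm (y₀, (0 : ℝ), t₀)) := by
      fun_prop
    have h2 : ContDiffAt ℝ ∞ (fun z : E3 × ℝ => ((e.symm (z.1, 0, z.2)).1,
        (e.symm (z.1, 0, z.2)).2.1)) (y₀, t₀) := ContDiffAt.comp (y₀, t₀) h1 hcomp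
    exact h2.of_le (by exact_mod_cast le_top)
  · simp [hback, hp₀]
  · filter_upwards [htarget] with z hzt
    have h := e.right_inv hzt
    rw [hecoe] at h
    simp only [normalCoordMap, Prod.mk.injEq] at h
    obtain ⟨h1, h2, h3⟩ := h
    rw [h3] at h1 h2
    exact ⟨h1, h2⟩
  · obtain ⟨ρ, hρ, hball⟩ := Metric.mem_nhds_iff.1 (e.open_source.mem_nhds hps)
    refine ⟨ρ, hρ, ?_⟩
    have htime : ∀ᶠ z : E3 × ℝ in 𝓝 (y₀, t₀), dist z.2 t₀ < ρ :=
      (continuous_snd.tendsto (y₀, t₀)).eventually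
        (show ∀ᶠ s in 𝓝 t₀, dist s t₀ < ρ from Metric.ball_mem_nhds t₀ hρ)
    filter_upwards [htime] with z hzt y r hy hr h1 h2
    have hmem : ((y, r, z.2) : E3 × ℝ × ℝ) ∈ e.source := by
      apply hball
      rw [Metric.mem_ball, hp₀, Prod.dist_eq, Prod.dist_eq]
      refine max_lt ?_ (max_lt ?_ hzt)
      · rwa [dist_eq_norm]
      · rwa [Real.dist_eq, sub_zero]
    have h := e.left_inv hmem
    rw [hecoe] at h
    simp only [normalCoordMap, h1, h2] at h
    rw [h]

namespace MovingSurface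

variable {T : ℝ} (S : MovingSurface T)

/-- Regularity of the closest point mapping and the signed distance at a point of space-time. -/
structure RegularAt (ρ : ℝ) (z : E3 × ℝ) : Prop where
  mem_Ioo : z.2 ∈ Ioo 0 T
  unique : ∀ y ∈ S.Γ z.2, ∀ r, |r| < ρ → z.1 = y + r • S.ν y z.2 →
    y = S.proj z.1 z.2 ∧ r = S.sdist z.1 z.2
  contDiffAt_proj : ContDiffAt ℝ 1 (Function.uncurry S.proj) z
  contDiffAt_sdist : ContDiffAt ℝ 1 (Function.uncurry S.sdist) z
  contDiffAt_normal : ContDiffAt ℝ 1 (fun z : E3 × ℝ => S.ν (S.proj z.1 z.2) z.2) z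
  inner_fderiv_proj : ∀ w : E3 × ℝ, inner ℝ (S.ν (S.proj z.1 z.2) z.2)
    (fderiv ℝ (Function.uncurry S.proj) z w) = w.2 * S.V (S.proj z.1 z.2) z.2

/-- The closest point is a foot with small height, so uniqueness of normal coordinates identifies it
with the foot from `Q`. Thus `proj`, `sdist` and the extended normal inherit the regularity of `Q`
and of the defining function. -/
theorem eventually_regularAt {z₀ : E3 × ℝ} (hz₀ : z₀ ∈ S.spaceTime) :
    ∃ ρ > 0, ∀ᶠ z in 𝓝 z₀, S.RegularAt ρ z := by
  obtain ⟨ht₀, hy₀⟩ := hz₀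
  obtain ⟨W, φ, hW, hmem, hφ, hdef⟩ := S.exists_defining z₀.2 (Ioo_subset_Icc_self ht₀) z₀.1 hy₀
  rw [Prod.mk.eta] at hmem
  have hdef' : ∀ z ∈ W, z.2 ∈ Icc 0 T → spaceGrad φ z ≠ 0 ∧ (z.1 ∈ S.Γ z.2 ↔ φ z = 0) ∧
      (z.1 ∈ S.Γ z.2 → S.ν z.1 z.2 = unitGrad φ z ∧
        S.V z.1 z.2 = -(‖spaceGrad φ z‖⁻¹ * deriv (fun s => φ (z.1, s)) z.2)) :=
    fun z hz hzt => hdef z.1 z.2 hz hzt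
  obtain ⟨hg, hiff, hval⟩ := hdef' z₀ hmem (Ioo_subset_Icc_self ht₀)
  obtain ⟨Q, hQ, hQ0, hQeq, ρ, hρ, hQu⟩ := exists_normal_coordinates hW hφ hmem hg (hiff.1 hy₀)
  have hQ1 : ∀ᶠ z in 𝓝 z₀, ContDiffAt ℝ 1 Q z := hQ.eventually (by simp)
  obtain ⟨ρ', hρ', hballW⟩ := Metric.mem_nhds_iff.1 (hW.mem_nhds hmem)
  -- The foot lies within distance of the point plus height, less than `2 * σ`, of `z₀`; this must
  -- fit in both balls.
  set σ := min ρ ρ' / 2 with hσ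
  have hσpos : 0 < σ := by positivity
  have hσρ : 2 * σ ≤ ρ := by rw [hσ]; linarith [min_le_left ρ ρ']
  have hσρ' : 2 * σ ≤ ρ' := by rw [hσ]; linarith [min_le_right ρ ρ']
  have hQW : ∀ᶠ z in 𝓝 z₀, ((Q z).1, z.2) ∈ W := by
    have hc : ContinuousAt (fun z => ((Q z).1, z.2)) z₀ :=
      (hQ.continuousAt.fst).prodMk continuous_snd.continuousAt
    refine hc.preimage_mem_nhds (hW.mem_nhds ?_)
    rw [hQ0]
    exact hmem
  have hQs : ∀ᶠ z in 𝓝 z₀, |(Q z).2| < σ := by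
    have hc : ContinuousAt (fun z => |(Q z).2|) z₀ := hQ.continuousAt.snd.abs
    refine hc.eventually_lt_const ?_
    simpa [hQ0] using hσpos
  have htime : ∀ᶠ z : E3 × ℝ in 𝓝 z₀, z.2 ∈ Ioo 0 T :=
    continuous_snd.continuousAt.preimage_mem_nhds (isOpen_Ioo.mem_nhds ht₀)
  have hnear : ∀ᶠ z : E3 × ℝ in 𝓝 z₀, dist z z₀ < σ := Metric.ball_mem_nhds z₀ hσpos
  have huniq : ∀ᶠ z in 𝓝 z₀, ∀ y ∈ S.Γ z.2, ∀ r, |r| < σ → z.1 = y + r • S.ν y z.2 →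
      Q z = (y, r) := by
    filter_upwards [hQu, htime, hnear] with z hzu hzt hzn y hy r hr hx
    have hx1 : dist z.1 z₀.1 < σ := (le_max_left _ _).trans_lt hzn
    have hx2 : dist z.2 z₀.2 < σ := (le_max_right _ _).trans_lt hzn
    have hyd : ‖y - z₀.1‖ < 2 * σ := by
      have : y - z₀.1 = (z.1 - z₀.1) - r • S.ν y z.2 := by rw [hx]; abel
      rw [this]
      refine (norm_sub_le _ _).trans_lt ?_
      rw [norm_smul, S.norm_normal (Ioo_subset_Icc_self hzt) hy, mul_one, Real.norm_eq_abs,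
        ← dist_eq_norm]
      linarith
    have hyW : (y, z.2) ∈ W := by
      apply hballW
      rw [Metric.mem_ball, Prod.dist_eq]
      refine max_lt ?_ ?_
      · rw [dist_eq_norm]
        exact hyd.trans_le hσρ'
      · exact hx2.trans_le (by linarith)
    obtain ⟨-, h2, h3⟩ := hdef' (y, z.2) hyW (Ioo_subset_Icc_self hzt)
    refine hzu y r (hyd.trans_le hσρ) (hr.trans_le (by linarith)) ?_ (h2.1 hy)
    rw [← (h3 hy).1]
    exact hx.symm
  have hQΓ : ∀ᶠ z in 𝓝 z₀, (Q z).1 ∈ S.Γ z.2 ∧ z.1 = (Q z).1 + (Q z).2 • S.ν (Q z).1 z.2 := by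
    filter_upwards [hQeq, hQW, htime] with z hz1 hz2 hz3
    obtain ⟨-, h2, h3⟩ := hdef' _ hz2 (Ioo_subset_Icc_self hz3)
    have hin : (Q z).1 ∈ S.Γ z.2 := h2.2 hz1.2
    refine ⟨hin, ?_⟩
    rw [← hz1.1, (h3 hin).1]
  have hQproj : ∀ᶠ z in 𝓝 z₀, S.proj z.1 z.2 = (Q z).1 ∧ S.sdist z.1 z.2 = (Q z).2 := by
    filter_upwards [huniq, hQΓ, hQs, htime] with z hz1 hz2 hz3 hz4
    have hz4' := Ioo_subset_Icc_self hz4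
    -- Minimality bounds the height over the closest point by that over the foot from `Q`, bringing
    -- it within the range of uniqueness.
    have hle : |S.sdist z.1 z.2| ≤ |(Q z).2| := by
      rw [S.abs_sdist hz4']
      refine (Metric.infDist_le_dist_of_mem hz2.1).trans ?_
      have : z.1 - (Q z).1 = (Q z).2 • S.ν (Q z).1 z.2 := sub_eq_of_eq_add' hz2.2
      rw [dist_eq_norm, this, norm_smul, S.norm_normal hz4' hz2.1, mul_one, Real.norm_eq_abs]
    have := hz1 _ (S.proj_spec hz4' z.1).1 _ (hle.trans_lt hz3) (S.sub_proj_eq hz4' z.1)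
    rw [this]
    exact ⟨rfl, rfl⟩
  refine ⟨σ, hσpos, ?_⟩
  filter_upwards [htime, huniq, hQproj, hQproj.eventually_nhds, hQ1, hQW, hQW.eventually_nhds,
    hQΓ.eventually_nhds, htime.eventually_nhds] with z hz1 hz2 hz3 hz4 hz5 hz6 hz7 hz8 hz9
  have ep : Function.uncurry S.proj =ᶠ[𝓝 z] fun z => (Q z).1 := by
    filter_upwards [hz4] with w hw using hw.1
  have es : Function.uncurry S.sdist =ᶠ[𝓝 z] fun z => (Q z).2 := by
    filter_upwards [hz4] with w hw using hw.2
  have en : (fun z : E3 × ℝ => S.ν (S.proj z.1 z.2) z.2) =ᶠ[𝓝 z]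
      fun z => unitGrad φ ((Q z).1, z.2) := by
    filter_upwards [hz4, hz7, hz8, hz9] with w hw h7 h8 h9
    rw [hw.1]
    exact ((hdef' _ h7 (Ioo_subset_Icc_self h9)).2.2 h8.1).1
  have hpair : ContDiffAt ℝ 1 (fun z => ((Q z).1, z.2)) z := hz5.fst.prodMk contDiffAt_snd
  obtain ⟨hgz, -, hvalz⟩ := hdef' _ hz6 (Ioo_subset_Icc_self hz1)
  have hpG : (Q z).1 ∈ S.Γ z.2 := hz8.self_of_nhds.1
  refine ⟨hz1, fun y hy r hr hx => ?_, hz5.fst.congr_of_eventuallyEq ep,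
    hz5.snd.congr_of_eventuallyEq es, ?_, ?_⟩
  · have := hz2 y hy r hr hx
    rw [hz3.1, hz3.2, this]
    exact ⟨rfl, rfl⟩
  · refine ContDiffAt.congr_of_eventuallyEq ?_ en
    exact ContDiffAt.comp (g := unitGrad φ) z
      ((contDiffAt_unitGrad hW hφ hz6 hgz).of_le (by exact_mod_cast le_top)) hpair
  · intro w
    have hφd : DifferentiableAt ℝ φ ((Q z).1, z.2) :=
      (hφ.contDiffAt (hW.mem_nhds hz6)).differentiableAt (by simp)
    have hQd : HasFDerivAt (fun z => (Q z).1) (fderiv ℝ (fun z => (Q z).1) z) z :=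
      (hz5.fst.differentiableAt (by simp)).hasFDerivAt
    have hcomp : HasFDerivAt (fun z : E3 × ℝ => φ ((Q z).1, z.2))
        ((fderiv ℝ φ ((Q z).1, z.2)).comp ((fderiv ℝ (fun z => (Q z).1) z).prod
          (ContinuousLinearMap.snd ℝ E3 ℝ))) z :=
      HasFDerivAt.comp (g := φ) z hφd.hasFDerivAt (hQd.prodMk hasFDerivAt_snd)
    -- Differentiating this identity gives `∇φ · dπ + ∂ₜφ dt = 0`, which is the formula for the
    -- normal velocity of the foot.
    have hzero : (fun z : E3 × ℝ => φ ((Q z).1, z.2)) =ᶠ[𝓝 z] fun _ => 0 := by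
      filter_upwards [hz7, hz8, hz9] with w h7 h8 h9
      exact (hdef' _ h7 (Ioo_subset_Icc_self h9)).2.1.1 h8.1
    have h0 := hcomp.unique ((hasFDerivAt_const (0 : ℝ) z).congr_of_eventuallyEq hzero)
    have h0w := congrArg (fun f => f w) h0
    simp only [ContinuousLinearMap.comp_apply, ContinuousLinearMap.prod_apply,
      ContinuousLinearMap.coe_snd', _root_.zero_apply] at h0w
    set a := fderiv ℝ (fun z => (Q z).1) z w with ha
    have hsplit : ((a, w.2) : E3 × ℝ) = (a, 0) + w.2 • ((0 : E3), (1 : ℝ)) := by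
      ext <;> simp
    rw [hsplit, map_add, map_smul, ← inner_spaceGrad hφd, ← deriv_time_eq hφd] at h0w
    rw [hz3.1, ep.fderiv_eq, ← ha, (hvalz hpG).1, (hvalz hpG).2, unitGrad, inner_smul_left]
    simp only [smul_eq_mul, conj_trivial] at h0w ⊢
    have : inner ℝ (spaceGrad φ ((Q z).1, z.2)) a =
      -(w.2 * deriv (fun s => φ ((Q z).1, s)) z.2) := by linarith
    rw [this]
    ring

end MovingSurface

end

end ThinFluid

/-! ### A uniform tube and the derivatives of the signed distance -/

namespace ThinFluid

noncomputable section

namespace MovingSurface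

variable {T : ℝ} (S : MovingSurface T)

theorem RegularAt.mono {S : MovingSurface T} {ρ ρ' : ℝ} {z : E3 × ℝ} (h : S.RegularAt ρ z)
    (hρ : ρ' ≤ ρ) : S.RegularAt ρ' z :=
  { h with unique := fun y hy r hr => h.unique y hy r (hr.trans_le hρ) }

theorem isCompact_spaceTime_Icc {a b : ℝ} (ha : 0 < a) (hb : b < T) :
    IsCompact {z : E3 × ℝ | z.2 ∈ Icc a b ∧ z.1 ∈ S.Γ z.2} := by
  convert S.isCompact_spaceTime.inter_right (isClosed_Icc.preimage continuous_snd :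
    IsClosed (Prod.snd ⁻¹' Icc a b : Set (E3 × ℝ))) using 1
  ext z
  constructor
  · rintro ⟨h1, h2⟩
    exact ⟨⟨⟨ha.le.trans h1.1, h1.2.trans hb.le⟩, h2⟩, h1⟩
  · rintro ⟨⟨_, h2⟩, h1⟩
    exact ⟨h1, h2⟩

/-- The closest point mapping is regular on a tube of uniform width. -/
theorem exists_regular_tube {a b : ℝ} (ha : 0 < a) (hb : b < T) :
    ∃ ε₀ > 0, ∀ t ∈ Icc a b, ∀ x, Metric.infDist x (S.Γ t) ≤ ε₀ →
      ∀ᶠ w in 𝓝 (x, t), S.RegularAt (2 * ε₀) w := by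
  set K := {z : E3 × ℝ | z.2 ∈ Icc a b ∧ z.1 ∈ S.Γ z.2} with hK
  have hKc : IsCompact K := S.isCompact_spaceTime_Icc ha hb
  have hsub : K ⊆ S.spaceTime := fun z hz => ⟨⟨ha.trans_le hz.1.1, hz.1.2.trans_lt hb⟩, hz.2⟩
  obtain ⟨ρ, hρ, hreg⟩ : ∃ ρ > 0, ∀ z ∈ K, ∀ᶠ w in 𝓝 z, S.RegularAt ρ w := by
    refine hKc.induction_on (p := fun s => ∃ ρ > 0, ∀ z ∈ s, ∀ᶠ w in 𝓝 z, S.RegularAt ρ w)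
      ⟨1, one_pos, by simp⟩ ?_ ?_ ?_
    · rintro s t hst ⟨ρ, hρ, h⟩
      exact ⟨ρ, hρ, fun z hz => h z (hst hz)⟩
    · rintro s t ⟨ρ, hρ, h⟩ ⟨ρ', hρ', h'⟩
      refine ⟨min ρ ρ', lt_min hρ hρ', fun z hz => ?_⟩
      rcases hz with hz | hz
      · exact (h z hz).mono fun w hw => hw.mono (min_le_left _ _)
      · exact (h' z hz).mono fun w hw => hw.mono (min_le_right _ _)
    · intro z hz
      obtain ⟨ρ, hρ, h⟩ := S.eventually_regularAt (hsub hz)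
      exact ⟨_, mem_nhdsWithin_of_mem_nhds h.eventually_nhds, ρ, hρ, fun w hw => hw⟩
  have hUo : IsOpen {z | ∀ᶠ w in 𝓝 z, S.RegularAt ρ w} := isOpen_setOfPred_eventually_nhds
  obtain ⟨δ, hδ, hthick⟩ := hKc.exists_cthickening_subset_open hUo hreg
  -- Half of `ρ` leaves a uniqueness radius of twice the tube width, so heights up to and including
  -- the width are strictly inside it.
  refine ⟨min δ (ρ / 2), lt_min hδ (half_pos hρ), fun t ht x hx => ?_⟩
  have ht' : t ∈ Icc 0 T := ⟨ha.le.trans ht.1, ht.2.trans hb.le⟩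
  obtain ⟨h1, h2⟩ := S.proj_spec ht' x
  have hmem : (x, t) ∈ Metric.cthickening δ K := by
    refine Metric.mem_cthickening_of_dist_le (x, t) (S.proj x t, t) δ K ⟨ht, h1⟩ ?_
    rw [Prod.dist_eq, dist_self, h2]
    exact max_le (hx.trans (min_le_left _ _)) hδ.le
  refine (hthick hmem : ∀ᶠ w in 𝓝 (x, t), S.RegularAt ρ w).mono fun w hw => hw.mono ?_
  linarith [min_le_right δ (ρ / 2)]

theorem proj_of_mem {t : ℝ} (ht : t ∈ Icc 0 T) {y : E3} (hy : y ∈ S.Γ t) : S.proj y t = y := by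
  obtain ⟨_, h2⟩ := S.proj_spec ht y
  rw [Metric.infDist_zero_of_mem hy, dist_eq_zero] at h2
  exact h2.symm

theorem sdist_of_mem {t : ℝ} (ht : t ∈ Icc 0 T) {y : E3} (hy : y ∈ S.Γ t) : S.sdist y t = 0 := by
  rw [sdist, S.proj_of_mem ht hy, sub_self, inner_zero_left]

/-- The normal field extended to be constant in the normal direction. -/
def normalExt (z : E3 × ℝ) : E3 := S.ν (S.proj z.1 z.2) z.2

theorem norm_normalExt {z : E3 × ℝ} (hz : z.2 ∈ Icc 0 T) : ‖S.normalExt z‖ = 1 :=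
  S.norm_normal hz (S.proj_spec hz z.1).1

section Regular

variable {S} {ρ : ℝ} {z : E3 × ℝ} (hz : ∀ᶠ w in 𝓝 z, S.RegularAt ρ w)
include hz

/-- Differentiate `‖n‖ ^ 2 = 1`. -/
theorem inner_fderiv_normalExt (w : E3 × ℝ) :
    inner ℝ (S.normalExt z) (fderiv ℝ S.normalExt z w) = 0 := by
  have hd : HasFDerivAt S.normalExt (fderiv ℝ S.normalExt z) z :=
    (hz.self_of_nhds.contDiffAt_normal.differentiableAt (by simp)).hasFDerivAt
  have h1 := hd.norm_sq
  have h2 : (fun w => ‖S.normalExt w‖ ^ 2) =ᶠ[𝓝 z] fun _ => 1 := by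
    filter_upwards [hz] with w hw
    rw [S.norm_normalExt (Ioo_subset_Icc_self hw.mem_Ioo), one_pow]
  have h3 := h1.unique ((hasFDerivAt_const (1 : ℝ) z).congr_of_eventuallyEq h2)
  have h4 := congrArg (fun f => f w) h3
  simpa using h4

/-- The signed distance has spatial gradient `ν` and time derivative `-V`. -/
theorem fderiv_sdist (w : E3 × ℝ) :
    fderiv ℝ (Function.uncurry S.sdist) z w =
      inner ℝ (S.normalExt z) w.1 - w.2 * S.V (S.proj z.1 z.2) z.2 := by
  have hz0 := hz.self_of_nhds
  have hzt := Ioo_subset_Icc_self hz0.mem_Ioo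
  have hn : HasFDerivAt S.normalExt (fderiv ℝ S.normalExt z) z :=
    (hz0.contDiffAt_normal.differentiableAt (by simp)).hasFDerivAt
  have hp := (hz0.contDiffAt_proj.differentiableAt (by simp)).hasFDerivAt
  have hd := (hz0.contDiffAt_sdist.differentiableAt (by simp)).hasFDerivAt
  have h1 := hp.add (hd.smul hn)
  -- Differentiate `x = π + d n` and pair with `n`: the term with the derivative of `n` drops out,
  -- and `n · dπ` is `V dt`.
  have h2 : (fun w : E3 × ℝ => w.1) =ᶠ[𝓝 z]
      (Function.uncurry S.proj + Function.uncurry S.sdist • S.normalExt) := by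
    filter_upwards [hz] with w hw
    exact S.sub_proj_eq (Ioo_subset_Icc_self hw.mem_Ioo) w.1
  have h3 := (hasFDerivAt_fst (𝕜 := ℝ) (p := z)).unique (h1.congr_of_eventuallyEq h2)
  have h4 := congrArg (fun f => inner ℝ (S.normalExt z) (f w)) h3
  have h5 : inner ℝ (S.normalExt z) (fderiv ℝ (Function.uncurry S.proj) z w) =
    w.2 * S.V (S.proj z.1 z.2) z.2 := hz0.inner_fderiv_proj w
  simp only [ContinuousLinearMap.coe_fst', _root_.add_apply, _root_.smul_apply,
    ContinuousLinearMap.smulRight_apply, inner_add_right, inner_smul_right,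
    inner_fderiv_normalExt hz, real_inner_self_eq_norm_sq, S.norm_normalExt hzt, h5] at h4
  linarith

theorem proj_sdist_add_smul {y : E3} (hy : y ∈ S.Γ z.2) {r : ℝ} (hr : |r| < ρ)
    (hx : z.1 = y + r • S.ν y z.2) : S.proj z.1 z.2 = y ∧ S.sdist z.1 z.2 = r := by
  obtain ⟨h1, h2⟩ := hz.self_of_nhds.unique y hy r hr hx
  exact ⟨h1.symm, h2.symm⟩

/-- Moving along the normal keeps the same foot with shifted height; uniqueness says that this is
still the closest point. -/
theorem eventually_normal_line (hd : |S.sdist z.1 z.2| < ρ) :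
    ∀ᶠ s : ℝ in 𝓝 0, S.proj (z.1 + s • S.normalExt z) z.2 = S.proj z.1 z.2 ∧
      S.sdist (z.1 + s • S.normalExt z) z.2 = S.sdist z.1 z.2 + s := by
  have hc : Tendsto (fun s : ℝ => (z.1 + s • S.normalExt z, z.2)) (𝓝 0) (𝓝 z) := by
    have : Continuous (fun s : ℝ => (z.1 + s • S.normalExt z, z.2)) := by fun_prop
    simpa using this.tendsto 0
  have hs : ∀ᶠ s : ℝ in 𝓝 0, |S.sdist z.1 z.2 + s| < ρ := by
    have : Continuous fun s : ℝ => |S.sdist z.1 z.2 + s| := by fun_prop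
    exact this.continuousAt.eventually_lt_const (by simpa using hd)
  have hzt := Ioo_subset_Icc_self hz.self_of_nhds.mem_Ioo
  filter_upwards [hc.eventually hz, hs] with s h1 h2
  obtain ⟨h3, h4⟩ := h1.unique (S.proj z.1 z.2) (S.proj_spec hzt z.1).1 _ h2 (by
    conv_lhs => rw [S.sub_proj_eq hzt z.1]
    simp only [normalExt]
    module)
  exact ⟨h3.symm, h4.symm⟩

theorem fderiv_comp_proj_normal {F : Type*} [NormedAddCommGroup F] [NormedSpace ℝ F]
    (hd : |S.sdist z.1 z.2| < ρ) {c : E3 → ℝ → F}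
    (hc : DifferentiableAt ℝ (fun w : E3 × ℝ => c (S.proj w.1 w.2) w.2) z) :
    fderiv ℝ (fun w : E3 × ℝ => c (S.proj w.1 w.2) w.2) z (S.normalExt z, 0) = 0 := by
  have hline : HasDerivAt (fun s : ℝ => (z.1 + s • S.normalExt z, z.2)) (S.normalExt z, 0) 0 := by
    refine HasDerivAt.prodMk ?_ (hasDerivAt_const 0 z.2)
    simpa using ((hasDerivAt_id (0 : ℝ)).smul_const (S.normalExt z)).const_add z.1
  have hc' : HasFDerivAt (fun w : E3 × ℝ => c (S.proj w.1 w.2) w.2)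
      (fderiv ℝ (fun w : E3 × ℝ => c (S.proj w.1 w.2) w.2) z)
      ((fun s : ℝ => (z.1 + s • S.normalExt z, z.2)) 0) := by
    simpa using hc.hasFDerivAt
  have h1 := hc'.comp_hasDerivAt 0 hline
  refine h1.unique ((hasDerivAt_const (0 : ℝ) (c (S.proj z.1 z.2) z.2)).congr_of_eventuallyEq ?_)
  filter_upwards [eventually_normal_line hz hd] with s hs
  simp [hs.1]

end Regular

end MovingSurface

end

end ThinFluid

/-! ### Expansion of the Jacobian and mean curvature -/

namespace ThinFluid

noncomputable section

open scoped NNReal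

section Matrices

theorem fderiv_slice {F : Type*} [NormedAddCommGroup F] [NormedSpace ℝ F] {f : E3 × ℝ → F}
    {x : E3} {t : ℝ} (h : DifferentiableAt ℝ f (x, t)) :
    fderiv ℝ (fun y => f (y, t)) x = (fderiv ℝ f (x, t)).comp (ContinuousLinearMap.inl ℝ E3 ℝ) :=
  (HasFDerivAt.comp (g := f) x h.hasFDerivAt (hasFDerivAt_prodMk_left x t)).fderiv

theorem contDiffAt_slice {F : Type*} [NormedAddCommGroup F] [NormedSpace ℝ F] {f : E3 × ℝ → F}
    {x : E3} {t : ℝ} {n : WithTop ℕ∞} (h : ContDiffAt ℝ n f (x, t)) :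
    ContDiffAt ℝ n (fun y => f (y, t)) x :=
  ContDiffAt.comp (g := f) x h (by fun_prop)

theorem sum_smul_e (a : E3) : ∑ i, a i • e i = a := by
  ext j
  fin_cases j <;> simp [e, Fin.sum_univ_three]

theorem sum_mul_gradMatrix (F : E3 → E3) (x a : E3) (j : Fin 3) :
    ∑ i, a i * gradMatrix F x i j = (fderiv ℝ F x a) j := by
  conv_rhs => rw [← sum_smul_e a]
  simp [gradMatrix]

theorem abs_gradMatrix_le (F : E3 → E3) (x : E3) (i j : Fin 3) :
    |gradMatrix F x i j| ≤ ‖fderiv ℝ F x‖ := by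
  have h1 : |gradMatrix F x i j| ≤ ‖fderiv ℝ F x (e i)‖ := by
    simpa [gradMatrix] using PiLp.norm_apply_le (fderiv ℝ F x (e i)) j
  have h2 : ‖e i‖ = 1 := by simp [e]
  have h3 := (fderiv ℝ F x).le_opNorm (e i)
  rw [h2, mul_one] at h3
  exact h1.trans h3

theorem det_one_add_smul_fderiv (F : E3 → E3) (x : E3) (r : ℝ) :
    (ContinuousLinearMap.id ℝ E3 + r • fderiv ℝ F x).det = (1 + r • gradMatrix F x).det := by
  rw [ContinuousLinearMap.det, ← LinearMap.det_toMatrix (EuclideanSpace.basisFun (Fin 3) ℝ).toBasis,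
    ← Matrix.det_transpose]
  congr 1
  ext i j
  simp only [Matrix.transpose_apply, LinearMap.toMatrix_apply, OrthonormalBasis.coe_toBasis,
    EuclideanSpace.basisFun_apply, OrthonormalBasis.coe_toBasis_repr_apply,
    EuclideanSpace.basisFun_repr, Matrix.add_apply, Matrix.smul_apply, gradMatrix, Matrix.of_apply,
    ContinuousLinearMap.coe_coe, _root_.add_apply, _root_.smul_apply, ContinuousLinearMap.id_apply,
    PiLp.add_apply, PiLp.smul_apply, e]
  congr 1
  rw [Matrix.one_apply]
  simp [eq_comm]

/-- The quadratic coefficient is the sum of the three principal minors, six products of two entries;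
the cubic one is `det M`, six products of three. -/
theorem abs_det_one_add_smul_sub_le {M : Matrix (Fin 3) (Fin 3) ℝ} {B : ℝ} (hM : ∀ i j, |M i j| ≤ B)
    {r : ℝ} (hr : |r| ≤ 1) :
    |(1 + r • M).det - (1 + r * M.trace)| ≤ (6 * B ^ 2 + 6 * B ^ 3) * r ^ 2 := by
  have hB : 0 ≤ B := (abs_nonneg _).trans (hM 0 0)
  have h2 : ∀ i j k l, |M i j * M k l| ≤ B ^ 2 := fun i j k l => by
    rw [abs_mul, sq]
    exact mul_le_mul (hM _ _) (hM _ _) (abs_nonneg _) hB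
  have h3 : |M.det| ≤ 6 * B ^ 3 := by
    have := Matrix.det_le (A := M) (abv := AbsoluteValue.abs) (x := B) hM
    simpa [Nat.factorial] using this
  have hexp : (1 + r • M).det - (1 + r * M.trace) =
      r ^ 2 * ((M 0 0 * M 1 1 - M 0 1 * M 1 0) + (M 0 0 * M 2 2 - M 0 2 * M 2 0) +
        (M 1 1 * M 2 2 - M 1 2 * M 2 1) + r * M.det) := by
    simp [Matrix.det_fin_three, Matrix.trace, Fin.sum_univ_three]
    ring
  have hc2 : |(M 0 0 * M 1 1 - M 0 1 * M 1 0) + (M 0 0 * M 2 2 - M 0 2 * M 2 0) +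
        (M 1 1 * M 2 2 - M 1 2 * M 2 1)| ≤ 6 * B ^ 2 := by
    have a1 := abs_le.1 (h2 0 0 1 1)
    have a2 := abs_le.1 (h2 0 1 1 0)
    have a3 := abs_le.1 (h2 0 0 2 2)
    have a4 := abs_le.1 (h2 0 2 2 0)
    have a5 := abs_le.1 (h2 1 1 2 2)
    have a6 := abs_le.1 (h2 1 2 2 1)
    rw [abs_le]
    constructor <;> linarith
  rw [hexp, abs_mul, abs_of_nonneg (sq_nonneg r), mul_comm]
  gcongr
  refine (abs_add_le _ _).trans (add_le_add hc2 ?_)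
  rw [abs_mul]
  nlinarith [abs_nonneg r, abs_nonneg M.det]

end Matrices

namespace MovingSurface

variable {T : ℝ} (S : MovingSurface T)

/-- The extended normal field at time `t`. -/
def normalAt (t : ℝ) (x : E3) : E3 := S.normalExt (x, t)

/-- The derivative of the extended normal field at time `t`. -/
def weingarten (t : ℝ) (x : E3) : E3 →L[ℝ] E3 := fderiv ℝ (S.normalAt t) x

theorem normalAt_of_mem {t : ℝ} (ht : t ∈ Icc 0 T) {y : E3} (hy : y ∈ S.Γ t) :
    S.normalAt t y = S.ν y t := by
  rw [normalAt, normalExt, S.proj_of_mem ht hy]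

theorem weingarten_eq {ρ : ℝ} {x : E3} {t : ℝ} (hz : ∀ᶠ w in 𝓝 (x, t), S.RegularAt ρ w) :
    S.weingarten t x =
      (fderiv ℝ S.normalExt (x, t)).comp (ContinuousLinearMap.inl ℝ E3 ℝ) :=
  fderiv_slice (f := S.normalExt)
    (hz.self_of_nhds.contDiffAt_normal.differentiableAt (by simp))

/-- Flatness is strict differentiability of the signed distance: it vanishes at both points of the
surface and its gradient is the normal. -/
theorem normalField {t : ℝ} (ht : t ∈ Ioo 0 T) :
    NormalField (S.Γ t) (S.normalAt t) (S.weingarten t) := by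
  have ht' := Ioo_subset_Icc_self ht
  have hreg : ∀ y ∈ S.Γ t, ∃ ρ > 0, ∀ᶠ w in 𝓝 (y, t), S.RegularAt ρ w := fun y hy =>
    S.eventually_regularAt (z₀ := (y, t)) ⟨ht, hy⟩
  have hcd : ∀ y ∈ S.Γ t, ContDiffAt ℝ 1 (S.normalAt t) y := by
    intro y hy
    obtain ⟨ρ, -, hz⟩ := hreg y hy
    exact contDiffAt_slice (f := S.normalExt) hz.self_of_nhds.contDiffAt_normal
  refine ⟨S.isCompact_Γ ht', fun y hy => S.norm_normalExt ht', fun y hy => ?_, fun y hy => ?_,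
    fun y hy h => ?_, fun y hy => ?_, fun y hy δ hδ => ?_⟩
  · exact (hcd y hy).hasStrictFDerivAt (by simp)
  · obtain ⟨ρ, hρ, hz⟩ := hreg y hy
    rw [S.weingarten_eq hz]
    have h0 : |S.sdist y t| < ρ := by rwa [S.sdist_of_mem ht' hy, abs_zero]
    exact fderiv_comp_proj_normal hz h0 (c := S.ν)
      (hz.self_of_nhds.contDiffAt_normal.differentiableAt (by simp))
  · obtain ⟨ρ, hρ, hz⟩ := hreg y hy
    rw [S.weingarten_eq hz]
    exact inner_fderiv_normalExt hz (h, 0)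
  · exact ((hcd y hy).continuousAt_fderiv (by simp)).continuousWithinAt
  · obtain ⟨ρ, hρ, hz⟩ := hreg y hy
    have hs : ContDiffAt ℝ 1 (fun x => S.sdist x t) y :=
      contDiffAt_slice (f := Function.uncurry S.sdist) hz.self_of_nhds.contDiffAt_sdist
    have hs' := hs.hasStrictFDerivAt (by simp)
    filter_upwards [hs'.isLittleO.bound hδ] with p hp h1 h2
    have hf : fderiv ℝ (fun x => S.sdist x t) y (p.1 - p.2) =
        inner ℝ (S.normalAt t y) (p.1 - p.2) := by
      have h3 : fderiv ℝ (fun x => S.sdist x t) y = _ :=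
        fderiv_slice (f := Function.uncurry S.sdist)
          (hz.self_of_nhds.contDiffAt_sdist.differentiableAt (by simp))
      rw [h3]
      simp only [ContinuousLinearMap.comp_apply, ContinuousLinearMap.inl_apply, fderiv_sdist hz]
      simp [normalAt]
    rw [S.sdist_of_mem ht' h1, S.sdist_of_mem ht' h2, hf, sub_self, zero_sub, norm_neg,
      Real.norm_eq_abs] at hp
    exact hp

theorem tanProj_mul_gradMatrix {y : E3} {t : ℝ} {F : E3 → E3} (h : fderiv ℝ F y (S.ν y t) = 0) :
    S.tanProj y t * gradMatrix F y = gradMatrix F y := by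
  rw [tanProj, Matrix.sub_mul, Matrix.one_mul, sub_eq_self]
  ext i j
  have := sum_mul_gradMatrix F y (S.ν y t) j
  rw [h] at this
  simp only [Matrix.mul_apply, Matrix.of_apply, mul_assoc, ← Finset.mul_sum, this]
  simp

theorem meanCurv_eq {t : ℝ} (ht : t ∈ Ioo 0 T) {y : E3} (hy : y ∈ S.Γ t) :
    S.meanCurv y t = -(gradMatrix (S.normalAt t) y).trace := by
  have h := (S.normalField ht).deriv_normal y hy
  rw [S.normalAt_of_mem (Ioo_subset_Icc_self ht) hy] at h
  have h2 : S.tanGrad S.ν y t = gradMatrix (S.normalAt t) y :=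
    S.tanProj_mul_gradMatrix (F := S.normalAt t) h
  rw [meanCurv, h2]

/-- Uniform properties of a tubular neighbourhood for times in a compact interval. -/
structure Tube (a b ε₀ C : ℝ) : Prop where
  pos_left : 0 < a
  lt_right : b < T
  pos : 0 < ε₀
  le_one : ε₀ ≤ 1
  regular : ∀ t ∈ Icc a b, ∀ x, Metric.infDist x (S.Γ t) ≤ ε₀ →
      ∀ᶠ w in 𝓝 (x, t), S.RegularAt (2 * ε₀) w
  abs_meanCurv_le : ∀ t ∈ Icc a b, ∀ y ∈ S.Γ t, |S.meanCurv y t| ≤ C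
  half_le_jac : ∀ t ∈ Icc a b, ∀ y ∈ S.Γ t, ∀ r, |r| ≤ ε₀ →
    1 / 2 ≤ (displaceDeriv (S.weingarten t) (y, r)).det
  abs_jac_sub_le : ∀ t ∈ Icc a b, ∀ y ∈ S.Γ t, ∀ r, |r| ≤ ε₀ →
    |(displaceJac (S.weingarten t) (y, r) : ℝ) - (1 - r * S.meanCurv y t)| ≤ C * r ^ 2

theorem exists_tube {a b : ℝ} (ha : 0 < a) (hb : b < T) : ∃ ε₀ C, S.Tube a b ε₀ C := by
  obtain ⟨ε₁, hε₁, hreg⟩ := S.exists_regular_tube ha hb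
  have hK := S.isCompact_spaceTime_Icc ha hb
  have hcont : ContinuousOn (fun z => fderiv ℝ S.normalExt z)
      {z : E3 × ℝ | z.2 ∈ Icc a b ∧ z.1 ∈ S.Γ z.2} := by
    intro z hz
    have := (hreg z.2 hz.1 z.1 (by rw [Metric.infDist_zero_of_mem hz.2]; exact hε₁.le)).self_of_nhds
    exact (ContDiffAt.continuousAt_fderiv (f := S.normalExt) this.contDiffAt_normal
      (by simp)).continuousWithinAt
  obtain ⟨B, hB⟩ := hK.exists_bound_of_continuousOn hcont
  have hT : ∀ t ∈ Icc a b, t ∈ Ioo 0 T := fun t ht => ⟨ha.trans_le ht.1, ht.2.trans_lt hb⟩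
  have hentry : ∀ t ∈ Icc a b, ∀ y ∈ S.Γ t, ∀ i j,
      |gradMatrix (S.normalAt t) y i j| ≤ |B| := by
    intro t ht y hy i j
    refine (abs_gradMatrix_le _ _ _ _).trans ?_
    have hz := hreg t ht y (by rw [Metric.infDist_zero_of_mem hy]; exact hε₁.le)
    have h1 : fderiv ℝ (S.normalAt t) y = _ := S.weingarten_eq hz
    rw [h1]
    refine (ContinuousLinearMap.opNorm_comp_le _ _).trans ?_
    have h2 : ‖ContinuousLinearMap.inl ℝ E3 ℝ‖ ≤ 1 := ContinuousLinearMap.norm_inl_le_one ℝ E3 ℝ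
    have h3 := (hB (y, t) ⟨ht, hy⟩).trans (le_abs_self B)
    nlinarith [norm_nonneg (fderiv ℝ S.normalExt (y, t)),
      norm_nonneg (ContinuousLinearMap.inl ℝ E3 ℝ)]
  -- The first two terms bound the remainder of the determinant, the last one the trace.
  set C := 6 * |B| ^ 2 + 6 * |B| ^ 3 + 3 * |B| with hC
  have hC0 : 0 ≤ C := by positivity
  have htr : ∀ t ∈ Icc a b, ∀ y ∈ S.Γ t, |S.meanCurv y t| ≤ C := by
    intro t ht y hy
    rw [S.meanCurv_eq (hT t ht) hy, abs_neg, Matrix.trace, Fin.sum_univ_three]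
    simp only [Matrix.diag_apply]
    have a1 := hentry t ht y hy 0 0
    have a2 := hentry t ht y hy 1 1
    have a3 := hentry t ht y hy 2 2
    have : 0 ≤ 6 * |B| ^ 2 + 6 * |B| ^ 3 := by positivity
    refine (abs_add_three _ _ _).trans ?_
    rw [hC]
    linarith
  -- With `C * ε₀ ≤ 1 / 4`, the linear and the quadratic term each lower the determinant by at most
  -- `1 / 4`.
  set ε₀ := min (min ε₁ 1) (1 / (4 * (C + 1))) with hε₀
  have hε₀1 : ε₀ ≤ ε₁ := (min_le_left _ _).trans (min_le_left _ _)
  have hε₀2 : ε₀ ≤ 1 := (min_le_left _ _).trans (min_le_right _ _)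
  have hε₀3 : ε₀ * (C + 1) ≤ 1 / 4 := by
    have : ε₀ ≤ 1 / (4 * (C + 1)) := min_le_right _ _
    rw [le_div_iff₀ (by positivity)] at this
    linarith
  have hε₀p : 0 < ε₀ := lt_min (lt_min hε₁ one_pos) (by positivity)
  have hdet : ∀ t ∈ Icc a b, ∀ y ∈ S.Γ t, ∀ r, |r| ≤ ε₀ →
      |(displaceDeriv (S.weingarten t) (y, r)).det - (1 - r * S.meanCurv y t)| ≤ C * r ^ 2 := by
    intro t ht y hy r hr
    have h1 : (displaceDeriv (S.weingarten t) (y, r)).det =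
        (1 + r • gradMatrix (S.normalAt t) y).det := det_one_add_smul_fderiv _ _ _
    have h2 := abs_det_one_add_smul_sub_le (hentry t ht y hy) (hr.trans hε₀2)
    rw [h1, S.meanCurv_eq (hT t ht) hy]
    have h3 : (1 : ℝ) - r * -(gradMatrix (S.normalAt t) y).trace =
      1 + r * (gradMatrix (S.normalAt t) y).trace := by ring
    rw [h3]
    refine h2.trans (mul_le_mul_of_nonneg_right ?_ (sq_nonneg r))
    rw [hC]
    linarith [abs_nonneg B]
  have hhalf : ∀ t ∈ Icc a b, ∀ y ∈ S.Γ t, ∀ r, |r| ≤ ε₀ →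
      1 / 2 ≤ (displaceDeriv (S.weingarten t) (y, r)).det := by
    intro t ht y hy r hr
    have h1 := (abs_le.1 (hdet t ht y hy r hr)).1
    have h2 : |r * S.meanCurv y t| ≤ ε₀ * C := by
      rw [abs_mul]
      exact mul_le_mul hr (htr t ht y hy) (abs_nonneg _) hε₀p.le
    have h3 := (abs_le.1 h2).2
    have h4 : r ^ 2 ≤ ε₀ := by
      rw [← sq_abs]
      nlinarith [abs_nonneg r]
    nlinarith
  refine ⟨ε₀, C, ha, hb, hε₀p, hε₀2, fun t ht x hx => ?_, htr, hhalf, fun t ht y hy r hr => ?_⟩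
  · refine (hreg t ht x (hx.trans hε₀1)).mono fun w hw => hw.mono ?_
    linarith
  · have h1 : (displaceJac (S.weingarten t) (y, r) : ℝ) =
        (displaceDeriv (S.weingarten t) (y, r)).det := by
      rw [displaceJac, coe_nnnorm, Real.norm_eq_abs, abs_of_nonneg]
      linarith [hhalf t ht y hy r hr]
    rw [h1]
    exact hdet t ht y hy r hr

end MovingSurface

end

end ThinFluid

/-! ### The thin domain and its boundary in normal coordinates -/

namespace ThinFluid

noncomputable section

open scoped NNReal

namespace MovingSurface

variable {T : ℝ} {S : MovingSurface T}

section Boundary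

variable {ρ : ℝ} {x : E3} {t : ℝ} (hz : ∀ᶠ w in 𝓝 (x, t), S.RegularAt ρ w)
include hz

/-- `σ` records the side of the surface. Off the surface the signed distance keeps its sign locally,
so the distance inherits its derivatives up to `σ`; boundary normal and velocity become `σ ν` and `σ
V`. -/
theorem infDist_eventuallyEq_signed {σ : ℝ} (hσ : 0 < σ * S.sdist x t) (hσ1 : |σ| = 1) :
    (fun w : E3 × ℝ => Metric.infDist w.1 (S.Γ w.2)) =ᶠ[𝓝 (x, t)]
      fun w => σ * Function.uncurry S.sdist w := by
  have hc : ContinuousAt (fun w => σ * Function.uncurry S.sdist w) (x, t) :=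
    hz.self_of_nhds.contDiffAt_sdist.continuousAt.const_mul σ
  have hpos : ∀ᶠ w in 𝓝 (x, t), 0 < σ * Function.uncurry S.sdist w :=
    hc.eventually_const_lt hσ
  filter_upwards [hz, hpos] with w hw hw'
  rw [← S.abs_sdist (Ioo_subset_Icc_self hw.mem_Ioo)]
  have : |σ * Function.uncurry S.sdist w| = |S.sdist w.1 w.2| := by
    rw [abs_mul, hσ1, one_mul]
    rfl
  rw [← this, abs_of_pos hw']

theorem gradient_infDist {σ : ℝ} (hσ : 0 < σ * S.sdist x t) (hσ1 : |σ| = 1) :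
    gradient (fun y => Metric.infDist y (S.Γ t)) x = σ • S.normalExt (x, t) := by
  have he := infDist_eventuallyEq_signed hz hσ hσ1
  have hd : DifferentiableAt ℝ (fun w => σ * Function.uncurry S.sdist w) (x, t) :=
    (hz.self_of_nhds.contDiffAt_sdist.differentiableAt (by simp)).const_mul σ
  have hd' := hd.congr_of_eventuallyEq he
  have h1 : gradient (fun y => Metric.infDist y (S.Γ t)) x =
    spaceGrad (fun w : E3 × ℝ => Metric.infDist w.1 (S.Γ w.2)) (x, t) := rfl
  rw [h1]
  refine ext_inner_right ℝ fun w => ?_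
  rw [inner_spaceGrad hd', he.fderiv_eq,
    fderiv_const_mul (hz.self_of_nhds.contDiffAt_sdist.differentiableAt (by simp)),
    inner_smul_left]
  simp [fderiv_sdist hz]

theorem deriv_infDist {σ : ℝ} (hσ : 0 < σ * S.sdist x t) (hσ1 : |σ| = 1) :
    deriv (fun s => Metric.infDist x (S.Γ s)) t = -(σ * S.V (S.proj x t) t) := by
  have he := infDist_eventuallyEq_signed hz hσ hσ1
  have hd : DifferentiableAt ℝ (fun w => σ * Function.uncurry S.sdist w) (x, t) :=
    (hz.self_of_nhds.contDiffAt_sdist.differentiableAt (by simp)).const_mul σ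
  have hd' := hd.congr_of_eventuallyEq he
  have h1 := deriv_time_eq hd'
  simp only at h1
  rw [h1, he.fderiv_eq,
    fderiv_const_mul (hz.self_of_nhds.contDiffAt_sdist.differentiableAt (by simp))]
  simp [fderiv_sdist hz]

theorem bdryNormal_eq {σ : ℝ} (hσ : 0 < σ * S.sdist x t) (hσ1 : |σ| = 1) :
    S.bdryNormal x t = σ • S.normalExt (x, t) := by
  rw [bdryNormal, gradient_infDist hz hσ hσ1, norm_smul,
    S.norm_normalExt (Ioo_subset_Icc_self hz.self_of_nhds.mem_Ioo), Real.norm_eq_abs, hσ1]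
  simp

theorem bdryVelocity_eq {σ : ℝ} (hσ : 0 < σ * S.sdist x t) (hσ1 : |σ| = 1) :
    S.bdryVelocity x t = σ * S.V (S.proj x t) t := by
  rw [bdryVelocity, gradient_infDist hz hσ hσ1, deriv_infDist hz hσ hσ1, norm_smul,
    S.norm_normalExt (Ioo_subset_Icc_self hz.self_of_nhds.mem_Ioo), Real.norm_eq_abs, hσ1]
  simp

end Boundary

namespace Tube

variable {a b ε₀ C : ℝ} (hτ : S.Tube a b ε₀ C) {t : ℝ} (ht : t ∈ Icc a b)
include hτ ht

theorem mem_Ioo : t ∈ Ioo 0 T := ⟨hτ.pos_left.trans_le ht.1, ht.2.trans_lt hτ.lt_right⟩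

theorem mem_Icc : t ∈ Icc 0 T := Ioo_subset_Icc_self (hτ.mem_Ioo ht)

theorem displace_eq {y : E3} (hy : y ∈ S.Γ t) (r : ℝ) :
    displace (S.normalAt t) (y, r) = y + r • S.ν y t := by
  rw [displace, S.normalAt_of_mem (hτ.mem_Icc ht) hy]

theorem infDist_displace_le {y : E3} (hy : y ∈ S.Γ t) (r : ℝ) :
    Metric.infDist (displace (S.normalAt t) (y, r)) (S.Γ t) ≤ |r| := by
  refine (Metric.infDist_le_dist_of_mem hy).trans ?_
  rw [hτ.displace_eq ht hy, dist_eq_norm, add_sub_cancel_left, norm_smul,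
    S.norm_normal (hτ.mem_Icc ht) hy, mul_one, Real.norm_eq_abs]

theorem regular_displace {y : E3} (hy : y ∈ S.Γ t) {r : ℝ} (hr : |r| ≤ ε₀) :
    ∀ᶠ w in 𝓝 (displace (S.normalAt t) (y, r), t), S.RegularAt (2 * ε₀) w :=
  hτ.regular t ht _ ((hτ.infDist_displace_le ht hy r).trans hr)

theorem proj_displace {y : E3} (hy : y ∈ S.Γ t) {r : ℝ} (hr : |r| ≤ ε₀) :
    S.proj (displace (S.normalAt t) (y, r)) t = y :=
  (proj_sdist_add_smul (hτ.regular_displace ht hy hr) hy (by linarith [hτ.pos])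
    (hτ.displace_eq ht hy r)).1

theorem sdist_displace {y : E3} (hy : y ∈ S.Γ t) {r : ℝ} (hr : |r| ≤ ε₀) :
    S.sdist (displace (S.normalAt t) (y, r)) t = r :=
  (proj_sdist_add_smul (hτ.regular_displace ht hy hr) hy (by linarith [hτ.pos])
    (hτ.displace_eq ht hy r)).2

theorem infDist_displace {y : E3} (hy : y ∈ S.Γ t) {r : ℝ} (hr : |r| ≤ ε₀) :
    Metric.infDist (displace (S.normalAt t) (y, r)) (S.Γ t) = |r| := by
  rw [← S.abs_sdist (hτ.mem_Icc ht), hτ.sdist_displace ht hy hr]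

theorem normalExt_displace {y : E3} (hy : y ∈ S.Γ t) {r : ℝ} (hr : |r| ≤ ε₀) :
    S.normalExt (displace (S.normalAt t) (y, r), t) = S.ν y t := by
  rw [normalExt]
  simp only
  rw [hτ.proj_displace ht hy hr]

theorem displace_proj (x : E3) :
    displace (S.normalAt t) (S.proj x t, S.sdist x t) = x := by
  rw [hτ.displace_eq ht (S.proj_spec (hτ.mem_Icc ht) x).1, ← S.sub_proj_eq (hτ.mem_Icc ht) x]

theorem injOn_displace : InjOn (displace (S.normalAt t)) (S.Γ t ×ˢ Icc (-ε₀) ε₀) := by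
  rintro ⟨y, r⟩ ⟨hy, hr⟩ ⟨y', r'⟩ ⟨hy', hr'⟩ h
  have hr := abs_le.2 hr
  have hr' := abs_le.2 hr'
  have h1 := hτ.proj_displace ht hy hr
  have h2 := hτ.sdist_displace ht hy hr
  rw [h] at h1 h2
  rw [hτ.proj_displace ht hy' hr'] at h1
  rw [hτ.sdist_displace ht hy' hr'] at h2
  exact Prod.ext h1.symm h2.symm

theorem Ω_eq_image (ε : ℝ) :
    S.Ω ε t = displace (S.normalAt t) '' (S.Γ t ×ˢ Ioo (-ε) ε) := by
  ext x
  constructor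
  · intro hx
    have hx : Metric.infDist x (S.Γ t) < ε := hx
    rw [← S.abs_sdist (hτ.mem_Icc ht)] at hx
    exact ⟨(S.proj x t, S.sdist x t), ⟨(S.proj_spec (hτ.mem_Icc ht) x).1, abs_lt.1 hx⟩,
      hτ.displace_proj ht x⟩
  · rintro ⟨⟨y, r⟩, ⟨hy, hr⟩, rfl⟩
    exact (hτ.infDist_displace_le ht hy r).trans_lt (abs_lt.2 hr)

/-- The frontier lies in the level set of the distance. Conversely each point at height `±ε` is a
limit of points of smaller height along its normal. -/
theorem frontier_Ω {ε : ℝ} (hε0 : 0 < ε) (hε : ε ≤ ε₀) :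
    frontier (S.Ω ε t) = (fun y => displace (S.normalAt t) (y, ε)) '' S.Γ t ∪
      (fun y => displace (S.normalAt t) (y, -ε)) '' S.Γ t := by
  have hopen : IsOpen (S.Ω ε t) := isOpen_lt (Metric.continuous_infDist_pt _) continuous_const
  have key : ∀ y ∈ S.Γ t, ∀ σ : ℝ, |σ| = 1 →
      displace (S.normalAt t) (y, σ * ε) ∈ frontier (S.Ω ε t) := by
    intro y hy σ hσ
    have habs : |σ * ε| = ε := by rw [abs_mul, hσ, one_mul, abs_of_pos hε0]
    rw [hopen.frontier_eq]
    constructor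
    · have hlim : Tendsto (fun s : ℝ => displace (S.normalAt t) (y, σ * s)) (𝓝[<] ε)
          (𝓝 (displace (S.normalAt t) (y, σ * ε))) := by
        have : Continuous (fun s : ℝ => displace (S.normalAt t) (y, σ * s)) := by
          simp only [displace]
          fun_prop
        exact (this.tendsto ε).mono_left nhdsWithin_le_nhds
      refine mem_closure_of_tendsto hlim ?_
      filter_upwards [Ioo_mem_nhdsLT hε0] with s hs
      refine (hτ.infDist_displace_le ht hy _).trans_lt ?_
      rw [abs_mul, hσ, one_mul, abs_of_pos hs.1]
      exact hs.2
    · intro h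
      have h : Metric.infDist _ (S.Γ t) < ε := h
      rw [hτ.infDist_displace ht hy (habs.le.trans hε), habs] at h
      exact lt_irrefl _ h
  apply Subset.antisymm
  · intro x hx
    have hx1 : Metric.infDist x (S.Γ t) = ε :=
      frontier_lt_subset_eq (Metric.continuous_infDist_pt _) continuous_const hx
    rw [← S.abs_sdist (hτ.mem_Icc ht)] at hx1
    have hp := (S.proj_spec (hτ.mem_Icc ht) x).1
    rcases eq_or_eq_neg_of_abs_eq hx1 with h | h
    · left
      refine ⟨S.proj x t, hp, ?_⟩
      simp only
      rw [← h, hτ.displace_proj ht]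
    · right
      refine ⟨S.proj x t, hp, ?_⟩
      simp only
      rw [← h, hτ.displace_proj ht]
  · rintro x (⟨y, hy, rfl⟩ | ⟨y, hy, rfl⟩)
    · simpa using key y hy 1 (by simp)
    · simpa using key y hy (-1) (by simp)

theorem displace_mem_frontier {ε : ℝ} (hε0 : 0 < ε) (hε : ε ≤ ε₀) {y : E3} (hy : y ∈ S.Γ t) {σ : ℝ}
    (hσ : σ = 1 ∨ σ = -1) : displace (S.normalAt t) (y, σ * ε) ∈ frontier (S.Ω ε t) := by
  rw [hτ.frontier_Ω ht hε0 hε]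
  rcases hσ with rfl | rfl
  · left
    exact ⟨y, hy, by simp⟩
  · right
    exact ⟨y, hy, by simp⟩

theorem bdryNormal_displace {ε : ℝ} (hε0 : 0 < ε) (hε : ε ≤ ε₀) {y : E3} (hy : y ∈ S.Γ t) {σ : ℝ}
    (hσ : σ = 1 ∨ σ = -1) :
    S.bdryNormal (displace (S.normalAt t) (y, σ * ε)) t = σ • S.ν y t := by
  have hσ1 : |σ| = 1 := by rcases hσ with rfl | rfl <;> simp
  have habs : |σ * ε| ≤ ε₀ := by rwa [abs_mul, hσ1, one_mul, abs_of_pos hε0]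
  rw [MovingSurface.bdryNormal_eq (hτ.regular_displace ht hy habs) ?_ hσ1,
    hτ.normalExt_displace ht hy habs]
  rw [hτ.sdist_displace ht hy habs, ← mul_assoc, ← sq, ← sq_abs, hσ1]
  simpa using hε0

theorem bdryVelocity_displace {ε : ℝ} (hε0 : 0 < ε) (hε : ε ≤ ε₀) {y : E3} (hy : y ∈ S.Γ t) {σ : ℝ}
    (hσ : σ = 1 ∨ σ = -1) :
    S.bdryVelocity (displace (S.normalAt t) (y, σ * ε)) t = σ * S.V y t := by
  have hσ1 : |σ| = 1 := by rcases hσ with rfl | rfl <;> simp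
  have habs : |σ * ε| ≤ ε₀ := by rwa [abs_mul, hσ1, one_mul, abs_of_pos hε0]
  rw [MovingSurface.bdryVelocity_eq (hτ.regular_displace ht hy habs) ?_ hσ1,
    hτ.proj_displace ht hy habs]
  rw [hτ.sdist_displace ht hy habs, ← mul_assoc, ← sq, ← sq_abs, hσ1]
  simpa using hε0

theorem det_ne_zero {y : E3} (hy : y ∈ S.Γ t) {r : ℝ} (hr : |r| ≤ ε₀) :
    (displaceDeriv (S.weingarten t) (y, r)).det ≠ 0 := by
  have := hτ.half_le_jac t ht y hy r hr
  linarith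

theorem setIntegral_Ω {ε : ℝ} (hε : ε ≤ ε₀) {f : E3 → ℝ} (hf : ContinuousOn f (S.Ω ε t)) :
    ∫ x in S.Ω ε t, f x =
      ∫ z in S.Γ t ×ˢ Ioo (-ε) ε,
        displaceJac (S.weingarten t) z * f (displace (S.normalAt t) z)
          ∂((μHE[2].restrict (S.Γ t)).prod (volume : Measure ℝ)) := by
  have hsub : ∀ r ∈ Ioo (-ε) ε, |r| ≤ ε₀ := fun r hr => (abs_lt.2 hr).le.trans hε
  rw [hτ.Ω_eq_image ht ε] at hf ⊢
  refine (S.normalField (hτ.mem_Ioo ht)).setIntegral_displace measurableSet_Ioo ?_ ?_ hf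
  · rintro ⟨y, r⟩ ⟨hy, hr⟩
    exact hτ.det_ne_zero ht hy (hsub r hr)
  · exact (hτ.injOn_displace ht).mono (prod_mono_right fun r hr => abs_le.1 (hsub r hr))

theorem integrableOn_Γ {g : E3 → ℝ} (hg : ContinuousOn g (S.Γ t)) :
    IntegrableOn g (S.Γ t) μHE[2] := by
  have hN := S.normalField (hτ.mem_Ioo ht)
  obtain ⟨M, hM⟩ := hN.isCompact.exists_bound_of_continuousOn hg
  have hm := hN.isCompact.isClosed.measurableSet
  exact IntegrableOn.of_bound hN.measure_lt_top (hg.aestronglyMeasurable hm) M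
    ((ae_restrict_iff' hm).2 (Eventually.of_forall hM))

theorem setIntegral_frontier_Ω {ε : ℝ} (hε0 : 0 < ε) (hε : ε ≤ ε₀) {f : E3 → ℝ}
    (hf : ContinuousOn f (frontier (S.Ω ε t))) :
    ∫ x in frontier (S.Ω ε t), f x ∂μHE[2] =
      ∫ y in S.Γ t, (displaceJac (S.weingarten t) (y, ε) * f (displace (S.normalAt t) (y, ε)) +
        displaceJac (S.weingarten t) (y, -ε) * f (displace (S.normalAt t) (y, -ε))) ∂μHE[2] := by
  have hN := S.normalField (hτ.mem_Ioo ht)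
  have hΓ := hN.isCompact
  have habs : |ε| ≤ ε₀ := by rwa [abs_of_pos hε0]
  have habs' : |-ε| ≤ ε₀ := by rwa [abs_neg]
  have hinj : ∀ r, |r| ≤ ε₀ → InjOn (fun y => displace (S.normalAt t) (y, r)) (S.Γ t) := by
    intro r hr y hy y' hy' h
    have := hτ.injOn_displace ht ⟨hy, abs_le.1 hr⟩ ⟨hy', abs_le.1 hr⟩ h
    exact congrArg Prod.fst this
  have hdet : ∀ r, |r| ≤ ε₀ → ∀ y ∈ S.Γ t, (displaceDeriv (S.weingarten t) (y, r)).det ≠ 0 :=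
    fun r hr y hy => hτ.det_ne_zero ht hy hr
  have hc : ∀ r, IsCompact ((fun y => displace (S.normalAt t) (y, r)) '' S.Γ t) := fun r =>
    hΓ.image_of_continuousOn (hN.continuousOn_displace_slice r)
  rw [hτ.frontier_Ω ht hε0 hε] at hf ⊢
  have hf' : ∀ r, (fun y => displace (S.normalAt t) (y, r)) '' S.Γ t ⊆
      (fun y => displace (S.normalAt t) (y, ε)) '' S.Γ t ∪
        (fun y => displace (S.normalAt t) (y, -ε)) '' S.Γ t → |r| ≤ ε₀ →
      IntegrableOn f ((fun y => displace (S.normalAt t) (y, r)) '' S.Γ t) μHE[2] ∧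
      ContinuousOn (fun y => displaceJac (S.weingarten t) (y, r) *
        f (displace (S.normalAt t) (y, r))) (S.Γ t) := by
    intro r hsub hr
    have hfr := hf.mono hsub
    obtain ⟨M, hM⟩ := (hc r).exists_bound_of_continuousOn hfr
    have hm := (hc r).isClosed.measurableSet
    refine ⟨IntegrableOn.of_bound (hN.measure_displace_slice_lt_top (hdet r hr) (hinj r hr))
      (hfr.aestronglyMeasurable hm) M ((ae_restrict_iff' hm).2 (Eventually.of_forall hM)), ?_⟩
    exact (NNReal.continuous_coe.comp_continuousOn (hN.continuousOn_displaceJac_slice r)).mul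
      (hfr.comp (hN.continuousOn_displace_slice r) (mapsTo_image _ _))
  obtain ⟨hi1, hc1⟩ := hf' ε subset_union_left habs
  obtain ⟨hi2, hc2⟩ := hf' (-ε) subset_union_right habs'
  have hdisj : Disjoint ((fun y => displace (S.normalAt t) (y, ε)) '' S.Γ t)
      ((fun y => displace (S.normalAt t) (y, -ε)) '' S.Γ t) := by
    rw [Set.disjoint_left]
    rintro _ ⟨y, hy, rfl⟩ ⟨y', hy', h⟩
    have := hτ.injOn_displace ht ⟨hy', abs_le.1 habs'⟩ ⟨hy, abs_le.1 habs⟩ h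
    have h2 : -ε = ε := congrArg Prod.snd this
    linarith
  rw [setIntegral_union hdisj (hc _).isClosed.measurableSet hi1 hi2,
    hN.setIntegral_displace_slice (hdet _ habs) (hinj _ habs) (hf.mono subset_union_left),
    hN.setIntegral_displace_slice (hdet _ habs') (hinj _ habs') (hf.mono subset_union_right),
    ← integral_add (hτ.integrableOn_Γ ht hc1) (hτ.integrableOn_Γ ht hc2)]

end Tube

end MovingSurface

end

end ThinFluid

/-! ### Comparing rescaled thin-domain integrals with surface integrals -/

namespace ThinFluid

noncomputable section

open scoped NNReal

namespace MovingSurface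

variable {T : ℝ} {S : MovingSurface T}

namespace Tube

variable {a b ε₀ C : ℝ} (hτ : S.Tube a b ε₀ C)
include hτ

theorem const_nonneg {t : ℝ} (ht : t ∈ Icc a b) : 0 ≤ C := by
  obtain ⟨y, hy⟩ := (S.isConnected t (hτ.mem_Icc ht)).nonempty
  exact (abs_nonneg _).trans (hτ.abs_meanCurv_le t ht y hy)

theorem abs_jac_sub_one_le {t : ℝ} (ht : t ∈ Icc a b) {y : E3} (hy : y ∈ S.Γ t) {r : ℝ}
    (hr : |r| ≤ ε₀) : |(displaceJac (S.weingarten t) (y, r) : ℝ) - 1| ≤ 2 * C * |r| := by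
  have h1 := hτ.abs_jac_sub_le t ht y hy r hr
  have h2 := hτ.abs_meanCurv_le t ht y hy
  have hC := hτ.const_nonneg ht
  have h3 : |r * S.meanCurv y t| ≤ C * |r| := by
    rw [abs_mul, mul_comm]
    gcongr
  have h4 : C * r ^ 2 ≤ C * |r| := by
    rw [← sq_abs]
    have : |r| ^ 2 ≤ |r| := by nlinarith [abs_nonneg r, hτ.le_one]
    gcongr
  calc |(displaceJac (S.weingarten t) (y, r) : ℝ) - 1|
      = |((displaceJac (S.weingarten t) (y, r) : ℝ) - (1 - r * S.meanCurv y t)) +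
          -(r * S.meanCurv y t)| := by congr 1; ring
    _ ≤ _ := abs_add_le _ _
    _ ≤ 2 * C * |r| := by rw [abs_neg]; linarith

section

variable {t : ℝ} (ht : t ∈ Icc a b)
include ht

theorem measureReal_prod {ε : ℝ} (hε0 : 0 < ε) :
    ((μHE[2].restrict (S.Γ t)).prod (volume : Measure ℝ)).real (S.Γ t ×ˢ Ioo (-ε) ε) =
      2 * ε * μHE[2].real (S.Γ t) := by
  have hN := S.normalField (hτ.mem_Ioo ht)
  have := hN.isFiniteMeasure_restrict
  rw [measureReal_prod_prod]
  simp only [measureReal_def, Measure.restrict_apply_self, Real.volume_Ioo]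
  rw [ENNReal.toReal_ofReal (by linarith)]
  ring

theorem measure_prod_lt_top (ε : ℝ) :
    ((μHE[2].restrict (S.Γ t)).prod (volume : Measure ℝ)) (S.Γ t ×ˢ Ioo (-ε) ε) < ⊤ := by
  have hN := S.normalField (hτ.mem_Ioo ht)
  have := hN.isFiniteMeasure_restrict
  rw [Measure.prod_prod]
  exact ENNReal.mul_lt_top (by simpa using hN.measure_lt_top) (by simp)

theorem setIntegral_prod_fst {ε : ℝ} (hε0 : 0 < ε) (f : E3 → ℝ) :
    ∫ z in S.Γ t ×ˢ Ioo (-ε) ε, f z.1 ∂((μHE[2].restrict (S.Γ t)).prod (volume : Measure ℝ)) =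
      2 * ε * ∫ y in S.Γ t, f y ∂μHE[2] := by
  have hN := S.normalField (hτ.mem_Ioo ht)
  have := hN.isFiniteMeasure_restrict
  rw [← Measure.prod_restrict, Measure.restrict_restrict hN.isCompact.isClosed.measurableSet,
    inter_self]
  have h := integral_prod_mul (μ := μHE[2].restrict (S.Γ t))
    (ν := (volume : Measure ℝ).restrict (Ioo (-ε) ε)) f (fun _ => (1 : ℝ))
  simp only [mul_one] at h
  rw [h, integral_const, smul_eq_mul, mul_one]
  simp only [measureReal_def, Measure.restrict_apply_univ, Real.volume_Ioo]
  rw [ENNReal.toReal_ofReal (by linarith)]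
  ring

theorem abs_setIntegral_Ω_sub_le {ε : ℝ} (hε0 : 0 < ε) (hε : ε ≤ ε₀) {F f : E3 → ℝ} {η : ℝ}
    (hF : ContinuousOn F (S.Ω ε t)) (hf : ContinuousOn f (S.Γ t))
    (h : ∀ y ∈ S.Γ t, ∀ r, |r| < ε →
      |displaceJac (S.weingarten t) (y, r) * F (displace (S.normalAt t) (y, r)) - f y| ≤ η) :
    |(2 * ε)⁻¹ * (∫ x in S.Ω ε t, F x) - ∫ y in S.Γ t, f y ∂μHE[2]| ≤
      η * μHE[2].real (S.Γ t) := by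
  have hN := S.normalField (hτ.mem_Ioo ht)
  have hΓ := hN.isCompact
  set m := (μHE[2].restrict (S.Γ t)).prod (volume : Measure ℝ) with hm
  set B := S.Γ t ×ˢ Ioo (-ε) ε with hB
  have hBm : MeasurableSet B := hΓ.isClosed.measurableSet.prod measurableSet_Ioo
  have hB1 : B ⊆ S.Γ t ×ˢ univ := prod_mono_right (subset_univ _)
  have hdisp : ContinuousOn (displace (S.normalAt t)) B := hN.continuousOn_displace.mono hB1
  have hJ : ContinuousOn (fun z => (displaceJac (S.weingarten t) z : ℝ)) B :=
    NNReal.continuous_coe.comp_continuousOn (hN.continuousOn_displaceJac.mono hB1)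
  have hg1 : ContinuousOn (fun z => displaceJac (S.weingarten t) z *
      F (displace (S.normalAt t) z)) B := by
    refine hJ.mul (hF.comp hdisp ?_)
    rw [hτ.Ω_eq_image ht ε]
    exact mapsTo_image _ _
  have hg2 : ContinuousOn (fun z : E3 × ℝ => f z.1) B :=
    hf.comp continuousOn_fst fun z hz => hz.1
  obtain ⟨M, hM⟩ := hΓ.exists_bound_of_continuousOn hf
  have hB' : m B < ⊤ := hτ.measure_prod_lt_top ht ε
  have hi2 : IntegrableOn (fun z : E3 × ℝ => f z.1) B m :=
    IntegrableOn.of_bound hB' (hg2.aestronglyMeasurable hBm) M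
      ((ae_restrict_iff' hBm).2 (Eventually.of_forall fun z hz => hM z.1 hz.1))
  have hpt : ∀ z ∈ B, ‖displaceJac (S.weingarten t) z * F (displace (S.normalAt t) z) - f z.1‖ ≤ η :=
    fun z hz => h z.1 hz.1 z.2 (abs_lt.2 hz.2)
  have hi1 : IntegrableOn (fun z => displaceJac (S.weingarten t) z *
      F (displace (S.normalAt t) z)) B m := by
    refine IntegrableOn.of_bound hB' (hg1.aestronglyMeasurable hBm) (η + M)
      ((ae_restrict_iff' hBm).2 (Eventually.of_forall fun z hz => ?_))
    have h1 := hpt z hz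
    have h2 := hM z.1 hz.1
    have h3 := norm_le_insert' (displaceJac (S.weingarten t) z * F (displace (S.normalAt t) z))
      (f z.1)
    linarith
  have hdiff : ‖∫ z in B, (displaceJac (S.weingarten t) z * F (displace (S.normalAt t) z) - f z.1)
      ∂m‖ ≤ η * m.real B := norm_setIntegral_le_of_norm_le_const hB' hpt
  rw [integral_sub hi1 hi2, ← hτ.setIntegral_Ω ht hε hF, hτ.setIntegral_prod_fst ht hε0,
    hτ.measureReal_prod ht hε0, Real.norm_eq_abs] at hdiff
  have h2ε : 0 < 2 * ε := by linarith
  have : (2 * ε)⁻¹ * (∫ x in S.Ω ε t, F x) - ∫ y in S.Γ t, f y ∂μHE[2] =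
      (2 * ε)⁻¹ * ((∫ x in S.Ω ε t, F x) - 2 * ε * ∫ y in S.Γ t, f y ∂μHE[2]) := by
    field_simp
  rw [this, abs_mul, abs_of_pos (inv_pos.2 h2ε), inv_mul_le_iff₀ h2ε]
  linarith

/-- The two sheets are added over the same foot before estimating: with the factor `(2 * ε)⁻¹` each
alone may blow up, and only their sum is controlled. -/
theorem abs_setIntegral_frontier_sub_le {ε : ℝ} (hε0 : 0 < ε) (hε : ε ≤ ε₀) {F f : E3 → ℝ} {η : ℝ}
    (hF : ContinuousOn F (frontier (S.Ω ε t))) (hf : ContinuousOn f (S.Γ t))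
    (h : ∀ y ∈ S.Γ t,
      |(2 * ε)⁻¹ * (displaceJac (S.weingarten t) (y, ε) * F (displace (S.normalAt t) (y, ε)) +
        displaceJac (S.weingarten t) (y, -ε) * F (displace (S.normalAt t) (y, -ε))) - f y| ≤ η) :
    |(2 * ε)⁻¹ * (∫ x in frontier (S.Ω ε t), F x ∂μHE[2]) - ∫ y in S.Γ t, f y ∂μHE[2]| ≤
      η * μHE[2].real (S.Γ t) := by
  have hN := S.normalField (hτ.mem_Ioo ht)
  have hFc : ∀ σ : ℝ, (σ = 1 ∨ σ = -1) →
      ContinuousOn (fun y => displaceJac (S.weingarten t) (y, σ * ε) *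
        F (displace (S.normalAt t) (y, σ * ε))) (S.Γ t) := fun σ hσ =>
    (NNReal.continuous_coe.comp_continuousOn (hN.continuousOn_displaceJac_slice _)).mul
      (hF.comp (hN.continuousOn_displace_slice _)
        (fun y hy => hτ.displace_mem_frontier ht hε0 hε hy hσ))
  have h1 := hFc 1 (Or.inl rfl)
  have h2 := hFc (-1) (Or.inr rfl)
  simp only [one_mul, neg_one_mul] at h1 h2
  have h12 : ContinuousOn (fun y => (2 * ε)⁻¹ *
      (displaceJac (S.weingarten t) (y, ε) * F (displace (S.normalAt t) (y, ε)) +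
        displaceJac (S.weingarten t) (y, -ε) * F (displace (S.normalAt t) (y, -ε)))) (S.Γ t) :=
    continuousOn_const.mul (h1.add h2)
  rw [hτ.setIntegral_frontier_Ω ht hε0 hε hF, ← integral_const_mul,
    ← integral_sub (hτ.integrableOn_Γ ht h12)
      (hτ.integrableOn_Γ ht hf)]
  rw [← Real.norm_eq_abs]
  refine norm_setIntegral_le_of_norm_le_const hN.measure_lt_top fun y hy => ?_
  rw [Real.norm_eq_abs]
  exact h y hy

end

/-- The area of the surfaces is bounded for times in a compact interval. -/
theorem exists_area_bound : ∃ M, ∀ t ∈ Icc a b, μHE[2].real (S.Γ t) ≤ M := by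
  have hK := S.isCompact_spaceTime_Icc hτ.pos_left hτ.lt_right
  obtain ⟨R, hR⟩ := (hK.image continuous_fst).isBounded.subset_closedBall (0 : E3)
  -- The tube of width `ε₀` lies in one ball for all times, and its Jacobian is at least `1 / 2`, so
  -- its volume is at least `ε₀` times the area.
  refine ⟨ε₀⁻¹ * volume.real (Metric.closedBall (0 : E3) (R + ε₀)), fun t ht => ?_⟩
  have hN := S.normalField (hτ.mem_Ioo ht)
  have h2 : S.Ω ε₀ t ⊆ Metric.closedBall (0 : E3) (R + ε₀) := by
    intro x hx
    have hx : Metric.infDist x (S.Γ t) < ε₀ := hx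
    obtain ⟨h3, h4⟩ := S.proj_spec (hτ.mem_Icc ht) x
    have h5 := hR ⟨(S.proj x t, t), ⟨ht, h3⟩, rfl⟩
    rw [Metric.mem_closedBall] at h5 ⊢
    exact (dist_triangle x (S.proj x t) 0).trans (by simp only at h5; linarith)
  have h3 := hτ.setIntegral_Ω ht le_rfl (f := fun _ => 1) continuousOn_const
  simp only [mul_one, integral_const, smul_eq_mul, measureReal_def,
    Measure.restrict_apply_univ] at h3
  set m := (μHE[2].restrict (S.Γ t)).prod (volume : Measure ℝ) with hm
  set B := S.Γ t ×ˢ Ioo (-ε₀) ε₀ with hB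
  have hBm : MeasurableSet B := hN.isCompact.isClosed.measurableSet.prod measurableSet_Ioo
  have hB' : m B < ⊤ := hτ.measure_prod_lt_top ht ε₀
  have hr : ∀ z ∈ B, |z.2| ≤ ε₀ := fun z hz => (abs_lt.2 hz.2).le
  have hJ : ContinuousOn (fun z => (displaceJac (S.weingarten t) z : ℝ)) B :=
    NNReal.continuous_coe.comp_continuousOn
      (hN.continuousOn_displaceJac.mono (prod_mono_right (subset_univ _)))
  have hint : IntegrableOn (fun z => (displaceJac (S.weingarten t) z : ℝ)) B m := by
    refine IntegrableOn.of_bound hB' (hJ.aestronglyMeasurable hBm) (1 + 2 * C)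
      ((ae_restrict_iff' hBm).2 (Eventually.of_forall fun z hz => ?_))
    have h5 := hτ.abs_jac_sub_one_le ht hz.1 (hr z hz)
    have h6 := hτ.const_nonneg ht
    have h7 : 2 * C * |z.2| ≤ 2 * C := by nlinarith [(hr z hz).trans hτ.le_one]
    have h8 := (abs_le.1 h5).2
    rw [Real.norm_eq_abs, abs_of_nonneg (NNReal.coe_nonneg _)]
    linarith
  have hlow : (1 / 2) * m.real B ≤ ∫ z in B, (displaceJac (S.weingarten t) z : ℝ) ∂m := by
    have h5 : ∫ z in B, (1 / 2 : ℝ) ∂m ≤ ∫ z in B, (displaceJac (S.weingarten t) z : ℝ) ∂m := by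
      refine setIntegral_mono_on (integrableOn_const hB'.ne) hint hBm fun z hz => ?_
      have h6 := hτ.half_le_jac t ht z.1 hz.1 z.2 (hr z hz)
      rw [displaceJac, coe_nnnorm, Real.norm_eq_abs]
      exact h6.trans (le_abs_self _)
    rw [setIntegral_const, smul_eq_mul] at h5
    linarith
  rw [← h3, hτ.measureReal_prod ht hτ.pos] at hlow
  have h4 : volume.real (S.Ω ε₀ t) ≤ volume.real (Metric.closedBall (0 : E3) (R + ε₀)) :=
    measureReal_mono h2 measure_closedBall_lt_top.ne
  rw [measureReal_def] at h4
  rw [← div_eq_inv_mul, le_div_iff₀ hτ.pos]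
  linarith

/-- Continuous functions on the tube vary little along short normal segments. -/
theorem exists_uniform_normal {F : Type*} [NormedAddCommGroup F] {G : E3 × ℝ → F}
    (hG : ∀ t ∈ Icc a b, ∀ x, Metric.infDist x (S.Γ t) ≤ ε₀ → ContinuousAt G (x, t)) {η : ℝ}
    (hη : 0 < η) :
    ∃ δ > 0, δ ≤ ε₀ ∧ ∀ t ∈ Icc a b, ∀ y ∈ S.Γ t, ∀ r, |r| < δ →
      ‖G (displace (S.normalAt t) (y, r), t) - G (y, t)‖ < η := by
  set K := {z : E3 × ℝ | z.2 ∈ Icc a b ∧ z.1 ∈ S.Γ z.2} with hK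
  have hKc : IsCompact K := S.isCompact_spaceTime_Icc hτ.pos_left hτ.lt_right
  have hnc : ContinuousOn S.normalExt K := fun z hz =>
    ((hτ.regular z.2 hz.1 z.1 (by
      rw [Metric.infDist_zero_of_mem hz.2]
      exact hτ.pos.le)).self_of_nhds.contDiffAt_normal.continuousAt).continuousWithinAt
  have hg : ContinuousOn (fun p : (E3 × ℝ) × ℝ => G (displace (S.normalAt p.1.2) (p.1.1, p.2), p.1.2))
      (K ×ˢ Icc (-ε₀) ε₀) := by
    have hinner : ContinuousOn (fun p : (E3 × ℝ) × ℝ =>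
        (displace (S.normalAt p.1.2) (p.1.1, p.2), p.1.2)) (K ×ˢ Icc (-ε₀) ε₀) := by
      simp only [displace, normalAt]
      have h1 : ContinuousOn (fun p : (E3 × ℝ) × ℝ => S.normalExt (p.1.1, p.1.2))
          (K ×ˢ Icc (-ε₀) ε₀) := hnc.comp continuousOn_fst fun p hp => hp.1
      fun_prop
    intro p hp
    refine ContinuousAt.comp_continuousWithinAt (g := G) ?_ (hinner p hp)
    refine hG _ hp.1.1 _ ?_
    exact (hτ.infDist_displace_le hp.1.1 hp.1.2 _).trans (abs_le.2 hp.2)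
  have huc := (hKc.prod isCompact_Icc).uniformContinuousOn_of_continuous hg
  obtain ⟨δ, hδ, hδ'⟩ := Metric.uniformContinuousOn_iff.1 huc η hη
  refine ⟨min δ ε₀, lt_min hδ hτ.pos, min_le_right _ _, fun t ht y hy r hr => ?_⟩
  have hr1 : |r| < δ := hr.trans_le (min_le_left _ _)
  have hr2 : |r| < ε₀ := hr.trans_le (min_le_right _ _)
  have h := hδ' ((y, t), r) ⟨⟨ht, hy⟩, abs_le.1 hr2.le⟩ ((y, t), 0)
    ⟨⟨ht, hy⟩, by simp [hτ.pos.le]⟩ (by simpa [Prod.dist_eq, hδ] using hr1)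
  rw [dist_eq_norm] at h
  simpa [displace] using h

theorem exists_bound_surface {F : Type*} [NormedAddCommGroup F] {G : E3 × ℝ → F}
    (hG : ContinuousOn G {z : E3 × ℝ | z.2 ∈ Icc a b ∧ z.1 ∈ S.Γ z.2}) :
    ∃ M, 0 ≤ M ∧ ∀ t ∈ Icc a b, ∀ y ∈ S.Γ t, ‖G (y, t)‖ ≤ M := by
  obtain ⟨M, hM⟩ :=
    (S.isCompact_spaceTime_Icc hτ.pos_left hτ.lt_right).exists_bound_of_continuousOn hG
  exact ⟨|M|, abs_nonneg M, fun t ht y hy => (hM (y, t) ⟨ht, hy⟩).trans (le_abs_self M)⟩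

end Tube

end MovingSurface

end

end ThinFluid

/-! ### Expansions and uniform convergence to the surface -/

namespace ThinFluid

noncomputable section

open scoped NNReal

namespace MovingSurface

variable {T : ℝ} {S : MovingSurface T}

section Coefficients

variable {F : Type*} [NormedAddCommGroup F] [NormedSpace ℝ F]

/-- The coefficient is smooth only relative to the space-time hypersurface. The foot map sends a
full neighbourhood into it, so the composition is differentiable in the ordinary sense. -/
theorem contDiffAt_comp_proj {c : E3 → ℝ → F}
    (hc : ContDiffOn ℝ ∞ (Function.uncurry c) S.spaceTime) {ρ : ℝ} {z : E3 × ℝ}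
    (hz : ∀ᶠ w in 𝓝 z, S.RegularAt ρ w) :
    ContDiffAt ℝ 1 (fun w : E3 × ℝ => c (S.proj w.1 w.2) w.2) z := by
  set U := {w | S.RegularAt ρ w} with hU
  have hUz : U ∈ 𝓝 z := hz
  have hmaps : MapsTo (fun w : E3 × ℝ => (S.proj w.1 w.2, w.2)) U S.spaceTime := fun w hw =>
    ⟨hw.mem_Ioo, (S.proj_spec (Ioo_subset_Icc_self hw.mem_Ioo) w.1).1⟩
  have h1 : ContDiffAt ℝ 1 (fun w : E3 × ℝ => (S.proj w.1 w.2, w.2)) z :=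
    hz.self_of_nhds.contDiffAt_proj.prodMk contDiffAt_snd
  have h2 : ContDiffWithinAt ℝ 1 (Function.uncurry c) S.spaceTime (S.proj z.1 z.2, z.2) :=
    (hc _ (hmaps hz.self_of_nhds)).of_le (by exact_mod_cast le_top)
  have h3 : ContDiffWithinAt ℝ 1 (fun w : E3 × ℝ => c (S.proj w.1 w.2) w.2) U z :=
    ContDiffWithinAt.comp (g := Function.uncurry c)
      (f := fun w : E3 × ℝ => (S.proj w.1 w.2, w.2)) z h2 h1.contDiffWithinAt hmaps
  exact h3.contDiffAt hUz

variable (S) in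
/-- The truncated expansion `∑ⱼ d^j c_j(π)`. -/
def expansion {k : ℕ} (c : Fin k → E3 → ℝ → F) (z : E3 × ℝ) : F :=
  ∑ j : Fin k, S.sdist z.1 z.2 ^ (j : ℕ) • c j (S.proj z.1 z.2) z.2

theorem contDiffAt_expansion {k : ℕ} {c : Fin k → E3 → ℝ → F}
    (hc : ∀ j, ContDiffOn ℝ ∞ (Function.uncurry (c j)) S.spaceTime) {ρ : ℝ} {z : E3 × ℝ}
    (hz : ∀ᶠ w in 𝓝 z, S.RegularAt ρ w) : ContDiffAt ℝ 1 (S.expansion c) z := by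
  unfold expansion
  refine ContDiffAt.sum fun j _ => ?_
  exact ((hz.self_of_nhds.contDiffAt_sdist).pow j).smul (contDiffAt_comp_proj (hc j) hz)

theorem Tube.expansion_displace {a b ε₀ C : ℝ} (hτ : S.Tube a b ε₀ C) {t : ℝ} (ht : t ∈ Icc a b)
    {y : E3} (hy : y ∈ S.Γ t) {r : ℝ} (hr : |r| ≤ ε₀) {k : ℕ} (c : Fin k → E3 → ℝ → F) :
    S.expansion c (displace (S.normalAt t) (y, r), t) = ∑ j : Fin k, r ^ (j : ℕ) • c j y t := by
  simp only [expansion, hτ.proj_displace ht hy hr, hτ.sdist_displace ht hy hr]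

/-- The remainder bounds hold up to the lateral boundary. -/
theorem HasExpansion.exists_remainder_bound {a b ε₀ C : ℝ} (hτ : S.Tube a b ε₀ C) {k : ℕ}
    (hk : 1 ≤ k) {f : ℝ → E3 → ℝ → F} {c : Fin k → E3 → ℝ → F} (hf : S.HasExpansion f c) :
    ∃ M, 0 ≤ M ∧ ∀ᶠ ε : ℝ in 𝓝[>] 0, ∀ t ∈ Icc a b, ∀ y ∈ S.Γ t, ∀ r, |r| ≤ ε →
      ‖f ε (displace (S.normalAt t) (y, r)) t -
        S.expansion c (displace (S.normalAt t) (y, r), t)‖ ≤ M * |r| ^ k ∧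
      ‖fderiv ℝ (Function.uncurry (f ε)) (displace (S.normalAt t) (y, r), t) -
        fderiv ℝ (S.expansion c) (displace (S.normalAt t) (y, r), t)‖ ≤ M * |r| ^ (k - 1) := by
  obtain ⟨M, hM⟩ := hf.remainder a b hτ.pos_left hτ.lt_right
  refine ⟨|M|, abs_nonneg M, ?_⟩
  filter_upwards [hM, hf.smooth, Ioo_mem_nhdsGT hτ.pos] with ε hε hsm hε0 t ht y hy r hr
  set rem : E3 × ℝ → F := fun z => f ε z.1 z.2 - S.expansion c z with hrem
  have hreg : ∀ s, |s| ≤ ε → ∀ᶠ w in 𝓝 (displace (S.normalAt t) (y, s), t),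
      S.RegularAt (2 * ε₀) w := fun s hs => hτ.regular_displace ht hy (hs.trans hε0.2.le)
  have hclos : ∀ s, |s| ≤ ε → displace (S.normalAt t) (y, s) ∈ closure (S.Ω ε t) := by
    intro s hs
    rcases hs.lt_or_eq with h | h
    · exact subset_closure ((hτ.infDist_displace_le ht hy s).trans_lt h)
    · apply frontier_subset_closure
      rcases eq_or_eq_neg_of_abs_eq h with h | h
      · simpa [h] using hτ.displace_mem_frontier ht hε0.1 hε0.2.le hy (Or.inl rfl)
      · simpa [h] using hτ.displace_mem_frontier ht hε0.1 hε0.2.le hy (Or.inr rfl)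
  have hfs : ∀ s, |s| ≤ ε → ContDiffAt ℝ 1 (Function.uncurry (f ε))
      (displace (S.normalAt t) (y, s), t) := fun s hs =>
    (hsm t (hτ.mem_Ioo ht) _ (hclos s hs)).of_le (by exact_mod_cast le_top)
  have hes : ∀ s, |s| ≤ ε → ContDiffAt ℝ 1 (S.expansion c)
      (displace (S.normalAt t) (y, s), t) := fun s hs =>
    contDiffAt_expansion hf.coeff_smooth (hreg s hs)
  have hrs : ∀ s, |s| ≤ ε → ContDiffAt ℝ 1 rem (displace (S.normalAt t) (y, s), t) :=
    fun s hs => (hfs s hs).sub (hes s hs)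
  have hint : ∀ s, |s| < ε →
      ‖rem (displace (S.normalAt t) (y, s), t)‖ ≤ |M| * |s| ^ k ∧
      ‖fderiv ℝ rem (displace (S.normalAt t) (y, s), t)‖ ≤ |M| * |s| ^ (k - 1) := by
    intro s hs
    have hΩ : displace (S.normalAt t) (y, s) ∈ S.Ω ε t :=
      (hτ.infDist_displace_le ht hy s).trans_lt hs
    have hsd := hτ.sdist_displace ht hy (hs.le.trans hε0.2.le)
    have h0 : ‖iteratedFDeriv ℝ 0 rem (displace (S.normalAt t) (y, s), t)‖ ≤
        M * |S.sdist (displace (S.normalAt t) (y, s)) t| ^ k := hε t ht _ hΩ 0 (Nat.zero_le k)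
    have h1 : ‖iteratedFDeriv ℝ 1 rem (displace (S.normalAt t) (y, s), t)‖ ≤
        M * |S.sdist (displace (S.normalAt t) (y, s)) t| ^ (k - 1) := hε t ht _ hΩ 1 hk
    rw [norm_iteratedFDeriv_zero, hsd] at h0
    rw [norm_iteratedFDeriv_one, hsd] at h1
    exact ⟨h0.trans (by gcongr; exact le_abs_self M), h1.trans (by gcongr; exact le_abs_self M)⟩
  have hgoal : ‖rem (displace (S.normalAt t) (y, r), t)‖ ≤ |M| * |r| ^ k ∧
      ‖fderiv ℝ rem (displace (S.normalAt t) (y, r), t)‖ ≤ |M| * |r| ^ (k - 1) := by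
    -- The hypothesis controls only the open domain; letting `θ ↑ 1` extends both bounds to `|r| =
    -- ε` by continuity.
    have hline : Tendsto (fun θ : ℝ => (displace (S.normalAt t) (y, θ * r), t)) (𝓝[<] 1)
        (𝓝 (displace (S.normalAt t) (y, r), t)) := by
      have : Continuous (fun θ : ℝ => (displace (S.normalAt t) (y, θ * r), t)) := by
        simp only [displace]
        fun_prop
      have h := (this.tendsto 1).mono_left (nhdsWithin_le_nhds (s := Iio 1))
      simpa using h
    have hpow : ∀ n : ℕ, Tendsto (fun θ : ℝ => |M| * |θ * r| ^ n) (𝓝[<] 1) (𝓝 (|M| * |r| ^ n)) := by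
      intro n
      have : Continuous (fun θ : ℝ => |M| * |θ * r| ^ n) := by fun_prop
      have h := (this.tendsto 1).mono_left (nhdsWithin_le_nhds (s := Iio 1))
      simpa using h
    have hθ : ∀ᶠ θ : ℝ in 𝓝[<] 1, |θ * r| < ε := by
      filter_upwards [Ioo_mem_nhdsLT one_pos] with θ hθ
      rw [abs_mul, abs_of_pos hθ.1]
      nlinarith [hθ.1, hθ.2, hε0.1, abs_nonneg r]
    constructor
    · refine le_of_tendsto_of_tendsto (((hrs r hr).continuousAt.tendsto.comp hline).norm) (hpow k) ?_
      filter_upwards [hθ] with θ h using (hint _ h).1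
    · refine le_of_tendsto_of_tendsto
        ((((hrs r hr).continuousAt_fderiv (by simp)).tendsto.comp hline).norm) (hpow (k - 1)) ?_
      filter_upwards [hθ] with θ h using (hint _ h).2
  refine ⟨hgoal.1, ?_⟩
  have hsub : fderiv ℝ rem (displace (S.normalAt t) (y, r), t) =
      fderiv ℝ (Function.uncurry (f ε)) (displace (S.normalAt t) (y, r), t) -
        fderiv ℝ (S.expansion c) (displace (S.normalAt t) (y, r), t) :=
    (((hfs r hr).differentiableAt (by simp)).hasFDerivAt.sub
      ((hes r hr).differentiableAt (by simp)).hasFDerivAt).fderiv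
  rw [← hsub]
  exact hgoal.2

end Coefficients

section UniformConvergence

variable {X : Type*} [NormedAddCommGroup X]

variable (S) in
/-- Uniform convergence, as the width of the tube shrinks, of functions on the tube to a function
on the surface. -/
def ConvergesToSurface (a b : ℝ) (G : ℝ → E3 → ℝ → X) (g : E3 → ℝ → X) : Prop :=
  ∀ η > 0, ∀ᶠ ε : ℝ in 𝓝[>] 0, ∀ t ∈ Icc a b, ∀ y ∈ S.Γ t, ∀ r, |r| ≤ ε →
    ‖G ε (displace (S.normalAt t) (y, r)) t - g y t‖ ≤ η

/-- Eventually all values lie in the compact ball of radius `M + 1`, where `Φ` is uniformly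
continuous. -/
theorem ConvergesToSurface.comp [ProperSpace X] {a b : ℝ} {G : ℝ → E3 → ℝ → X} {g : E3 → ℝ → X}
    (h : S.ConvergesToSurface a b G g) {M : ℝ} (hM : ∀ t ∈ Icc a b, ∀ y ∈ S.Γ t, ‖g y t‖ ≤ M)
    {Y : Type*} [NormedAddCommGroup Y] {Φ : X → Y} (hΦ : Continuous Φ) :
    S.ConvergesToSurface a b (fun ε x t => Φ (G ε x t)) (fun y t => Φ (g y t)) := by
  intro η hη
  have huc := (isCompact_closedBall (0 : X) (M + 1)).uniformContinuousOn_of_continuous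
    hΦ.continuousOn
  obtain ⟨δ, hδ, hδ'⟩ := Metric.uniformContinuousOn_iff.1 huc η hη
  filter_upwards [h (min (δ / 2) 1) (lt_min (half_pos hδ) one_pos)] with ε hε t ht y hy r hr
  have h1 := hε t ht y hy r hr
  have h2 := hM t ht y hy
  rw [← dist_eq_norm]
  refine (hδ' _ ?_ _ ?_ ?_).le
  · rw [mem_closedBall_zero_iff]
    have := norm_le_insert' (G ε (displace (S.normalAt t) (y, r)) t) (g y t)
    linarith [min_le_right (δ / 2) 1]
  · rw [mem_closedBall_zero_iff]
    linarith
  · rw [dist_eq_norm]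
    linarith [min_le_left (δ / 2) 1]

/-- The Jacobian is `1 + O(ε)` and the areas are bounded uniformly in time, so uniform pointwise
convergence passes to the averages over the thickness. -/
theorem Tube.tendsto_setIntegral_Ω {a b ε₀ C : ℝ} (hτ : S.Tube a b ε₀ C) {G : ℝ → E3 → ℝ → ℝ}
    {g : E3 → ℝ → ℝ} (h : S.ConvergesToSurface a b G g) {M : ℝ}
    (hM : ∀ t ∈ Icc a b, ∀ y ∈ S.Γ t, ‖g y t‖ ≤ M)
    (hG : ∀ᶠ ε : ℝ in 𝓝[>] 0, ∀ t ∈ Icc a b, ContinuousOn (fun x => G ε x t) (S.Ω ε t))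
    (hg : ∀ t ∈ Icc a b, ContinuousOn (fun y => g y t) (S.Γ t)) :
    ∀ η > 0, ∀ᶠ ε : ℝ in 𝓝[>] 0, ∀ t ∈ Icc a b,
      |(2 * ε)⁻¹ * (∫ x in S.Ω ε t, G ε x t) - ∫ y in S.Γ t, g y t ∂μHE[2]| ≤ η := by
  intro η hη
  obtain ⟨A, hA⟩ := hτ.exists_area_bound
  set A' := |A| + 1 with hA'
  have hA'0 : 0 < A' := by positivity
  set κ := min (η / (2 * A')) 1 with hκ
  have hκ0 : 0 < κ := lt_min (by positivity) one_pos
  have hsmall : ∀ᶠ ε : ℝ in 𝓝[>] 0, 2 * |C| * ε * (|M| + 1) < η / (2 * A') := by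
    have hc : Continuous fun ε : ℝ => 2 * |C| * ε * (|M| + 1) := by fun_prop
    have ht := (hc.tendsto 0).mono_left (nhdsWithin_le_nhds (s := Ioi 0))
    simp only [mul_zero, zero_mul] at ht
    exact ht.eventually_lt_const (by positivity)
  filter_upwards [h κ hκ0, hG, hsmall, Ioo_mem_nhdsGT hτ.pos] with ε h1 h2 h3 h4 t ht
  refine (hτ.abs_setIntegral_Ω_sub_le ht h4.1 h4.2.le (η := η / A') (h2 t ht) (hg t ht) ?_).trans ?_
  · intro y hy r hr
    have q1 := h1 t ht y hy r hr.le
    have q2 := hτ.abs_jac_sub_one_le ht hy (hr.le.trans h4.2.le)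
    have q3 := hM t ht y hy
    set J := (displaceJac (S.weingarten t) (y, r) : ℝ)
    set w := G ε (displace (S.normalAt t) (y, r)) t
    rw [Real.norm_eq_abs] at q1 q3
    have q4 : |w| ≤ |M| + 1 := by
      have e1 : |w| ≤ |w - g y t| + |g y t| := by
        have := abs_add_le (w - g y t) (g y t)
        rwa [sub_add_cancel] at this
      linarith [min_le_right (η / (2 * A')) 1, le_abs_self M]
    have q5 : |J - 1| ≤ 2 * |C| * ε := by
      refine q2.trans ?_
      have := le_abs_self C
      have := abs_nonneg C
      have := abs_nonneg r
      nlinarith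
    have q6 : 0 ≤ 2 * |C| * ε := (abs_nonneg _).trans q5
    calc |J * w - g y t| = |(J - 1) * w + (w - g y t)| := by congr 1; ring
      _ ≤ |J - 1| * |w| + |w - g y t| := by
        rw [← abs_mul]
        exact abs_add_le _ _
      _ ≤ 2 * |C| * ε * (|M| + 1) + κ := by gcongr
      _ ≤ η / (2 * A') + η / (2 * A') := add_le_add h3.le (min_le_left _ _)
      _ = η / A' := by field_simp; norm_num
  · have := hA t ht
    rw [div_mul_eq_mul_div, div_le_iff₀ hA'0]
    gcongr
    linarith [le_abs_self A]

end UniformConvergence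

end MovingSurface

end

end ThinFluid

/-! ### What the boundary conditions say about the coefficients -/

namespace ThinFluid

noncomputable section

open scoped NNReal

section Strain

/-- The strain rate of a velocity field with space-time derivative `L`. -/
def strainOf (L : E3 × ℝ →L[ℝ] E3) : Matrix (Fin 3) (Fin 3) ℝ :=
  Matrix.of fun i j => (1 / 2 : ℝ) * (L (e i, 0) j + L (e j, 0) i)

theorem strain_slice {f : E3 × ℝ → E3} {x : E3} {t : ℝ} (h : DifferentiableAt ℝ f (x, t)) :
    strain (fun y => f (y, t)) x = strainOf (fderiv ℝ f (x, t)) := by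
  ext i j
  simp [strain, strainOf, gradMatrix, fderiv_slice h]

theorem continuous_strainOf : Continuous strainOf := by
  unfold strainOf
  refine continuous_matrix fun i j => ?_
  simp only [Matrix.of_apply]
  fun_prop

theorem continuous_frobSq : Continuous frobSq := by
  unfold frobSq
  fun_prop

theorem continuous_matVec : Continuous fun p : Matrix (Fin 3) (Fin 3) ℝ × E3 => matVec p.1 p.2 := by
  unfold matVec
  refine (PiLp.continuous_toLp 2 _).comp ?_
  exact Continuous.matrix_mulVec continuous_fst ((PiLp.continuous_ofLp 2 _).comp continuous_snd)

theorem inner_eq_sum (a b : E3) : inner ℝ a b = ∑ i, a i * b i := by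
  simp [PiLp.inner_apply, mul_comm]

theorem matVec_apply (M : Matrix (Fin 3) (Fin 3) ℝ) (a : E3) (i : Fin 3) :
    matVec M a i = ∑ j, M i j * a j := by
  simp [matVec, Matrix.mulVec, dotProduct]

theorem sum_mul_apply (L : E3 × ℝ →L[ℝ] E3) (a : E3) (j : Fin 3) :
    ∑ i, a i * L (e i, 0) j = L (a, 0) j := by
  have h : ((a, 0) : E3 × ℝ) = ∑ i, a i • ((e i, 0) : E3 × ℝ) := by
    ext k
    · conv_lhs => rw [← sum_smul_e a]
      simp [Prod.fst_sum]
    · simp [Prod.snd_sum]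
  rw [h, map_sum]
  simp_rw [map_smul]
  simp

/-- A matrix and its symmetric part have the same quadratic form. -/
theorem inner_matVec_strainOf (L : E3 × ℝ →L[ℝ] E3) (n : E3) :
    inner ℝ (matVec (strainOf L) n) n = inner ℝ (L (n, 0)) n := by
  have h : ∀ j, L (n, 0) j = ∑ i, n i * L (e i, 0) j := fun j => (sum_mul_apply L n j).symm
  simp only [inner_eq_sum, matVec_apply, h, strainOf, Matrix.of_apply, Fin.sum_univ_three]
  ring

/-- If the strain rate annihilates the normal, then it is the projected tangential strain rate. -/
theorem eq_proj_mul_mul_proj {D M : Matrix (Fin 3) (Fin 3) ℝ} {n w : Fin 3 → ℝ}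
    (hn : n ⬝ᵥ n = 1)
    (hD : D = M + (1 / 2 : ℝ) • (Matrix.vecMulVec n w + Matrix.vecMulVec w n))
    (hDn : D.mulVec n = 0) (hDs : D.transpose = D) :
    D = (1 - Matrix.vecMulVec n n) * M * (1 - Matrix.vecMulVec n n) := by
  -- Since `D` is symmetric and kills `n`, projecting on either side leaves it unchanged, whereas
  -- the projection kills the rank-one corrections.
  have h1 : D * Matrix.vecMulVec n n = 0 := by
    rw [Matrix.mul_vecMulVec, hDn, Matrix.zero_vecMulVec]
  have h2 : Matrix.vecMulVec n n * D = 0 := by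
    rw [Matrix.vecMulVec_mul, ← Matrix.mulVec_transpose, hDs, hDn, Matrix.vecMulVec_zero]
  have h3 : (1 - Matrix.vecMulVec n n) * Matrix.vecMulVec n w = 0 := by
    rw [Matrix.sub_mul, Matrix.one_mul, Matrix.vecMulVec_mul_vecMulVec, hn, one_smul, sub_self]
  have h4 : Matrix.vecMulVec w n * (1 - Matrix.vecMulVec n n) = 0 := by
    rw [Matrix.mul_sub, Matrix.mul_one, Matrix.vecMulVec_mul_vecMulVec, hn, one_smul, sub_self]
  have hM : M = D - (1 / 2 : ℝ) • (Matrix.vecMulVec n w + Matrix.vecMulVec w n) := by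
    rw [hD, add_sub_cancel_right]
  have hPD : (1 - Matrix.vecMulVec n n) * D = D := by
    rw [Matrix.sub_mul, Matrix.one_mul, h2, sub_zero]
  have hDP : D * (1 - Matrix.vecMulVec n n) = D := by
    rw [Matrix.mul_sub, Matrix.mul_one, h1, sub_zero]
  generalize (1 : Matrix (Fin 3) (Fin 3) ℝ) - Matrix.vecMulVec n n = P at *
  rw [hM, Matrix.mul_sub, Matrix.sub_mul, hPD, hDP, Matrix.mul_smul, Matrix.smul_mul,
    Matrix.mul_add, Matrix.add_mul, h3, Matrix.zero_mul, Matrix.mul_assoc _ (Matrix.vecMulVec w n),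
    h4, Matrix.mul_zero, add_zero, smul_zero, sub_zero]

theorem eq_zero_of_abs_le {x : ℝ} {f : ℝ → ℝ} (h : ∀ᶠ ε : ℝ in 𝓝[>] 0, |x| ≤ f ε)
    (hf : Continuous f) (hf0 : f 0 = 0) : x = 0 := by
  have ht := (hf.tendsto 0).mono_left (nhdsWithin_le_nhds (s := Ioi 0))
  rw [hf0] at ht
  exact abs_nonpos_iff.1 (ge_of_tendsto ht h)

end Strain

namespace MovingSurface

variable {T : ℝ} {S : MovingSurface T}

section Velocity

variable {v v1 v2 : E3 → ℝ → E3}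

theorem Tube.expansion_displace_three {a b ε₀ C : ℝ} (hτ : S.Tube a b ε₀ C) {t : ℝ}
    (ht : t ∈ Icc a b) {y : E3} (hy : y ∈ S.Γ t) {r : ℝ} (hr : |r| ≤ ε₀) :
    S.expansion ![v, v1, v2] (displace (S.normalAt t) (y, r), t) =
      v y t + r • v1 y t + r ^ 2 • v2 y t := by
  rw [hτ.expansion_displace ht hy hr, Fin.sum_univ_three]
  simp

theorem Tube.fderiv_expansion_normal {a b ε₀ C : ℝ} (hτ : S.Tube a b ε₀ C)
    (hc : ∀ j, ContDiffOn ℝ ∞ (Function.uncurry (![v, v1, v2] j)) S.spaceTime) {t : ℝ}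
    (ht : t ∈ Icc a b) {y : E3} (hy : y ∈ S.Γ t) {r : ℝ} (hr : |r| ≤ ε₀) :
    fderiv ℝ (S.expansion ![v, v1, v2]) (displace (S.normalAt t) (y, r), t) (S.ν y t, 0) =
      v1 y t + (2 * r) • v2 y t := by
  have hz := hτ.regular_displace ht hy hr
  have hn := hτ.normalExt_displace ht hy hr
  have hs := hτ.sdist_displace ht hy hr
  have hp := hτ.proj_displace ht hy hr
  set x := displace (S.normalAt t) (y, r) with hx
  have hline : HasDerivAt (fun s : ℝ => (x + s • S.ν y t, t)) (S.ν y t, 0) 0 := by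
    refine HasDerivAt.prodMk ?_ (hasDerivAt_const 0 t)
    simpa using ((hasDerivAt_id (0 : ℝ)).smul_const (S.ν y t)).const_add x
  have hd : HasFDerivAt (S.expansion ![v, v1, v2]) (fderiv ℝ (S.expansion ![v, v1, v2]) (x, t))
      ((fun s : ℝ => (x + s • S.ν y t, t)) 0) := by
    simpa using ((contDiffAt_expansion hc hz).differentiableAt (by simp)).hasFDerivAt
  have h1 := hd.comp_hasDerivAt 0 hline
  have h2 : HasDerivAt (fun s : ℝ => v y t + (r + s) • v1 y t + (r + s) ^ 2 • v2 y t)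
      (v1 y t + (2 * r) • v2 y t) 0 := by
    have e1 : HasDerivAt (fun s : ℝ => r + s) 1 0 := (hasDerivAt_id 0).const_add r
    have e2 := (e1.smul_const (v1 y t)).const_add (v y t)
    have e3 := e2.add ((e1.pow 2).smul_const (v2 y t))
    simpa using! e3
  refine h1.unique (h2.congr_of_eventuallyEq ?_)
  have hlt : |S.sdist x t| < 2 * ε₀ := by
    rw [hs]
    linarith [hτ.pos]
  filter_upwards [eventually_normal_line hz hlt] with s hs'
  simp only [hn, hs, hp] at hs'
  simp only [Function.comp_apply, expansion, hs'.1, hs'.2, Fin.sum_univ_three]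
  simp

/-- Impermeability at heights `±ε` over one foot gives `α ± ε β + ε² γ = O(ε³)` for `α`, `β`, `γ`
independent of `ε`. Both signs are used to separate the odd coefficient from the even ones. The
cubic remainder is what reaches `γ`, needed later for the normal stress. -/
theorem inner_coeff_eq {u : ℝ → E3 → ℝ → E3} (hu : S.HasExpansion u ![v, v1, v2])
    (hnormal : ∀ᶠ ε : ℝ in 𝓝[>] 0, S.Impermeable ε (u ε)) {t : ℝ} (ht : t ∈ Ioo 0 T) {y : E3}
    (hy : y ∈ S.Γ t) :
    inner ℝ (v y t) (S.ν y t) = S.V y t ∧ inner ℝ (v1 y t) (S.ν y t) = 0 ∧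
      inner ℝ (v2 y t) (S.ν y t) = 0 := by
  obtain ⟨ε₀, C, hτ⟩ := S.exists_tube ht.1 ht.2
  have htt : t ∈ Icc t t := ⟨le_rfl, le_rfl⟩
  obtain ⟨M, hM0, hM⟩ := hu.exists_remainder_bound hτ (by norm_num)
  have hn := S.norm_normal (Ioo_subset_Icc_self ht) hy
  set n := S.ν y t with hndef
  set α := inner ℝ (v y t) n - S.V y t with hα
  set β := inner ℝ (v1 y t) n with hβ
  set γ := inner ℝ (v2 y t) n with hγ
  have key : ∀ σ : ℝ, (σ = 1 ∨ σ = -1) → ∀ᶠ ε : ℝ in 𝓝[>] 0,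
      |α + σ * ε * β + ε ^ 2 * γ| ≤ M * ε ^ 3 := by
    intro σ hσ
    have hσσ : σ * σ = 1 := by rcases hσ with rfl | rfl <;> norm_num
    have hσ1 : |σ| = 1 := by rcases hσ with rfl | rfl <;> simp
    filter_upwards [hM, hnormal, Ioo_mem_nhdsGT hτ.pos] with ε h1 h2 h3
    have habs : |σ * ε| = ε := by rw [abs_mul, hσ1, one_mul, abs_of_pos h3.1]
    have h4 := h2 t ht _ (hτ.displace_mem_frontier htt h3.1 h3.2.le hy hσ)
    rw [hτ.bdryNormal_displace htt h3.1 h3.2.le hy hσ,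
      hτ.bdryVelocity_displace htt h3.1 h3.2.le hy hσ, inner_smul_right] at h4
    have h5 : inner ℝ (u ε (displace (S.normalAt t) (y, σ * ε)) t) n = S.V y t := by
      have := congrArg (fun x => σ * x) h4
      simp only [← mul_assoc, hσσ, one_mul] at this
      exact this
    have h6 := (h1 t htt y hy (σ * ε) habs.le).1
    rw [hτ.expansion_displace_three htt hy (habs.le.trans h3.2.le), habs] at h6
    have h7 := (abs_real_inner_le_norm (u ε (displace (S.normalAt t) (y, σ * ε)) t -
      (v y t + (σ * ε) • v1 y t + (σ * ε) ^ 2 • v2 y t)) n)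
    rw [hn, mul_one] at h7
    have h8 : inner ℝ (u ε (displace (S.normalAt t) (y, σ * ε)) t -
      (v y t + (σ * ε) • v1 y t + (σ * ε) ^ 2 • v2 y t)) n = -(α + σ * ε * β + ε ^ 2 * γ) := by
      rw [inner_sub_left, inner_add_left, inner_add_left, inner_smul_left, inner_smul_left, h5]
      simp only [conj_trivial, mul_pow, hα, sq σ, hσσ]
      ring
    rw [h8, abs_neg] at h7
    exact h7.trans h6
  have hp := key 1 (Or.inl rfl)
  have hm := key (-1) (Or.inr rfl)
  -- Subtracting the two sides leaves `2 ε β = O(ε³)`.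
  have hβ0 : β = 0 := by
    refine eq_zero_of_abs_le (f := fun ε => M * ε ^ 2) ?_ (by fun_prop) (by simp)
    filter_upwards [hp, hm, self_mem_nhdsWithin] with ε h1 h2 h3
    have h3 : 0 < ε := h3
    rw [abs_le] at h1 h2 ⊢
    constructor <;> nlinarith
  have hα0 : α = 0 := by
    refine eq_zero_of_abs_le (f := fun ε => ε ^ 2 * |γ| + M * ε ^ 3) ?_ (by fun_prop) (by simp)
    filter_upwards [hp] with ε h1
    rw [hβ0, mul_zero, add_zero] at h1
    calc |α| = |(α + ε ^ 2 * γ) - ε ^ 2 * γ| := by rw [add_sub_cancel_right]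
      _ ≤ |α + ε ^ 2 * γ| + |ε ^ 2 * γ| := abs_sub _ _
      _ ≤ _ := by
        rw [abs_mul, abs_of_nonneg (sq_nonneg ε)]
        linarith
  have hγ0 : γ = 0 := by
    refine eq_zero_of_abs_le (f := fun ε => M * ε) ?_ (by fun_prop) (by simp)
    filter_upwards [hp, self_mem_nhdsWithin] with ε h1 h3
    have h3 : 0 < ε := h3
    rw [hβ0, hα0, mul_zero, zero_add, zero_add, abs_mul, abs_of_nonneg (sq_nonneg ε)] at h1
    have h4 : 0 < ε ^ 2 := by positivity
    have h5 : ε ^ 2 * |γ| ≤ ε ^ 2 * (M * ε) := by linarith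
    exact le_of_mul_le_mul_left h5 h4
  exact ⟨sub_eq_zero.1 hα0, hβ0, hγ0⟩

/-- The perfect slip condition in the limit of vanishing width. -/
theorem matVec_strainOf_normal {u : ℝ → E3 → ℝ → E3} (hu : S.HasExpansion u ![v, v1, v2])
    (hnormal : ∀ᶠ ε : ℝ in 𝓝[>] 0, S.Impermeable ε (u ε))
    (htan : ∀ᶠ ε : ℝ in 𝓝[>] 0, S.PerfectSlip ε (u ε)) {t : ℝ} (ht : t ∈ Ioo 0 T) {y : E3}
    (hy : y ∈ S.Γ t) :
    matVec (strainOf (fderiv ℝ (S.expansion ![v, v1, v2]) (y, t))) (S.ν y t) = 0 := by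
  obtain ⟨ε₀, C, hτ⟩ := S.exists_tube ht.1 ht.2
  have htt : t ∈ Icc t t := ⟨le_rfl, le_rfl⟩
  obtain ⟨M, hM0, hM⟩ := hu.exists_remainder_bound hτ (by norm_num)
  obtain ⟨-, hv1, -⟩ := inner_coeff_eq hu hnormal ht hy
  set n := S.ν y t with hndef
  have h0 : displace (S.normalAt t) (y, 0) = y := by simp [displace]
  have hz0 : ∀ᶠ w in 𝓝 (y, t), S.RegularAt (2 * ε₀) w := by
    simpa [h0] using hτ.regular_displace htt hy (r := 0) (by simpa using hτ.pos.le)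
  have hline : Tendsto (fun ε : ℝ => (displace (S.normalAt t) (y, ε), t)) (𝓝[>] 0) (𝓝 (y, t)) := by
    have : Continuous (fun ε : ℝ => (displace (S.normalAt t) (y, ε), t)) := by
      simp only [displace]
      fun_prop
    have h := (this.tendsto 0).mono_left (nhdsWithin_le_nhds (s := Ioi 0))
    rwa [h0] at h
  have hlim1 : Tendsto (fun ε : ℝ => fderiv ℝ (S.expansion ![v, v1, v2])
      (displace (S.normalAt t) (y, ε), t)) (𝓝[>] 0)
      (𝓝 (fderiv ℝ (S.expansion ![v, v1, v2]) (y, t))) :=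
    ((contDiffAt_expansion hu.coeff_smooth hz0).continuousAt_fderiv (by simp)).tendsto.comp hline
  have hlim2 : Tendsto (fun ε : ℝ => fderiv ℝ (Function.uncurry (u ε))
      (displace (S.normalAt t) (y, ε), t)) (𝓝[>] 0)
      (𝓝 (fderiv ℝ (S.expansion ![v, v1, v2]) (y, t))) := by
    refine tendsto_of_tendsto_of_dist hlim1 ?_
    have hb : Tendsto (fun ε : ℝ => M * ε ^ 2) (𝓝[>] 0) (𝓝 0) := by
      have : Continuous (fun ε : ℝ => M * ε ^ 2) := by fun_prop
      simpa using (this.tendsto 0).mono_left (nhdsWithin_le_nhds (s := Ioi 0))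
    refine squeeze_zero' (Eventually.of_forall fun _ => dist_nonneg) ?_ hb
    filter_upwards [hM, self_mem_nhdsWithin] with ε h1 h2
    have h2 : 0 < ε := h2
    have h3 := (h1 t htt y hy ε (abs_of_pos h2).le).2
    rw [dist_comm, dist_eq_norm]
    simpa [abs_of_pos h2] using h3
  set Ψ : (E3 × ℝ →L[ℝ] E3) → E3 := fun L => matVec (strainOf L) n -
    inner ℝ (matVec (strainOf L) n) n • n with hΨ
  have hmv : Continuous fun L : E3 × ℝ →L[ℝ] E3 => matVec (strainOf L) n :=
    continuous_matVec.comp (continuous_strainOf.prodMk continuous_const)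
  have hin : Continuous fun L : E3 × ℝ →L[ℝ] E3 => inner ℝ (matVec (strainOf L) n) n :=
    hmv.inner continuous_const
  have hΨc : Continuous Ψ := hmv.sub (hin.smul continuous_const)
  have hΨ0 : ∀ᶠ ε : ℝ in 𝓝[>] 0,
      Ψ (fderiv ℝ (Function.uncurry (u ε)) (displace (S.normalAt t) (y, ε), t)) = 0 := by
    filter_upwards [htan, hu.smooth, Ioo_mem_nhdsGT hτ.pos] with ε h1 h2 h3
    have hfr := hτ.displace_mem_frontier htt h3.1 h3.2.le hy (Or.inl rfl)
    have hbn := hτ.bdryNormal_displace htt h3.1 h3.2.le hy (Or.inl rfl)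
    rw [one_mul] at hfr hbn
    have h4 := h1 t ht _ hfr
    have hd : DifferentiableAt ℝ (Function.uncurry (u ε)) (displace (S.normalAt t) (y, ε), t) :=
      (h2 t ht _ (frontier_subset_closure hfr)).differentiableAt (by simp)
    have hstr : strain (fun y => u ε y t) (displace (S.normalAt t) (y, ε)) = _ := strain_slice hd
    rw [hbn, one_smul, hstr] at h4
    exact h4
  -- The slip condition is a continuous condition on the derivative, so it survives the limit on one
  -- sheet alone.
  have hfin : Ψ (fderiv ℝ (S.expansion ![v, v1, v2]) (y, t)) = 0 :=
    tendsto_nhds_unique ((hΨc.tendsto _).comp hlim2)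
      (tendsto_const_nhds.congr' (hΨ0.mono fun _ h => h.symm))
  -- The normal component of `D n` is `v1 · n = 0`, so vanishing of the tangential part is vanishing
  -- of the whole vector.
  have hnn : fderiv ℝ (S.expansion ![v, v1, v2]) (y, t) (n, 0) = v1 y t := by
    have := hτ.fderiv_expansion_normal hu.coeff_smooth htt hy (r := 0) (by simpa using hτ.pos.le)
    simpa [h0] using this
  simp only [hΨ, inner_matVec_strainOf, hnn, hv1, zero_smul, sub_zero] at hfin
  exact hfin

/-- On the surface `d = 0` and `∇d = ν`: the linear term contributes only through `∇d`, and the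
quadratic term not at all. -/
theorem fderiv_expansion_surface
    (hc : ∀ j, ContDiffOn ℝ ∞ (Function.uncurry (![v, v1, v2] j)) S.spaceTime) {t : ℝ}
    (ht : t ∈ Ioo 0 T) {y : E3} (hy : y ∈ S.Γ t) (w : E3) :
    fderiv ℝ (S.expansion ![v, v1, v2]) (y, t) (w, 0) =
      fderiv ℝ (fun x => v (S.proj x t) t) y w + inner ℝ (S.ν y t) w • v1 y t := by
  obtain ⟨ρ, hρ, hz⟩ := S.eventually_regularAt (z₀ := (y, t)) ⟨ht, hy⟩
  have ht' := Ioo_subset_Icc_self ht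
  have hp := S.proj_of_mem ht' hy
  have hs0 := S.sdist_of_mem ht' hy
  have hd : HasFDerivAt (𝕜 := ℝ) (Function.uncurry S.sdist) _ (y, t) :=
    (hz.self_of_nhds.contDiffAt_sdist.differentiableAt (by simp)).hasFDerivAt
  have d0 : DifferentiableAt ℝ (fun z : E3 × ℝ => v (S.proj z.1 z.2) z.2) (y, t) :=
    (contDiffAt_comp_proj (hc 0) hz).differentiableAt (by simp)
  have d1 : DifferentiableAt ℝ (fun z : E3 × ℝ => v1 (S.proj z.1 z.2) z.2) (y, t) :=
    (contDiffAt_comp_proj (hc 1) hz).differentiableAt (by simp)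
  have d2 : DifferentiableAt ℝ (fun z : E3 × ℝ => v2 (S.proj z.1 z.2) z.2) (y, t) :=
    (contDiffAt_comp_proj (hc 2) hz).differentiableAt (by simp)
  have hsum := (d0.hasFDerivAt.add (hd.smul d1.hasFDerivAt)).add ((hd.pow 2).smul d2.hasFDerivAt)
  have heq : S.expansion ![v, v1, v2] = fun z : E3 × ℝ =>
      v (S.proj z.1 z.2) z.2 + Function.uncurry S.sdist z • v1 (S.proj z.1 z.2) z.2 +
        Function.uncurry S.sdist z ^ 2 • v2 (S.proj z.1 z.2) z.2 := by
    funext z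
    simp [expansion, Fin.sum_univ_three, Function.uncurry]
  have hfd := hsum.congr_of_eventuallyEq (f₁ := S.expansion ![v, v1, v2])
    (Eventually.of_forall fun z => congrFun heq z)
  have hsl : fderiv ℝ (fun x => v (S.proj x t) t) y w =
      fderiv ℝ (fun z : E3 × ℝ => v (S.proj z.1 z.2) z.2) (y, t) (w, 0) := by
    have : fderiv ℝ (fun x => v (S.proj x t) t) y = _ :=
      fderiv_slice (f := fun z : E3 × ℝ => v (S.proj z.1 z.2) z.2) d0
    rw [this]
    simp
  have hsd : fderiv ℝ (Function.uncurry S.sdist) (y, t) (w, 0) = inner ℝ (S.ν y t) w := by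
    rw [fderiv_sdist hz]
    simp [normalExt, hp]
  rw [hfd.fderiv, hsl]
  simp [Function.uncurry, hs0, hp, hsd]

/-- On the surface, the strain rate of the limit velocity is the projected tangential strain
rate. -/
theorem strainOf_expansion_surface {u : ℝ → E3 → ℝ → E3} (hu : S.HasExpansion u ![v, v1, v2])
    (hnormal : ∀ᶠ ε : ℝ in 𝓝[>] 0, S.Impermeable ε (u ε))
    (htan : ∀ᶠ ε : ℝ in 𝓝[>] 0, S.PerfectSlip ε (u ε)) {t : ℝ} (ht : t ∈ Ioo 0 T) {y : E3}
    (hy : y ∈ S.Γ t) :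
    strainOf (fderiv ℝ (S.expansion ![v, v1, v2]) (y, t)) =
      S.tanProj y t * S.tanStrain v y t * S.tanProj y t := by
  have hn := S.norm_normal (Ioo_subset_Icc_self ht) hy
  have hmv := matVec_strainOf_normal hu hnormal htan ht hy
  have hfd := fderiv_expansion_surface hu.coeff_smooth ht hy
  obtain ⟨ρ, hρ, hz⟩ := S.eventually_regularAt (z₀ := (y, t)) ⟨ht, hy⟩
  have ht' := Ioo_subset_Icc_self ht
  have hp := S.proj_of_mem ht' hy
  set n := S.ν y t with hndef
  have d0 : DifferentiableAt ℝ (fun z : E3 × ℝ => v (S.proj z.1 z.2) z.2) (y, t) :=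
    (contDiffAt_comp_proj (hu.coeff_smooth 0) hz).differentiableAt (by simp)
  have hνn : fderiv ℝ (fun x => v (S.proj x t) t) y n = 0 := by
    have h1 : fderiv ℝ (fun x => v (S.proj x t) t) y = _ :=
      fderiv_slice (f := fun z : E3 × ℝ => v (S.proj z.1 z.2) z.2) d0
    have h2 : S.normalExt (y, t) = n := by simp [normalExt, hp, hndef]
    have h3 := fderiv_comp_proj_normal hz
      (by simpa [S.sdist_of_mem ht' hy] using hρ) (c := v) d0
    rw [h2] at h3
    rw [h1]
    simpa using h3
  have hP : S.tanProj y t = 1 - Matrix.vecMulVec n.ofLp n.ofLp := rfl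
  have htg : S.tanGrad v y t = gradMatrix (fun x => v (S.proj x t) t) y :=
    S.tanProj_mul_gradMatrix hνn
  rw [hP, tanStrain, htg]
  -- The expansion adds the rank-one term from `ν` and `v1` to the tangential gradient, so the
  -- correction in the strain is its symmetrisation.
  refine eq_proj_mul_mul_proj (w := (v1 y t).ofLp) ?_ ?_ ?_ ?_
  · have h1 := real_inner_self_eq_norm_sq n
    rw [hn, one_pow, inner_eq_sum] at h1
    exact h1
  · ext i j
    have hei : ∀ k : Fin 3, inner ℝ n (e k) = n k := fun k => by
      simp [e, EuclideanSpace.inner_single_right]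
    simp only [strainOf, Matrix.of_apply, hfd, Matrix.add_apply, Matrix.smul_apply, gradMatrix,
      Matrix.transpose_apply, Matrix.vecMulVec_apply, hei, PiLp.add_apply, PiLp.smul_apply,
      smul_eq_mul]
    ring
  · have := congrArg WithLp.ofLp hmv
    simpa [matVec] using this
  · ext i j
    simp only [strainOf, Matrix.transpose_apply, Matrix.of_apply]
    ring

end Velocity

end MovingSurface

end

end ThinFluid

/-! ### Limits of the kinetic energy and the dissipation -/

namespace ThinFluid

noncomputable section

open scoped NNReal

theorem continuousOn_strain {f : E3 → ℝ → E3} {t : ℝ} {s : Set E3}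
    (h : ∀ x ∈ s, ContDiffAt ℝ ∞ (Function.uncurry f) (x, t)) :
    ContinuousOn (fun x => strain (fun y => f y t) x) s := by
  have h1 : ContinuousOn (fun x => strainOf (fderiv ℝ (Function.uncurry f) (x, t))) s := by
    intro x hx
    have h2 := (h x hx).continuousAt_fderiv (by simp)
    have h3 : ContinuousAt (fun x' : E3 => fderiv ℝ (Function.uncurry f) (x', t)) x :=
      ContinuousAt.comp (f := fun x' : E3 => (x', t)) h2 (by fun_prop)
    exact (continuous_strainOf.continuousAt.comp h3).continuousWithinAt
  exact h1.congr fun x hx =>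
    strain_slice (f := Function.uncurry f) ((h x hx).differentiableAt (by simp))

/-- Here `J` is the Jacobian and `w` the normal stress on one sheet, each known to second order;
hence so is their product. -/
theorem abs_mul_add_le {J w q q1 H r C K Q : ℝ} (hr : |r| ≤ 1) (hH : |H| ≤ C) (hq : |q| ≤ Q)
    (hq1 : |q1| ≤ Q) (hK : 0 ≤ K) (hJ : |J - (1 - r * H)| ≤ C * r ^ 2)
    (hw : |w + (q + r * q1)| ≤ K * r ^ 2) :
    |J * w + (1 - r * H) * (q + r * q1)| ≤ r ^ 2 * ((1 + C) * K + C * (2 * Q + K)) := by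
  have hC : 0 ≤ C := (abs_nonneg _).trans hH
  have hQ : 0 ≤ Q := (abs_nonneg _).trans hq
  have hr2 : r ^ 2 ≤ 1 := by
    rw [← sq_abs]
    exact pow_le_one₀ (abs_nonneg r) hr
  have h1 : |r * q1| ≤ Q := by
    rw [abs_mul]
    nlinarith [abs_nonneg r, abs_nonneg q1]
  have h2 : |1 - r * H| ≤ 1 + C := by
    have h3 : |r * H| ≤ C := by
      rw [abs_mul]
      nlinarith [abs_nonneg r, abs_nonneg H]
    have h4 := abs_sub (1 : ℝ) (r * H)
    rw [abs_one] at h4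
    linarith
  have h3 : |w| ≤ 2 * Q + K := by
    have h4 : |w| ≤ |w + (q + r * q1)| + |q + r * q1| := by
      have := abs_sub (w + (q + r * q1)) (q + r * q1)
      rwa [add_sub_cancel_right] at this
    have h5 := abs_add_le q (r * q1)
    nlinarith
  calc |J * w + (1 - r * H) * (q + r * q1)|
      = |(J - (1 - r * H)) * w + (1 - r * H) * (w + (q + r * q1))| := by congr 1; ring
    _ ≤ |J - (1 - r * H)| * |w| + |1 - r * H| * |w + (q + r * q1)| := by
      rw [← abs_mul, ← abs_mul]
      exact abs_add_le _ _
    _ ≤ (C * r ^ 2) * (2 * Q + K) + (1 + C) * (K * r ^ 2) := by gcongr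
    _ = _ := by ring

/-- The contributions of the two boundary components cancel to leading order. -/
theorem abs_boundary_sub_le {Jp Jm wp wm q q1 H V ε C K Q W : ℝ} (hε0 : 0 < ε) (hε : ε ≤ 1)
    (hH : |H| ≤ C) (hq : |q| ≤ Q) (hq1 : |q1| ≤ Q) (hV : |V| ≤ W) (hK : 0 ≤ K)
    (hJp : |Jp - (1 - ε * H)| ≤ C * ε ^ 2) (hJm : |Jm - (1 - -ε * H)| ≤ C * (-ε) ^ 2)
    (hwp : |wp + (q + ε * q1)| ≤ K * ε ^ 2) (hwm : |wm + (q + -ε * q1)| ≤ K * (-ε) ^ 2) :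
    |(2 * ε)⁻¹ * (Jp * (wp * V) + Jm * (wm * (-V))) - (q * H - q1) * V| ≤
      ε * ((1 + C) * K + C * (2 * Q + K)) * W := by
  have hp := abs_mul_add_le (by rwa [abs_of_pos hε0]) hH hq hq1 hK hJp hwp
  have hm := abs_mul_add_le (by rwa [abs_neg, abs_of_pos hε0]) hH hq hq1 hK hJm hwm
  set B := (1 + C) * K + C * (2 * Q + K) with hB
  set X := Jp * wp + (1 - ε * H) * (q + ε * q1) with hX
  set Y := Jm * wm + (1 - -ε * H) * (q + -ε * q1) with hY
  have hXY : |X - Y| ≤ 2 * ε ^ 2 * B := by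
    have := abs_sub X Y
    rw [neg_sq] at hm
    linarith
  -- The model terms differ by exactly `2 ε (q1 - q H)`, their `ε²` parts being equal, so only the
  -- errors `X` and `Y` remain.
  have e1 : (2 * ε)⁻¹ * (Jp * (wp * V) + Jm * (wm * (-V))) - (q * H - q1) * V =
      (2 * ε)⁻¹ * (X - Y) * V := by
    rw [hX, hY]
    field_simp
    ring
  rw [e1, abs_mul, abs_mul, abs_of_pos (by positivity : 0 < (2 * ε)⁻¹)]
  calc (2 * ε)⁻¹ * |X - Y| * |V| ≤ (2 * ε)⁻¹ * (2 * ε ^ 2 * B) * W := by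
        gcongr
        have := (abs_nonneg _).trans hXY
        positivity
    _ = ε * B * W := by
        field_simp

namespace MovingSurface

variable {T : ℝ} {S : MovingSurface T}

section Coefficients

variable {F : Type*} [NormedAddCommGroup F] [NormedSpace ℝ F] {c : E3 → ℝ → F}

theorem continuousOn_coeff (hc : ContDiffOn ℝ ∞ (Function.uncurry c) S.spaceTime) {t : ℝ}
    (ht : t ∈ Ioo 0 T) : ContinuousOn (fun y => c y t) (S.Γ t) :=
  hc.continuousOn.comp (f := fun y : E3 => (y, t)) (by fun_prop) fun _ hy => ⟨ht, hy⟩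

theorem Tube.exists_bound_coeff {a b ε₀ C : ℝ} (hτ : S.Tube a b ε₀ C)
    (hc : ContDiffOn ℝ ∞ (Function.uncurry c) S.spaceTime) :
    ∃ M, 0 ≤ M ∧ ∀ t ∈ Icc a b, ∀ y ∈ S.Γ t, ‖c y t‖ ≤ M :=
  hτ.exists_bound_surface (G := Function.uncurry c)
    (hc.continuousOn.mono fun _ hz => ⟨hτ.mem_Ioo hz.1, hz.2⟩)

end Coefficients

section Convergence

variable {X : Type*} [NormedAddCommGroup X]

theorem Tube.convergesToSurface {a b ε₀ C : ℝ} (hτ : S.Tube a b ε₀ C) {f : ℝ → E3 → ℝ → X}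
    {G : E3 × ℝ → X}
    (hG : ∀ t ∈ Icc a b, ∀ x, Metric.infDist x (S.Γ t) ≤ ε₀ → ContinuousAt G (x, t)) {M : ℝ}
    {m : ℕ} (hM : 0 ≤ M) (hm : m ≠ 0)
    (h : ∀ᶠ ε : ℝ in 𝓝[>] 0, ∀ t ∈ Icc a b, ∀ y ∈ S.Γ t, ∀ r, |r| ≤ ε →
      ‖f ε (displace (S.normalAt t) (y, r)) t - G (displace (S.normalAt t) (y, r), t)‖ ≤
        M * |r| ^ m) :
    S.ConvergesToSurface a b f (fun y t => G (y, t)) := by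
  intro η hη
  obtain ⟨δ, hδ, -, hδ'⟩ := hτ.exists_uniform_normal hG (half_pos hη)
  have hsmall : ∀ᶠ ε : ℝ in 𝓝[>] 0, M * ε ^ m < η / 2 := by
    have hc : Continuous fun ε : ℝ => M * ε ^ m := by fun_prop
    have ht := (hc.tendsto 0).mono_left (nhdsWithin_le_nhds (s := Ioi 0))
    simp only [zero_pow hm, mul_zero] at ht
    exact ht.eventually_lt_const (by positivity)
  filter_upwards [h, hsmall, Ioo_mem_nhdsGT hδ] with ε h1 h2 h3 t ht y hy r hr
  have h4 := h1 t ht y hy r hr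
  have h5 := hδ' t ht y hy r (hr.trans_lt h3.2)
  have h6 : M * |r| ^ m ≤ M * ε ^ m := by gcongr
  have h7 := norm_sub_le_norm_sub_add_norm_sub (f ε (displace (S.normalAt t) (y, r)) t)
    (G (displace (S.normalAt t) (y, r), t)) (G (y, t))
  linarith

variable {F : Type*} [NormedAddCommGroup F] [NormedSpace ℝ F]

theorem HasExpansion.convergesToSurface {a b ε₀ C : ℝ} (hτ : S.Tube a b ε₀ C) {k : ℕ}
    (hk : 1 ≤ k) {f : ℝ → E3 → ℝ → F} {c : Fin k → E3 → ℝ → F} (hf : S.HasExpansion f c) :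
    S.ConvergesToSurface a b f (fun y t => S.expansion c (y, t)) := by
  obtain ⟨M, hM0, hM⟩ := hf.exists_remainder_bound hτ hk
  refine hτ.convergesToSurface (fun t ht x hx => ?_) hM0 (by omega : k ≠ 0)
    (hM.mono fun ε h t ht y hy r hr => (h t ht y hy r hr).1)
  exact (contDiffAt_expansion hf.coeff_smooth (hτ.regular t ht x hx)).continuousAt

/-- Differentiation costs one power of `|r|` in the remainder, hence `2 ≤ k`. -/
theorem HasExpansion.convergesToSurface_fderiv {a b ε₀ C : ℝ} (hτ : S.Tube a b ε₀ C) {k : ℕ}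
    (hk : 2 ≤ k) {f : ℝ → E3 → ℝ → F} {c : Fin k → E3 → ℝ → F} (hf : S.HasExpansion f c) :
    S.ConvergesToSurface a b (fun ε x t => fderiv ℝ (Function.uncurry (f ε)) (x, t))
      (fun y t => fderiv ℝ (S.expansion c) (y, t)) := by
  obtain ⟨M, hM0, hM⟩ := hf.exists_remainder_bound hτ (by omega)
  refine hτ.convergesToSurface (G := fderiv ℝ (S.expansion c)) (fun t ht x hx => ?_) hM0
    (by omega : k - 1 ≠ 0) (hM.mono fun ε h t ht y hy r hr => (h t ht y hy r hr).2)
  exact (contDiffAt_expansion hf.coeff_smooth (hτ.regular t ht x hx)).continuousAt_fderiv (by simp)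

end Convergence

section Limits

variable {a b ε₀ C : ℝ} {u : ℝ → E3 → ℝ → E3} {p : ℝ → E3 → ℝ → ℝ} {v v1 v2 : E3 → ℝ → E3}
  {q q1 : E3 → ℝ → ℝ}

theorem Tube.expansion_surface (hτ : S.Tube a b ε₀ C) {t : ℝ} (ht : t ∈ Icc a b) {y : E3}
    (hy : y ∈ S.Γ t) : S.expansion ![v, v1, v2] (y, t) = v y t := by
  have h := hτ.expansion_displace_three (v := v) (v1 := v1) (v2 := v2) ht hy (r := 0)
    (by simpa using hτ.pos.le)
  simpa [displace] using h

theorem Tube.tendsto_energy (hτ : S.Tube a b ε₀ C) (hu : S.HasExpansion u ![v, v1, v2]) :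
    ∀ η > 0, ∀ᶠ ε : ℝ in 𝓝[>] 0, ∀ t ∈ Icc a b,
      |(2 * ε)⁻¹ * (∫ x in S.Ω ε t, ‖u ε x t‖ ^ 2 / 2) -
        ∫ y in S.Γ t, ‖v y t‖ ^ 2 / 2 ∂μHE[2]| ≤ η := by
  have hv : ContDiffOn ℝ ∞ (Function.uncurry v) S.spaceTime := hu.coeff_smooth 0
  obtain ⟨M, hM0, hM⟩ := hτ.exists_bound_coeff hv
  have h1 : S.ConvergesToSurface a b u v := fun η hη =>
    (hu.convergesToSurface hτ (by norm_num) η hη).mono fun ε h t ht y hy r hr => by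
      have := h t ht y hy r hr
      simp only [hτ.expansion_surface ht hy] at this
      exact this
  have h2 := h1.comp hM (Φ := fun w : E3 => ‖w‖ ^ 2 / 2) (by fun_prop)
  refine hτ.tendsto_setIntegral_Ω h2 (M := M ^ 2 / 2) (fun t ht y hy => ?_) ?_ fun t ht => ?_
  · rw [Real.norm_of_nonneg (by positivity)]
    have := hM t ht y hy
    gcongr
  · filter_upwards [hu.smooth] with ε hε t ht x hx
    have h3 : ContinuousAt (fun x' : E3 => u ε x' t) x :=
      ContinuousAt.comp (f := fun x' : E3 => (x', t))
        (hε t (hτ.mem_Ioo ht) x (subset_closure hx)).continuousAt (by fun_prop)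
    exact ((h3.norm.pow 2).div_const 2).continuousWithinAt
  · exact ((continuousOn_coeff hv (hτ.mem_Ioo ht)).norm.pow 2).div_const 2

/-- The derivative of `u` converges to that of the expansion; the boundary conditions serve only to
identify the limiting strain. -/
theorem Tube.tendsto_dissipation (hτ : S.Tube a b ε₀ C) (hu : S.HasExpansion u ![v, v1, v2])
    (hnormal : ∀ᶠ ε : ℝ in 𝓝[>] 0, S.Impermeable ε (u ε))
    (htan : ∀ᶠ ε : ℝ in 𝓝[>] 0, S.PerfectSlip ε (u ε)) :
    ∀ η > 0, ∀ᶠ ε : ℝ in 𝓝[>] 0, ∀ t ∈ Icc a b,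
      |(2 * ε)⁻¹ * (∫ x in S.Ω ε t, frobSq (strain (fun y => u ε y t) x)) -
        ∫ y in S.Γ t, frobSq (S.tanProj y t * S.tanStrain v y t * S.tanProj y t) ∂μHE[2]| ≤ η := by
  have hec : ∀ t ∈ Icc a b, ∀ y ∈ S.Γ t,
      ContinuousAt (fderiv ℝ (S.expansion ![v, v1, v2])) (y, t) := fun t ht y hy =>
    (contDiffAt_expansion hu.coeff_smooth (hτ.regular t ht y
      (by rw [Metric.infDist_zero_of_mem hy]; exact hτ.pos.le))).continuousAt_fderiv (by simp)
  obtain ⟨M, hM0, hM⟩ := hτ.exists_bound_surface (G := fderiv ℝ (S.expansion ![v, v1, v2]))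
    fun z hz => (hec z.2 hz.1 z.1 hz.2).continuousWithinAt
  have hΦ : Continuous fun L : E3 × ℝ →L[ℝ] E3 => frobSq (strainOf L) :=
    continuous_frobSq.comp continuous_strainOf
  have : ProperSpace (E3 × ℝ →L[ℝ] E3) := FiniteDimensional.proper ℝ _
  have h1 := (hu.convergesToSurface_fderiv hτ (by norm_num)).comp hM hΦ
  obtain ⟨M', -, hM'⟩ := hτ.exists_bound_surface
    (G := fun z => frobSq (strainOf (fderiv ℝ (S.expansion ![v, v1, v2]) z)))
    fun z hz => (hΦ.continuousAt.comp (hec z.2 hz.1 z.1 hz.2)).continuousWithinAt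
  have hopen : ∀ ε t, IsOpen (S.Ω ε t) := fun ε t =>
    isOpen_lt (Metric.continuous_infDist_pt _) continuous_const
  have h2 := hτ.tendsto_setIntegral_Ω h1 hM' ?_ fun t ht y hy => ?_
  · intro η hη
    filter_upwards [h2 η hη, hu.smooth] with ε h3 h4 t ht
    have h5 := h3 t ht
    have e1 : ∫ x in S.Ω ε t, frobSq (strain (fun y => u ε y t) x) =
        ∫ x in S.Ω ε t, frobSq (strainOf (fderiv ℝ (Function.uncurry (u ε)) (x, t))) :=
      setIntegral_congr_fun (hopen ε t).measurableSet fun x hx => congrArg frobSq <|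
        strain_slice (f := Function.uncurry (u ε))
          ((h4 t (hτ.mem_Ioo ht) x (subset_closure hx)).differentiableAt (by simp))
    have e2 : ∫ y in S.Γ t, frobSq (S.tanProj y t * S.tanStrain v y t * S.tanProj y t) ∂μHE[2] =
        ∫ y in S.Γ t, frobSq (strainOf (fderiv ℝ (S.expansion ![v, v1, v2]) (y, t))) ∂μHE[2] :=
      setIntegral_congr_fun (S.normalField (hτ.mem_Ioo ht)).isCompact.measurableSet
        fun y hy => congrArg frobSq
          (strainOf_expansion_surface hu hnormal htan (hτ.mem_Ioo ht) hy).symm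
    rwa [e1, e2]
  · filter_upwards [hu.smooth] with ε hε t ht x hx
    have h3 := (hε t (hτ.mem_Ioo ht) x (subset_closure hx)).continuousAt_fderiv (by simp)
    have h4 : ContinuousAt (fun x' : E3 => fderiv ℝ (Function.uncurry (u ε)) (x', t)) x :=
      ContinuousAt.comp (f := fun x' : E3 => (x', t)) h3 (by fun_prop)
    exact (hΦ.continuousAt.comp h4).continuousWithinAt
  · have h4 : ContinuousAt (fun x' : E3 => fderiv ℝ (S.expansion ![v, v1, v2]) (x', t)) y :=
      ContinuousAt.comp (f := fun x' : E3 => (x', t)) (hec t ht y hy) (by fun_prop)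
    exact (hΦ.continuousAt.comp h4).continuousWithinAt

end Limits

end MovingSurface

end

end ThinFluid

/-! ### Limit of the boundary work -/

namespace ThinFluid

noncomputable section

open scoped NNReal

namespace MovingSurface

variable {T : ℝ} {S : MovingSurface T}

theorem inner_matVec_stress (μ₀ : ℝ) (u : E3 → ℝ → E3) (p : E3 → ℝ → ℝ) (x : E3) (t : ℝ) (n : E3) :
    inner ℝ (matVec (stress μ₀ u p x t) n) n =
      2 * μ₀ * inner ℝ (matVec (strain (fun y => u y t) x) n) n - p x t * inner ℝ n n := by
  have h : matVec (stress μ₀ u p x t) n =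
      (2 * μ₀) • matVec (strain (fun y => u y t) x) n - p x t • n := by
    simp [stress, matVec, Matrix.sub_mulVec, Matrix.smul_mulVec]
  rw [h, inner_sub_left, inner_smul_left, inner_smul_left]
  simp

section Continuity

variable {ρ : ℝ} {x : E3} {t : ℝ} (hz : ∀ᶠ w in 𝓝 (x, t), S.RegularAt ρ w)
include hz

theorem eventually_signed {σ : ℝ} (hσ : 0 < σ * S.sdist x t) :
    ∀ᶠ x' in 𝓝 x, (∀ᶠ w in 𝓝 (x', t), S.RegularAt ρ w) ∧ 0 < σ * S.sdist x' t := by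
  have hslice : Tendsto (fun x' : E3 => (x', t)) (𝓝 x) (𝓝 (x, t)) :=
    Continuous.tendsto (by fun_prop) x
  have hc : ContinuousAt (fun w => σ * Function.uncurry S.sdist w) (x, t) :=
    hz.self_of_nhds.contDiffAt_sdist.continuousAt.const_mul σ
  exact hslice.eventually (hz.eventually_nhds.and (hc.eventually_const_lt hσ))

theorem continuousAt_bdryNormal {σ : ℝ} (hσ : 0 < σ * S.sdist x t) (hσ1 : |σ| = 1) :
    ContinuousAt (fun x' => S.bdryNormal x' t) x := by
  have h1 : ContinuousAt (fun x' : E3 => S.normalExt (x', t)) x :=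
    ContinuousAt.comp (g := S.normalExt) (f := fun x' : E3 => (x', t))
      hz.self_of_nhds.contDiffAt_normal.continuousAt (by fun_prop)
  refine (h1.const_smul σ).congr ?_
  filter_upwards [eventually_signed hz hσ] with x' hx'
  exact (bdryNormal_eq hx'.1 hx'.2 hσ1).symm

/-- `V` itself carries no continuity assumption; the velocity is continuous as the time derivative
of the `C¹` signed distance, up to sign. -/
theorem continuousAt_bdryVelocity {σ : ℝ} (hσ : 0 < σ * S.sdist x t) (hσ1 : |σ| = 1) :
    ContinuousAt (fun x' => S.bdryVelocity x' t) x := by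
  have h1 : ContinuousAt (fun x' : E3 => fderiv ℝ (Function.uncurry S.sdist) (x', t)) x :=
    ContinuousAt.comp (g := fderiv ℝ (Function.uncurry S.sdist)) (f := fun x' : E3 => (x', t))
      (hz.self_of_nhds.contDiffAt_sdist.continuousAt_fderiv (by simp)) (by fun_prop)
  have h2 : ContinuousAt (fun x' : E3 =>
      -(σ * fderiv ℝ (Function.uncurry S.sdist) (x', t) ((0, 1) : E3 × ℝ))) x :=
    ((h1.clm_apply continuousAt_const).const_mul σ).neg
  refine h2.congr ?_
  filter_upwards [eventually_signed hz hσ] with x' hx'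
  rw [bdryVelocity_eq hx'.1 hx'.2 hσ1, fderiv_sdist hx'.1]
  simp

end Continuity

theorem continuousOn_meanCurv {t : ℝ} (ht : t ∈ Ioo 0 T) :
    ContinuousOn (fun y => S.meanCurv y t) (S.Γ t) := by
  have h := (S.normalField ht).continuousOn_deriv
  refine ContinuousOn.congr (f := fun y => -∑ i, (S.weingarten t y (e i)) i) ?_ fun y hy =>
    S.meanCurv_eq ht hy
  have h1 : ∀ i, ContinuousOn (fun y => (S.weingarten t y (e i)) i) (S.Γ t) := fun i =>
    (PiLp.continuous_apply 2 (fun _ : Fin 3 => ℝ) i).comp_continuousOn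
      (h.clm_apply continuousOn_const)
  exact (continuousOn_finsetSum _ fun i _ => h1 i).neg

section Boundary

variable {a b ε₀ C : ℝ} {u : ℝ → E3 → ℝ → E3} {p : ℝ → E3 → ℝ → ℝ} {v v1 v2 : E3 → ℝ → E3}
  {q q1 : E3 → ℝ → ℝ}

theorem Tube.exists_signed (hτ : S.Tube a b ε₀ C) {t : ℝ} (ht : t ∈ Icc a b) {ε : ℝ} (hε0 : 0 < ε)
    (hε : ε ≤ ε₀) {x : E3} (hx : x ∈ frontier (S.Ω ε t)) :
    ∃ σ : ℝ, |σ| = 1 ∧ 0 < σ * S.sdist x t ∧ ∀ᶠ w in 𝓝 (x, t), S.RegularAt (2 * ε₀) w := by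
  have h1 : |ε| ≤ ε₀ := by rwa [abs_of_pos hε0]
  have h2 : |-ε| ≤ ε₀ := by rwa [abs_neg]
  rw [hτ.frontier_Ω ht hε0 hε] at hx
  rcases hx with ⟨y, hy, rfl⟩ | ⟨y, hy, rfl⟩
  · exact ⟨1, by simp, by simpa [hτ.sdist_displace ht hy h1] using hε0,
      hτ.regular_displace ht hy h1⟩
  · exact ⟨-1, by simp, by simpa [hτ.sdist_displace ht hy h2] using hε0,
      hτ.regular_displace ht hy h2⟩

theorem Tube.continuousOn_boundary (hτ : S.Tube a b ε₀ C) {t : ℝ} (ht : t ∈ Icc a b) {ε : ℝ}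
    (hε0 : 0 < ε) (hε : ε ≤ ε₀) (μ₀ : ℝ) {u : E3 → ℝ → E3} {p : E3 → ℝ → ℝ}
    (hu : ∀ x ∈ closure (S.Ω ε t), ContDiffAt ℝ ∞ (Function.uncurry u) (x, t))
    (hp : ∀ x ∈ closure (S.Ω ε t), ContDiffAt ℝ ∞ (Function.uncurry p) (x, t)) :
    ContinuousOn (fun x => inner ℝ (matVec (stress μ₀ u p x t) (S.bdryNormal x t))
      (S.bdryNormal x t) * S.bdryVelocity x t) (frontier (S.Ω ε t)) := by
  have hn : ContinuousOn (fun x => S.bdryNormal x t) (frontier (S.Ω ε t)) := fun x hx => by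
    obtain ⟨σ, h1, h2, h3⟩ := hτ.exists_signed ht hε0 hε hx
    exact (continuousAt_bdryNormal h3 h2 h1).continuousWithinAt
  have hV : ContinuousOn (fun x => S.bdryVelocity x t) (frontier (S.Ω ε t)) := fun x hx => by
    obtain ⟨σ, h1, h2, h3⟩ := hτ.exists_signed ht hε0 hε hx
    exact (continuousAt_bdryVelocity h3 h2 h1).continuousWithinAt
  have hs := continuousOn_strain fun x hx => hu x (frontier_subset_closure hx)
  have hpc : ContinuousOn (fun x => p x t) (frontier (S.Ω ε t)) := fun x hx =>
    (ContinuousAt.comp (f := fun x' : E3 => (x', t))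
      (hp x (frontier_subset_closure hx)).continuousAt (by fun_prop)).continuousWithinAt
  have hm : ContinuousOn (fun x => matVec (strain (fun y => u y t) x) (S.bdryNormal x t))
      (frontier (S.Ω ε t)) := continuous_matVec.comp_continuousOn (hs.prodMk hn)
  simp only [inner_matVec_stress]
  exact (((hm.inner hn).const_mul _).sub (hpc.mul (hn.inner hn))).mul hV

/-- The sign `σ` enters the normal stress twice and cancels; it remains in the velocity, which makes
the two sheets subtract. -/
theorem Tube.boundary_displace (hτ : S.Tube a b ε₀ C) {t : ℝ} (ht : t ∈ Icc a b) {ε : ℝ}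
    (hε0 : 0 < ε) (hε : ε ≤ ε₀) (μ₀ : ℝ) {u : E3 → ℝ → E3} {p : E3 → ℝ → ℝ}
    (hu : ∀ x ∈ closure (S.Ω ε t), ContDiffAt ℝ ∞ (Function.uncurry u) (x, t)) {y : E3}
    (hy : y ∈ S.Γ t) {σ : ℝ} (hσ : σ = 1 ∨ σ = -1) {x : E3}
    (hx : x = displace (S.normalAt t) (y, σ * ε)) :
    inner ℝ (matVec (stress μ₀ u p x t) (S.bdryNormal x t)) (S.bdryNormal x t) *
        S.bdryVelocity x t =
      (2 * μ₀ * inner ℝ (fderiv ℝ (Function.uncurry u) (x, t) (S.ν y t, 0)) (S.ν y t) - p x t) *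
        (σ * S.V y t) := by
  have hfr := hτ.displace_mem_frontier ht hε0 hε hy hσ
  have hbn := hτ.bdryNormal_displace ht hε0 hε hy hσ
  have hbv := hτ.bdryVelocity_displace ht hε0 hε hy hσ
  rw [← hx] at hfr hbn hbv
  have hstr : strain (fun y => u y t) x = strainOf (fderiv ℝ (Function.uncurry u) (x, t)) :=
    strain_slice (f := Function.uncurry u)
      ((hu x (frontier_subset_closure hfr)).differentiableAt (by simp))
  have hσσ : σ * σ = 1 := by rcases hσ with rfl | rfl <;> norm_num
  have hsm : ((σ • S.ν y t, 0) : E3 × ℝ) = σ • (S.ν y t, 0) := by simp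
  rw [inner_matVec_stress, hbn, hbv, hstr, inner_matVec_strainOf, hsm, map_smul,
    inner_smul_left, inner_smul_right, inner_smul_left, inner_smul_right,
    real_inner_self_eq_norm_sq, S.norm_normal (hτ.mem_Icc ht) hy]
  simp only [conj_trivial, one_pow, mul_one, hσσ, ← mul_assoc]

/-- After division by `2ε` every ingredient is needed up to `O(ε²)`. The viscous normal stress is of
that size because the normal derivative of the expansion has no normal component, so only pressure
and curvature reach the limit. -/
theorem Tube.tendsto_boundary (hτ : S.Tube a b ε₀ C) {μ₀ : ℝ} (hμ₀ : 0 ≤ μ₀)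
    (hu : S.HasExpansion u ![v, v1, v2]) (hp : S.HasExpansion p ![q, q1])
    (hnormal : ∀ᶠ ε : ℝ in 𝓝[>] 0, S.Impermeable ε (u ε)) :
    ∀ η > 0, ∀ᶠ ε : ℝ in 𝓝[>] 0, ∀ t ∈ Icc a b,
      |(2 * ε)⁻¹ * (∫ x in frontier (S.Ω ε t),
          inner ℝ (matVec (stress μ₀ (u ε) (p ε) x t) (S.bdryNormal x t)) (S.bdryNormal x t) *
            S.bdryVelocity x t ∂μHE[2]) -
        ∫ y in S.Γ t, (q y t * S.meanCurv y t - q1 y t) * S.V y t ∂μHE[2]| ≤ η := by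
  intro η hη
  have hv : ContDiffOn ℝ ∞ (Function.uncurry v) S.spaceTime := hu.coeff_smooth 0
  have hq : ContDiffOn ℝ ∞ (Function.uncurry q) S.spaceTime := hp.coeff_smooth 0
  have hq1 : ContDiffOn ℝ ∞ (Function.uncurry q1) S.spaceTime := hp.coeff_smooth 1
  obtain ⟨A, hA⟩ := hτ.exists_area_bound
  obtain ⟨W, hW0, hW⟩ := hτ.exists_bound_coeff hv
  obtain ⟨Q₀, hQ₀0, hQ₀⟩ := hτ.exists_bound_coeff hq
  obtain ⟨Q₁, hQ₁0, hQ₁⟩ := hτ.exists_bound_coeff hq1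
  obtain ⟨Mu, hMu0, hMu⟩ := hu.exists_remainder_bound hτ (by norm_num)
  obtain ⟨Mp, hMp0, hMp⟩ := hp.exists_remainder_bound hτ (by norm_num)
  set K := 2 * μ₀ * Mu + Mp with hK
  have hK0 : 0 ≤ K := by positivity
  set Q := Q₀ + Q₁ with hQ
  set B := ((1 + C) * K + C * (2 * Q + K)) * W with hB
  have hsmall : ∀ᶠ ε : ℝ in 𝓝[>] 0, ε * B * A < η := by
    have hc : Continuous fun ε : ℝ => ε * B * A := by fun_prop
    have ht := (hc.tendsto 0).mono_left (nhdsWithin_le_nhds (s := Ioi 0))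
    simp only [zero_mul] at ht
    exact ht.eventually_lt_const hη
  filter_upwards [hMu, hMp, hu.smooth, hp.smooth, hsmall, Ioo_mem_nhdsGT hτ.pos] with
    ε hMu hMp hus hps hsm hε t ht
  have ht' := hτ.mem_Ioo ht
  have hC := hτ.const_nonneg ht
  have hVeq : ∀ y ∈ S.Γ t, inner ℝ (v y t) (S.ν y t) = S.V y t := fun y hy =>
    (inner_coeff_eq hu hnormal ht' hy).1
  -- Continuity and boundedness of `V` are taken from `V = v · ν`.
  have hVc : ContinuousOn (fun y => S.V y t) (S.Γ t) := by
    have hνc : ContinuousOn (S.normalAt t) (S.Γ t) := fun y hy =>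
      ((S.normalField ht').hasStrictFDerivAt y hy).continuousAt.continuousWithinAt
    refine ((continuousOn_coeff hv ht').inner hνc).congr fun y hy => ?_
    simp only [S.normalAt_of_mem (hτ.mem_Icc ht) hy, hVeq y hy]
  have hfc : ContinuousOn (fun y => (q y t * S.meanCurv y t - q1 y t) * S.V y t) (S.Γ t) :=
    (((continuousOn_coeff hq ht').mul (continuousOn_meanCurv ht')).sub
      (continuousOn_coeff hq1 ht')).mul hVc
  have hside : ∀ y ∈ S.Γ t, ∀ r, |r| = ε →
      |(2 * μ₀ * inner ℝ (fderiv ℝ (Function.uncurry (u ε)) (displace (S.normalAt t) (y, r), t)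
          (S.ν y t, 0)) (S.ν y t) - p ε (displace (S.normalAt t) (y, r)) t) +
        (q y t + r * q1 y t)| ≤ K * r ^ 2 := by
    intro y hy r hr
    have hrε : |r| ≤ ε₀ := hr.le.trans hε.2.le
    obtain ⟨-, hv1, hv2⟩ := inner_coeff_eq hu hnormal ht' hy
    have hn := S.norm_normal (hτ.mem_Icc ht) hy
    have h1 := (hMu t ht y hy r hr.le).2
    have h2 := (hMp t ht y hy r hr.le).1
    rw [hτ.expansion_displace ht hy hrε, Fin.sum_univ_two, sq_abs] at h2
    have h3 := hτ.fderiv_expansion_normal hu.coeff_smooth ht hy hrε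
    set x := displace (S.normalAt t) (y, r)
    set L := fderiv ℝ (Function.uncurry (u ε)) (x, t)
    set L' := fderiv ℝ (S.expansion ![v, v1, v2]) (x, t)
    have h4 : inner ℝ (L (S.ν y t, 0)) (S.ν y t) =
        inner ℝ ((L - L') (S.ν y t, 0)) (S.ν y t) := by
      rw [sub_apply, inner_sub_left, h3, inner_add_left, inner_smul_left, hv1, hv2]
      simp
    have h5 : |inner ℝ (L (S.ν y t, 0)) (S.ν y t)| ≤ Mu * r ^ 2 := by
      rw [h4]
      have h6 := abs_real_inner_le_norm ((L - L') (S.ν y t, 0)) (S.ν y t)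
      have h7 := (L - L').le_opNorm (S.ν y t, 0)
      have h8 : ‖((S.ν y t, 0) : E3 × ℝ)‖ = 1 := by simp [Prod.norm_def, hn]
      rw [h8, mul_one] at h7
      rw [hn, mul_one] at h6
      norm_num at h1
      linarith
    have h6 : |p ε x t - (q y t + r * q1 y t)| ≤ Mp * r ^ 2 := by
      simpa using h2
    calc |2 * μ₀ * inner ℝ (L (S.ν y t, 0)) (S.ν y t) - p ε x t + (q y t + r * q1 y t)|
        = |2 * μ₀ * inner ℝ (L (S.ν y t, 0)) (S.ν y t) - (p ε x t - (q y t + r * q1 y t))| := by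
          congr 1; ring
      _ ≤ |2 * μ₀ * inner ℝ (L (S.ν y t, 0)) (S.ν y t)| + |p ε x t - (q y t + r * q1 y t)| :=
          abs_sub _ _
      _ ≤ 2 * μ₀ * (Mu * r ^ 2) + Mp * r ^ 2 := by
          rw [abs_mul, abs_of_nonneg (by positivity : 0 ≤ 2 * μ₀)]
          gcongr
      _ = K * r ^ 2 := by rw [hK]; ring
  have hεabs : |ε| = ε := abs_of_pos hε.1
  refine (hτ.abs_setIntegral_frontier_sub_le ht hε.1 hε.2.le (η := ε * B)
    (hτ.continuousOn_boundary ht hε.1 hε.2.le μ₀ (hus t ht') (hps t ht')) hfc ?_).trans ?_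
  · intro y hy
    have hx1 : displace (S.normalAt t) (y, ε) = displace (S.normalAt t) (y, 1 * ε) := by
      rw [one_mul]
    have hx2 : displace (S.normalAt t) (y, -ε) = displace (S.normalAt t) (y, -1 * ε) := by
      rw [neg_one_mul]
    simp only [hτ.boundary_displace ht hε.1 hε.2.le μ₀ (hus t ht') hy (Or.inl rfl) hx1,
      hτ.boundary_displace ht hε.1 hε.2.le μ₀ (hus t ht') hy (Or.inr rfl) hx2, one_mul,
      neg_one_mul]
    have hVW : |S.V y t| ≤ W := by
      have h1 := abs_real_inner_le_norm (v y t) (S.ν y t)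
      rw [hVeq y hy, S.norm_normal (hτ.mem_Icc ht) hy, mul_one] at h1
      exact h1.trans (hW t ht y hy)
    rw [hB, ← mul_assoc ε]
    have h1 := hQ₀ t ht y hy
    have h2 := hQ₁ t ht y hy
    rw [Real.norm_eq_abs] at h1 h2
    have h3 : |q y t| ≤ Q := by linarith
    have h4 : |q1 y t| ≤ Q := by linarith
    exact abs_boundary_sub_le hε.1 (hε.2.le.trans hτ.le_one) (hτ.abs_meanCurv_le t ht y hy)
      h3 h4 hVW hK0
      (hτ.abs_jac_sub_le t ht y hy ε (by rw [hεabs]; exact hε.2.le))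
      (hτ.abs_jac_sub_le t ht y hy (-ε) (by rw [abs_neg, hεabs]; exact hε.2.le))
      (hside y hy ε hεabs) (hside y hy (-ε) (by rw [abs_neg, hεabs]))
  · have hεpos := hε.1
    have hB0 : 0 ≤ ε * B := by positivity
    exact (mul_le_mul_of_nonneg_left (hA t ht) hB0).trans hsm.le

end Boundary

end MovingSurface

end

end ThinFluid

/-! ### Passage to the limit in the energy identity -/

theorem theorem5p6 {T μ₀ : ℝ} (hT : 0 < T) (hμ₀ : 0 < μ₀) (S : ThinFluid.MovingSurface T)
    (u : ℝ → ThinFluid.E3 → ℝ → ThinFluid.E3) (p : ℝ → ThinFluid.E3 → ℝ → ℝ)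
    (v v1 v2 : ThinFluid.E3 → ℝ → ThinFluid.E3) (q q1 : ThinFluid.E3 → ℝ → ℝ)
    (hu : S.HasExpansion u ![v, v1, v2])
    (hp : S.HasExpansion p ![q, q1])
    (henergy : ∀ᶠ ε : ℝ in 𝓝[>] 0, S.BulkEnergyIdentity μ₀ ε (u ε) (p ε))
    (hnormal : ∀ᶠ ε : ℝ in 𝓝[>] 0, S.Impermeable ε (u ε))
    (htan : ∀ᶠ ε : ℝ in 𝓝[>] 0, S.PerfectSlip ε (u ε)) :
    S.SurfaceEnergyIdentity μ₀ v q q1 := by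
  intro t ht
  obtain ⟨a, ha0, hat⟩ := exists_between ht.1
  obtain ⟨b, htb, hbT⟩ := exists_between ht.2
  obtain ⟨ε₀, C, hτ⟩ := S.exists_tube ha0 hbT
  have hE := hτ.tendsto_energy hu
  have hD := hτ.tendsto_dissipation hu hnormal htan
  have hB := hτ.tendsto_boundary hμ₀.le hu hp hnormal
  have hfd : ∀ᶠ ε : ℝ in 𝓝[>] 0, ∀ s ∈ Ioo a b, HasDerivAt
      (fun s => (2 * ε)⁻¹ * ∫ x in S.Ω ε s, ‖u ε x s‖ ^ 2 / 2) _ s :=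
    henergy.mono fun ε h s hs =>
      (h s (hτ.mem_Ioo (Ioo_subset_Icc_self hs))).const_mul (2 * ε)⁻¹
  refine hasDerivAt_of_tendstoUniformlyOn (l := 𝓝[>] (0 : ℝ)) isOpen_Ioo ?_ hfd ?_ ⟨hat, htb⟩
    (g' := fun s => -(2 * μ₀) * (∫ y in S.Γ s,
        ThinFluid.frobSq (S.tanProj y s * S.tanStrain v y s * S.tanProj y s) ∂μHE[2]) +
      ∫ y in S.Γ s, (q y s * S.meanCurv y s - q1 y s) * S.V y s ∂μHE[2])
  · rw [Metric.tendstoUniformlyOn_iff]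
    intro η hη
    -- The factor `2 * μ₀` turns the first tolerance into `η / 4`, so the total error is at most `η
    -- / 2`.
    filter_upwards [hD (η / (8 * μ₀)) (by positivity), hB (η / 4) (by positivity)]
      with ε h1 h2 s hs
    have h3 := h1 s (Ioo_subset_Icc_self hs)
    have h4 := h2 s (Ioo_subset_Icc_self hs)
    rw [dist_comm, Real.dist_eq]
    set ID := ∫ x in S.Ω ε s, ThinFluid.frobSq (ThinFluid.strain (fun y => u ε y s) x)
    set IB := ∫ x in frontier (S.Ω ε s), inner ℝ (ThinFluid.matVec
      (ThinFluid.MovingSurface.stress μ₀ (u ε) (p ε) x s) (S.bdryNormal x s)) (S.bdryNormal x s) *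
        S.bdryVelocity x s ∂μHE[2]
    set JD := ∫ y in S.Γ s,
      ThinFluid.frobSq (S.tanProj y s * S.tanStrain v y s * S.tanProj y s) ∂μHE[2]
    set JB := ∫ y in S.Γ s, (q y s * S.meanCurv y s - q1 y s) * S.V y s ∂μHE[2]
    have h5 : |(2 * μ₀) * ((2 * ε)⁻¹ * ID - JD)| ≤ η / 4 := by
      rw [abs_mul, abs_of_pos (by positivity : 0 < 2 * μ₀)]
      calc 2 * μ₀ * |(2 * ε)⁻¹ * ID - JD| ≤ 2 * μ₀ * (η / (8 * μ₀)) := by gcongr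
        _ = η / 4 := by field_simp; norm_num
    have h6 : (2 * ε)⁻¹ * (-(2 * μ₀) * ID + IB) - (-(2 * μ₀) * JD + JB) =
        ((2 * ε)⁻¹ * IB - JB) - (2 * μ₀) * ((2 * ε)⁻¹ * ID - JD) := by ring
    rw [h6]
    refine (abs_sub _ _).trans_lt ?_
    linarith
  · intro s hs
    rw [Metric.tendsto_nhds]
    intro η hη
    filter_upwards [hE (η / 2) (half_pos hη)] with ε h1
    rw [Real.dist_eq]
    exact (h1 s (Ioo_subset_Icc_self hs)).trans_lt (half_lt_self hη)
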